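/- Let $\pi\colon E\to M$ be a smooth fibred manifold (surjective submersion; for instance a smooth bundle) with $\dim M=m$ and $\dim E=m+n$, let $\eta$ be a volume form on $M$ (a smooth nowhere vanishing $m$-form), and let $L\in C^\infty(J^2\pi)$ be a second-order Lagrangian function, with Lagrangian density $\mathcal L=L\,\eta$. Denote by $J^k\pi$ the manifold of $k$-jets of local sections of $\pi$. Let $J^2\pi^\dagger\to J^1\pi$ be the extended symmetric multimomentum bundle: its fibre over $j\in J^1\pi$ consists of the $m$-covectors $\omega\in\Lambda^mT^*_j(J^1\pi)$ that vanish whenever two arguments are vertical over $M$, and whose coefficients $p_\alpha^{ij}$ of $du_i^\alpha\wedge d^{m-1}x_j$ satisfy $p_\alpha^{ij}=p_\alpha^{ji}$ in natural coordinates $(x^i,u^\alpha,u^\alpha_i)$. Let $J^2\pi^\ddagger$ be the quotient of $J^2\pi^\dagger$ by the semibasic forms (those that vanish whenever one argument is vertical over $M$). Put $$W=J^3\pi\times_{J^1\pi}J^2\pi^\dagger,\qquad W_r=J^3\pi\times_{J^1\pi}J^2\pi^\ddagger,$$ with their natural smooth structures, and let $\mu_W\colon W\to W_r$, $(j^3_x\phi,\omega)\mapsto(j^3_x\phi,[\omega])$,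 be the quotient map. The coupling form assigns to $w=(j^3_x\phi,\omega)\in W$ the $m$-covector $\hat{\mathcal C}(w)=(j^1\phi)^*_x\,\omega$ on $T_xM$, and the Lagrangian density gives $\hat{\mathcal L}(w)=L(j^2_x\phi)\,\eta_x$. Let $$W_o=\{w\in W:\ \hat{\mathcal L}(w)=\hat{\mathcal C}(w)\}\overset{j_o}{\hookrightarrow}W .$$ Then $\mu_W$ is smooth and $W_o$ is an embedded smooth submanifold of $W$ of codimension one. It is transverse to $\mu_W$: for every $w\in W_o$, $$T_wW=T_wW_o\oplus\ker T_w\mu_W .$$ Moreover $\Phi=\mu_W\circ j_o\colon W_o\to W_r$ is a diffeomorphism. Consequently $\hat h=j_o\circ\Phi^{-1}\colon W_r\to W$ is a smooth section of $\mu_W$ (a Hamiltonian section), that is, $\mu_W\circ\hat h=\mathrm{id}_{W_r}$. -/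

import Mathlib

open scoped Manifold ContDiff Topology

noncomputable section JetGeometry
set_option linter.unusedSectionVars false


/-- Euclidean space `ℝ^m`. -/
abbrev Euc (m : ℕ) := EuclideanSpace ℝ (Fin m)
/-- The symmetric `k`-linear maps from `ℝ^m` to `ℝ^n`, as a subspace of all `k`-linear maps. -/
def symSubmodule (m n k : ℕ) : Submodule ℝ (Euc m [×k]→L[ℝ] Euc n) where
  carrier := {f | ∀ (σ : Equiv.Perm (Fin k)) (v : Fin k → Euc m), f (v ∘ σ) = f v}
  add_mem' := fun {f g} hf hg σ v => by simp [hf σ v, hg σ v]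
  zero_mem' := fun σ v => by simp
  smul_mem' := fun c f hf σ v => by simp [hf σ v]

/-- The space of symmetric `k`-linear maps from `ℝ^m` to `ℝ^n`: the values of `k`-th derivatives,
that is, the derivative coordinates `u^α_I` with `|I| = k`. -/
def SymMul (m n k : ℕ) : Type := symSubmodule m n k

instance (m n k : ℕ) : FiniteDimensional ℝ (Euc m [×k]→L[ℝ] Euc n) :=
  FiniteDimensional.of_injective
    (ContinuousMultilinearMap.toMultilinearMapLinear :
      (Euc m [×k]→L[ℝ] Euc n) →ₗ[ℝ] MultilinearMap ℝ (fun _ : Fin k => Euc m) (Euc n))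
    ContinuousMultilinearMap.toMultilinearMap_injective

namespace SymMul
variable {m n k : ℕ}

instance : NormedAddCommGroup (SymMul m n k) :=
  inferInstanceAs (NormedAddCommGroup (symSubmodule m n k))
instance : NormedSpace ℝ (SymMul m n k) := inferInstanceAs (NormedSpace ℝ (symSubmodule m n k))
instance : FiniteDimensional ℝ (SymMul m n k) :=
  inferInstanceAs (FiniteDimensional ℝ (symSubmodule m n k))

/-- The underlying multilinear map. -/
def toMap : SymMul m n k →L[ℝ] (Euc m [×k]→L[ℝ] Euc n) where
  toFun u := u.1
  map_add' _ _ := rfl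
  map_smul' _ _ := rfl
  cont := continuous_subtype_val

theorem ext' {u u' : SymMul m n k} (h : ∀ v, u.toMap v = u'.toMap v) : u = u' :=
  Subtype.ext (ContinuousMultilinearMap.ext h)

theorem toMap_perm (u : SymMul m n k) (σ : Equiv.Perm (Fin k)) (v : Fin k → Euc m) :
    u.toMap (v ∘ σ) = u.toMap v := u.2 σ v

/-- The full symmetrization of a multilinear map, as a linear projection. -/
def symmetrizeFull (m n k : ℕ) : (Euc m [×k]→L[ℝ] Euc n) →ₗ[ℝ] (Euc m [×k]→L[ℝ] Euc n) :=
  (k.factorial : ℝ)⁻¹ • ∑ σ : Equiv.Perm (Fin k),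
    { toFun := fun f => f.domDomCongr σ
      map_add' := fun _ _ => rfl
      map_smul' := fun _ _ => rfl }

theorem symmetrizeFull_apply (f : Euc m [×k]→L[ℝ] Euc n) (v : Fin k → Euc m) :
    symmetrizeFull m n k f v
      = (k.factorial : ℝ)⁻¹ • ∑ σ : Equiv.Perm (Fin k), f (v ∘ σ) := by
  rw [symmetrizeFull, LinearMap.smul_apply, LinearMap.sum_apply, smul_apply, sum_apply]
  rfl

theorem symmetrizeFull_mem (f : Euc m [×k]→L[ℝ] Euc n) :
    symmetrizeFull m n k f ∈ symSubmodule m n k := by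
  intro τ v
  rw [symmetrizeFull_apply, symmetrizeFull_apply]
  congr 1
  exact Fintype.sum_equiv (Equiv.mulLeft τ) _ _ fun σ => rfl

/-- Symmetrization, as a linear map onto the symmetric multilinear maps. -/
def symmetrizeₗ (m n k : ℕ) : (Euc m [×k]→L[ℝ] Euc n) →ₗ[ℝ] SymMul m n k :=
  (symmetrizeFull m n k).codRestrict (symSubmodule m n k) symmetrizeFull_mem

def symmetrize (m n k : ℕ) : (Euc m [×k]→L[ℝ] Euc n) →L[ℝ] SymMul m n k :=
  (symmetrizeₗ m n k).toContinuousLinearMap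

theorem toMap_symmetrize (f : Euc m [×k]→L[ℝ] Euc n) (v : Fin k → Euc m) :
    (symmetrize m n k f).toMap v
      = (k.factorial : ℝ)⁻¹ • ∑ σ : Equiv.Perm (Fin k), f (v ∘ σ) :=
   symmetrizeFull_apply f v

theorem symmetrize_toMap (u : SymMul m n k) : symmetrize m n k u.toMap = u := by
  refine ext' fun v => ?_
  rw [toMap_symmetrize, Finset.sum_congr rfl fun σ _ => u.toMap_perm σ v]
  simp only [Finset.sum_const, Finset.card_univ, Fintype.card_perm, Fintype.card_fin]
  rw [← Nat.cast_smul_eq_nsmul ℝ, smul_smul, inv_mul_cancel₀ (by positivity), one_smul]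

theorem toMap_symmetrize_of_symm {f : Euc m [×k]→L[ℝ] Euc n}
    (h : ∀ (σ : Equiv.Perm (Fin k)) (v : Fin k → Euc m), f (v ∘ σ) = f v) :
    (symmetrize m n k f).toMap = f :=
  congrArg toMap (symmetrize_toMap ⟨f, h⟩)

end SymMul

/-- The model space of the manifold of `k`-jets: base coordinates `x` together with the derivatives
of order `0, …, k` (natural coordinates `(x^i, u^α, u^α_i, …, u^α_I)`). -/
abbrev JetModel (m n k : ℕ) := Euc m × ((i : Fin (k + 1)) → SymMul m n i)

theorem iteratedFDeriv_symm {X : Type} [NormedAddCommGroup X] [NormedSpace ℝ X] {k : ℕ} :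
    ∀ {Y : Type} [NormedAddCommGroup Y] [NormedSpace ℝ Y] {f : X → Y} {U : Set X},
    IsOpen U → ContDiffOn ℝ ∞ f U → ∀ {x : X}, x ∈ U →
    ∀ (σ : Equiv.Perm (Fin k)) (v : Fin k → X),
    iteratedFDeriv ℝ k f x (v ∘ σ) = iteratedFDeriv ℝ k f x v := by
  induction k with
  | zero => intro Y _ _ f U _ _ x _ σ v; congr 1; exact Subsingleton.elim _ _
  | succ k ih =>
    intro Y _ _ f U hU hf x hx σ
    have hfx : ContDiffAt ℝ ∞ f x := hf.contDiffAt (hU.mem_nhds hx)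
    have hdiff : DifferentiableAt ℝ (iteratedFDeriv ℝ k f) x :=
      hfx.differentiableAt_iteratedFDeriv (by exact_mod_cast ENat.natCast_lt_top k)
    have left : ∀ i j : Fin k, ∀ v : Fin (k + 1) → X,
        iteratedFDeriv ℝ (k + 1) f x (v ∘ Equiv.swap i.succ j.succ)
          = iteratedFDeriv ℝ (k + 1) f x v := by
      intro i j v
      rw [hdiff.iteratedFDeriv_succ_apply_left', hdiff.iteratedFDeriv_succ_apply_left']
      have h0 : (v ∘ Equiv.swap i.succ j.succ) 0 = v 0 := by
        simp [Equiv.swap_apply_of_ne_of_ne (Fin.succ_ne_zero i).symm (Fin.succ_ne_zero j).symm]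
      have ht : Fin.tail (v ∘ Equiv.swap i.succ j.succ) = Fin.tail v ∘ Equiv.swap i j := by
        funext l
        simp only [Fin.tail, Function.comp]
        rw [(Fin.succ_injective k).swap_apply]
      rw [h0, ht]
      congr 1
      apply Filter.EventuallyEq.fderiv_eq
      filter_upwards [hU.mem_nhds hx] with y hy
      exact ih hU hf hy _ _
    have right : ∀ i j : Fin k, ∀ v : Fin (k + 1) → X,
        iteratedFDeriv ℝ (k + 1) f x (v ∘ Equiv.swap i.castSucc j.castSucc)
          = iteratedFDeriv ℝ (k + 1) f x v := by
      intro i j v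
      rw [iteratedFDeriv_succ_apply_right, iteratedFDeriv_succ_apply_right]
      have h0 : (v ∘ Equiv.swap i.castSucc j.castSucc) (Fin.last k) = v (Fin.last k) := by
        simp [Equiv.swap_apply_of_ne_of_ne (Fin.castSucc_ne_last i).symm
          (Fin.castSucc_ne_last j).symm]
      have ht : Fin.init (v ∘ Equiv.swap i.castSucc j.castSucc) = Fin.init v ∘ Equiv.swap i j := by
        funext l
        simp only [Fin.init, Function.comp]
        rw [(Fin.castSucc_injective k).swap_apply]
      rw [h0, ht]
      have := ih (f := fun y => fderiv ℝ f y) hU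
        (hf.fderiv_of_isOpen hU le_rfl) hx (Equiv.swap i j) (Fin.init v)
      rw [this]
    have swp : ∀ i j : Fin (k + 1), ∀ v : Fin (k + 1) → X,
        iteratedFDeriv ℝ (k + 1) f x (v ∘ Equiv.swap i j) = iteratedFDeriv ℝ (k + 1) f x v := by
      have key : ∀ j : Fin (k + 1), ∀ v : Fin (k + 1) → X,
          iteratedFDeriv ℝ (k + 1) f x (v ∘ Equiv.swap 0 j) = iteratedFDeriv ℝ (k + 1) f x v := by
        intro j v
        rcases Fin.eq_zero_or_eq_succ j with rfl | ⟨j, rfl⟩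
        · simp
        rcases Nat.lt_or_ge k 2 with hk | hk
        · interval_cases k
          · exact j.elim0
          · have : j = 0 := Subsingleton.elim _ _
            subst this
            have hs : IsSymmSndFDerivAt ℝ f x := hfx.isSymmSndFDerivAt
              (by simpa using (by exact_mod_cast le_top : ((2 : ℕ∞) : WithTop ℕ∞) ≤ ((⊤ : ℕ∞) : WithTop ℕ∞)))
            refine (iteratedFDeriv_two_apply (𝕜 := ℝ) f x (v ∘ Equiv.swap 0 (Fin.succ 0))).trans
              (Eq.trans ?_ (iteratedFDeriv_two_apply (𝕜 := ℝ) f x v).symm)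
            simpa using hs.eq _ _
        · by_cases hj : (j.succ : Fin (k + 1)) = Fin.last k
          · let one : Fin (k + 1) := ⟨1, by omega⟩
            have h1 : one ≠ Fin.last k := by
              intro h; have := congrArg Fin.val h; simp [one] at this; omega
            have h2 : (0 : Fin (k + 1)) ≠ one := by
              intro h; have := congrArg Fin.val h; simp [one] at this
            have h3 : (0 : Fin (k + 1)) ≠ Fin.last k := by
              intro h; have := congrArg Fin.val h; simp at this; omega
            have e : Equiv.swap 0 j.succ
                = Equiv.swap 0 one * Equiv.swap one (Fin.last k) * Equiv.swap 0 one := by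
              have := Equiv.swap_mul_swap_mul_swap (x := Fin.last k) (y := one) (z := 0) h1.symm h3.symm
              rw [hj, Equiv.swap_comm 0 one, Equiv.swap_comm one (Fin.last k)]
              exact this.symm
            have r01 : ∀ w : Fin (k + 1) → X, iteratedFDeriv ℝ (k + 1) f x (w ∘ Equiv.swap 0 one)
                = iteratedFDeriv ℝ (k + 1) f x w := fun w =>
              right ⟨0, by omega⟩ ⟨1, by omega⟩ w
            have l1l : ∀ w : Fin (k + 1) → X,
                iteratedFDeriv ℝ (k + 1) f x (w ∘ Equiv.swap one (Fin.last k))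
                = iteratedFDeriv ℝ (k + 1) f x w := fun w => by
              have := left ⟨0, by omega⟩ j w
              rwa [hj] at this
            rw [e]
            have : (v ∘ ⇑(Equiv.swap 0 one * Equiv.swap one (Fin.last k) * Equiv.swap 0 one))
              = ((v ∘ Equiv.swap 0 one) ∘ Equiv.swap one (Fin.last k)) ∘ Equiv.swap 0 one := rfl
            rw [this, r01, l1l, r01]
          · have hk0 : 0 < k := by omega
            have hlt : j.val + 1 < k := by
              have := j.succ.is_lt
              rcases Nat.lt_or_ge (j.val + 1) k with h | h
              · exact h
              · exact absurd (Fin.ext (by simp; omega)) hj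
            exact right ⟨0, hk0⟩ ⟨j.val + 1, hlt⟩ v
      intro i j v
      rcases Fin.eq_zero_or_eq_succ i with rfl | ⟨i, rfl⟩
      · exact key j v
      rcases Fin.eq_zero_or_eq_succ j with rfl | ⟨j, rfl⟩
      · rw [Equiv.swap_comm]; exact key _ v
      · exact left i j v
    induction σ using Equiv.Perm.swap_induction_on with
    | one => intro v; rfl
    | swap_mul g i j _ hg =>
      intro v
      have : v ∘ ⇑(Equiv.swap i j * g) = (v ∘ Equiv.swap i j) ∘ g := rfl
      rw [this, hg, swp]

section Fibration
variable (m n : ℕ) {M E : Type*}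
  [TopologicalSpace M] [ChartedSpace (Euc m) M]
  [TopologicalSpace E] [ChartedSpace (Euc (m + n)) E]

/-- A smooth fibred manifold `π : E → M` (`dim M = m`, `dim E = m + n`): a smooth surjective
submersion. Every smooth fibre bundle is one. -/
class IsFiberedManifold (π : E → M) : Prop where
  surjective : Function.Surjective π
  isSubmersion : Manifold.IsSubmersion 𝓘(ℝ, Euc (m + n)) 𝓘(ℝ, Euc m) ∞ π

/-- Adapted (fibred) coordinates `(x^i, u^α)`: smooth charts `base` of `M` and `total` of `E` such
that `π` reads `(x, u) ↦ x`. -/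
structure AdaptedChart (π : E → M) where
  base : OpenPartialHomeomorph M (Euc m)
  total : OpenPartialHomeomorph E (Euc m × Euc n)
  contMDiffOn_base : ContMDiffOn 𝓘(ℝ, Euc m) 𝓘(ℝ, Euc m) ∞ base base.source
  contMDiffOn_base_symm : ContMDiffOn 𝓘(ℝ, Euc m) 𝓘(ℝ, Euc m) ∞ base.symm base.target
  contMDiffOn_total :
    ContMDiffOn 𝓘(ℝ, Euc (m + n)) 𝓘(ℝ, Euc m × Euc n) ∞ total total.source
  contMDiffOn_total_symm :
    ContMDiffOn 𝓘(ℝ, Euc m × Euc n) 𝓘(ℝ, Euc (m + n)) ∞ total.symm total.target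
  proj_mem : ∀ e ∈ total.source, π e ∈ base.source
  proj_eq : ∀ e ∈ total.source, base (π e) = (total e).1

theorem exists_adaptedChart [IsManifold 𝓘(ℝ, Euc m) ∞ M] [IsManifold 𝓘(ℝ, Euc (m + n)) ∞ E]
    (π : E → M) [hπ : IsFiberedManifold m n π] (e : E) :
    ∃ c : AdaptedChart m n π, e ∈ c.total.source := by
  obtain ⟨F, _, _, hF⟩ := hπ.isSubmersion
  have h := hF e
  have : FiniteDimensional ℝ (Euc m × F) := h.equiv.toLinearEquiv.finiteDimensional
  have : FiniteDimensional ℝ F :=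
    FiniteDimensional.of_surjective (LinearMap.snd ℝ (Euc m) F) LinearMap.snd_surjective
  have hr : Module.finrank ℝ F = Module.finrank ℝ (Euc n) := by
    have := h.equiv.toLinearEquiv.finrank_eq
    simp at this ⊢
    omega
  let g : F ≃L[ℝ] Euc n := ContinuousLinearEquiv.ofFinrankEq hr
  let q : Euc (m + n) ≃L[ℝ] Euc m × Euc n :=
    h.equiv.trans ((ContinuousLinearEquiv.refl ℝ (Euc m)).prodCongr g)
  have hb := h.codChart_mem_maximalAtlas
  have ht := h.domChart_mem_maximalAtlas
  have hs := h.source_subset_preimage_source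
  refine ⟨{ base := h.codChart
            total := h.domChart.transHomeomorph q.toHomeomorph
            contMDiffOn_base := contMDiffOn_of_mem_maximalAtlas hb
            contMDiffOn_base_symm := contMDiffOn_symm_of_mem_maximalAtlas hb
            contMDiffOn_total := ?_
            contMDiffOn_total_symm := ?_
            proj_mem := fun e he => hs he
            proj_eq := ?_ }, h.mem_domChart_source⟩
  · exact q.contDiff.contMDiff.comp_contMDiffOn (contMDiffOn_of_mem_maximalAtlas ht)
  · refine (contMDiffOn_symm_of_mem_maximalAtlas ht).comp q.symm.contDiff.contMDiff.contMDiffOn ?_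
    intro x hx
    exact hx
  · intro e' he'
    have he'' : e' ∈ h.domChart.source := he'
    have hm : h.domChart e' ∈ (h.domChart.extend 𝓘(ℝ, Euc (m + n))).target := by
      simpa using h.domChart.map_source he''
    have := h.writtenInCharts hm
    simp [h.domChart.left_inv he''] at this
    simpa [q] using this

end Fibration

theorem iteratedFDeriv_comp_congr {X Y Z : Type*} [NormedAddCommGroup X] [NormedSpace ℝ X]
    [NormedAddCommGroup Y] [NormedSpace ℝ Y] [NormedAddCommGroup Z] [NormedSpace ℝ Z]
    {g : Y → Z} {f f' : X → Y} {x : X} {k : ℕ}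
    (hf : ContDiffAt ℝ ∞ f x) (hf' : ContDiffAt ℝ ∞ f' x) (hg : ContDiffAt ℝ ∞ g (f x))
    (h : ∀ i ≤ k, iteratedFDeriv ℝ i f x = iteratedFDeriv ℝ i f' x) :
    ∀ i ≤ k, iteratedFDeriv ℝ i (g ∘ f) x = iteratedFDeriv ℝ i (g ∘ f') x := by
  intro i hi
  have h0 : f x = f' x := by
    have := congrArg (fun q => q (0 : Fin 0 → X)) (h 0 (Nat.zero_le _))
    simpa using this
  have hi' : ((i : ℕ∞) : WithTop ℕ∞) ≤ ∞ := by exact_mod_cast le_top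
  rw [iteratedFDeriv_comp hg hf hi', iteratedFDeriv_comp (h0 ▸ hg) hf' hi']
  simp only [FormalMultilinearSeries.taylorComp]
  refine Finset.sum_congr rfl fun c _ => ?_
  simp only [FormalMultilinearSeries.compAlongOrderedFinpartition, ftaylorSeries, ← h0]
  congr 1
  funext j
  exact h _ ((c.partSize_le j).trans hi)

theorem iteratedFDeriv_precomp_congr {X Y Z : Type*} [NormedAddCommGroup X] [NormedSpace ℝ X]
    [NormedAddCommGroup Y] [NormedSpace ℝ Y] [NormedAddCommGroup Z] [NormedSpace ℝ Z]
    {g g' : Y → Z} {f : X → Y} {x : X} {k : ℕ}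
    (hf : ContDiffAt ℝ ∞ f x) (hg : ContDiffAt ℝ ∞ g (f x)) (hg' : ContDiffAt ℝ ∞ g' (f x))
    (h : ∀ i ≤ k, iteratedFDeriv ℝ i g (f x) = iteratedFDeriv ℝ i g' (f x)) :
    ∀ i ≤ k, iteratedFDeriv ℝ i (g ∘ f) x = iteratedFDeriv ℝ i (g' ∘ f) x := by
  intro i hi
  have hi' : ((i : ℕ∞) : WithTop ℕ∞) ≤ ∞ := by exact_mod_cast le_top
  rw [iteratedFDeriv_comp hg hf hi', iteratedFDeriv_comp hg' hf hi']
  simp only [FormalMultilinearSeries.taylorComp]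
  refine Finset.sum_congr rfl fun c _ => ?_
  simp only [FormalMultilinearSeries.compAlongOrderedFinpartition, ftaylorSeries]
  congr 1
  exact h _ (c.length_le.trans hi)

/-- Parametric iterated derivatives are jointly smooth. -/
theorem contDiffOn_iteratedFDeriv_param {P X Y : Type*} [NormedAddCommGroup P] [NormedSpace ℝ P]
    [NormedAddCommGroup X] [NormedSpace ℝ X] [NormedAddCommGroup Y] [NormedSpace ℝ Y]
    {G : P × X → Y} {O : Set (P × X)} (hO : IsOpen O) (hG : ContDiffOn ℝ ∞ G O) (i : ℕ) :
    ContDiffOn ℝ ∞ (fun q : P × X => iteratedFDeriv ℝ i (fun y => G (q.1, y)) q.2) O := by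
  have h1 : ContDiffOn ℝ ∞ (iteratedFDeriv ℝ i G) O := fun q hq =>
    ((hG.contDiffAt (hO.mem_nhds hq)).iteratedFDeriv_right (m := ∞) (by
      exact_mod_cast le_of_eq (top_add (i : ℕ∞)))).contDiffWithinAt
  refine ContDiffOn.congr
    ((ContinuousMultilinearMap.compContinuousLinearMapL (𝕜 := ℝ)
      (fun _ : Fin i => ContinuousLinearMap.inr ℝ P X)).contDiff.comp_contDiffOn h1) ?_
  rintro ⟨p, x⟩ hq
  let a : P × X := (p, 0)
  have hfun : (fun y => G (p, y)) = (fun z => G (a + z)) ∘ ContinuousLinearMap.inr ℝ P X := by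
    funext y; simp [a]
  let O1 : Set (P × X) := (fun z => a + z) ⁻¹' O
  have hO1 : IsOpen O1 := hO.preimage (by fun_prop)
  have hG1 : ContDiffOn ℝ ∞ (fun z => G (a + z)) O1 :=
    hG.comp (by fun_prop) fun z hz => hz
  have hmem : ContinuousLinearMap.inr ℝ P X x ∈ O1 := by simpa [O1, a] using hq
  have hO2 : IsOpen (ContinuousLinearMap.inr ℝ P X ⁻¹' O1) :=
    hO1.preimage (ContinuousLinearMap.inr ℝ P X).continuous
  have := (ContinuousLinearMap.inr ℝ P X).iteratedFDerivWithin_comp_right hG1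
    hO1.uniqueDiffOn hO2.uniqueDiffOn hmem (i := i) (by exact_mod_cast le_top)
  rw [iteratedFDerivWithin_of_isOpen i hO1 hmem, iteratedFDerivWithin_of_isOpen i hO2 hmem,
    iteratedFDeriv_comp_add_left] at this
  simp only [hfun, this]
  simp [a]

section TaylorPolynomial
variable {m n k : ℕ}
/-- The Taylor polynomial with prescribed derivatives at the base point. -/
def jetPoly (v : JetModel m n k) (z : Euc m) : Euc n :=
  ∑ i : Fin (k + 1), ((i : ℕ).factorial : ℝ)⁻¹ • (v.2 i).toMap (fun _ => z - v.1)

theorem contDiff_multilinear_apply {ι X Y : Type*} [Fintype ι] [NormedAddCommGroup X]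
    [NormedSpace ℝ X] [NormedAddCommGroup Y] [NormedSpace ℝ Y] [CompleteSpace Y] :
    ContDiff ℝ ∞ (fun p : ContinuousMultilinearMap ℝ (fun _ : ι => X) Y × (ι → X) => p.1 p.2) :=
  contDiff_iff_contDiffAt.2 fun x =>
    (ContinuousLinearMap.analyticAt_uncurry_of_multilinear (𝕜 := ℝ)
      (ContinuousLinearMap.id ℝ (ContinuousMultilinearMap ℝ (fun _ : ι => X) Y))
        (x := x)).contDiffAt

theorem contDiff_jetPoly : ContDiff ℝ ∞ (fun q : JetModel m n k × Euc m => jetPoly q.1 q.2) := by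
  unfold jetPoly
  refine ContDiff.sum fun i _ => ContDiff.const_smul _ ?_
  refine contDiff_multilinear_apply.comp
    (f := fun q : JetModel m n k × Euc m => ((q.1.2 i).toMap, fun _ => q.2 - q.1.1)) ?_
  refine ContDiff.prodMk ?_ (by fun_prop)
  have h1 : ContDiff ℝ ∞ (fun u : SymMul m n i => u.toMap) :=
    SymMul.toMap.contDiff
  have h2 : ContDiff ℝ ∞ (fun q : JetModel m n k × Euc m => q.1.2 i) :=
    contDiff_pi.1 (contDiff_snd.comp contDiff_fst) i
  exact h1.comp h2

theorem iteratedFDeriv_jetPoly (v : JetModel m n k) (i : Fin (k + 1)) :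
    iteratedFDeriv ℝ i (jetPoly v) v.1 = (v.2 i).toMap := by
  let p : FormalMultilinearSeries ℝ (Euc m) (Euc n) := fun j =>
    if h : j < k + 1 then ((j.factorial : ℝ)⁻¹ • (v.2 ⟨j, h⟩).toMap) else 0
  have hp : ∀ j, k + 1 ≤ j → p j = 0 := fun j hj => dif_neg (by omega)
  have h0 : HasFPowerSeriesOnBall (jetPoly v) p v.1 ⊤ := by
    have := (p.hasFiniteFPowerSeriesOnBall_of_finite hp).comp_sub v.1
    rw [zero_add] at this
    refine this.toHasFPowerSeriesOnBall.congr fun z _ => ?_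
    simp only
    rw [FormalMultilinearSeries.sum, tsum_eq_sum (s := Finset.range (k + 1))
      (fun j hj => by simp [hp j (by simpa using hj)]), Finset.sum_range]
    refine Finset.sum_congr rfl fun j _ => ?_
    simp only [p, j.is_lt, dif_pos, Fin.eta, smul_apply]
  have han : AnalyticOn ℝ (jetPoly v) Set.univ := by
    intro z _
    have : z ∈ Metric.eball v.1 ⊤ := by simp
    exact (h0.analyticAt_of_mem this).analyticWithinAt
  ext w : 1
  rw [h0.iteratedFDeriv_eq_sum han w]
  have : ∀ σ : Equiv.Perm (Fin (i : ℕ)), (p i fun j => w (σ j))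
      = (((i : ℕ).factorial : ℝ)⁻¹) • (v.2 i).toMap w := by
    intro σ
    have hs := (v.2 i).toMap_perm σ w
    simp only [p, i.is_lt, dif_pos, Fin.eta, smul_apply]
    congr 1
  rw [Finset.sum_congr rfl fun σ _ => this σ]
  simp only [Finset.sum_const, Finset.card_univ, Fintype.card_perm, Fintype.card_fin]
  rw [← Nat.cast_smul_eq_nsmul ℝ, smul_smul, mul_inv_cancel₀ (by positivity), one_smul]
end TaylorPolynomial

section SmoothAtlas
variable {V X : Type*} [NormedAddCommGroup V] [NormedSpace ℝ V]

/-- A set of bijective charts with smooth transition maps on open overlaps; it makes `X` a smooth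
manifold modelled on `V`. -/
structure SmoothAtlas (V X : Type*) [NormedAddCommGroup V] [NormedSpace ℝ V] where
  charts : Set (PartialEquiv X V)
  cover : ∀ x, ∃ e ∈ charts, x ∈ e.source
  open_source : ∀ e ∈ charts, ∀ e' ∈ charts, IsOpen (e.symm.trans e').source
  contDiffOn : ∀ e ∈ charts, ∀ e' ∈ charts,
    ContDiffOn ℝ ∞ (e.symm.trans e') (e.symm.trans e').source

namespace SmoothAtlas

def toCore (a : SmoothAtlas V X) : ChartedSpaceCore V X where
  atlas := a.charts
  chartAt x := Classical.choose (a.cover x)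
  mem_chart_source x := (Classical.choose_spec (a.cover x)).2
  chart_mem_atlas x := (Classical.choose_spec (a.cover x)).1
  open_source e e' he he' := a.open_source e he e' he'
  continuousOn_toFun e e' he he' := (a.contDiffOn e he e' he').continuousOn

theorem isManifold (a : SmoothAtlas V X) :
    @IsManifold ℝ _ V _ _ V _ 𝓘(ℝ, V) ∞ X a.toCore.toTopologicalSpace a.toCore.toChartedSpace := by
  let := a.toCore.toTopologicalSpace
  let := a.toCore.toChartedSpace
  refine isManifold_of_contDiffOn 𝓘(ℝ, V) ∞ X fun e e' he he' => ?_
  obtain ⟨e, hc, rfl⟩ : ∃ (f : PartialEquiv X V) (hf : f ∈ a.charts),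
      e = a.toCore.openPartialHomeomorph f hf := by
    have h : e ∈ ⋃ (f : PartialEquiv X V) (hf : f ∈ a.charts),
        {a.toCore.openPartialHomeomorph f hf} := he
    simpa only [Set.mem_iUnion, Set.mem_singleton_iff] using h
  obtain ⟨e', hc', rfl⟩ : ∃ (f : PartialEquiv X V) (hf : f ∈ a.charts),
      e' = a.toCore.openPartialHomeomorph f hf := by
    have h : e' ∈ ⋃ (f : PartialEquiv X V) (hf : f ∈ a.charts),
        {a.toCore.openPartialHomeomorph f hf} := he'
    simpa only [Set.mem_iUnion, Set.mem_singleton_iff] using h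
  have := a.contDiffOn e hc e' hc'
  refine this.congr_mono ?_ ?_
  · intro x _; rfl
  · intro x hx; exact hx.1

end SmoothAtlas
end SmoothAtlas

section Jets
variable (m n : ℕ) {M E : Type*}
  [TopologicalSpace M] [ChartedSpace (Euc m) M]
  [TopologicalSpace E] [ChartedSpace (Euc (m + n)) E]

/-- `φ` is, near `x`, a smooth local section of `π`. -/
def IsLocalSectionAt (π : E → M) (φ : M → E) (x : M) : Prop :=
  ∃ U : Set M, IsOpen U ∧ x ∈ U ∧
    ContMDiffOn 𝓘(ℝ, Euc m) 𝓘(ℝ, Euc (m + n)) ∞ φ U ∧ ∀ y ∈ U, π (φ y) = y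

/-- A local section of `π` with a marked point in its domain. -/
structure LocalSection (π : E → M) where
  pt : M
  toFun : M → E
  isLocalSectionAt : IsLocalSectionAt m n π toFun pt

variable {m n}
namespace AdaptedChart
variable {π : E → M}

/-- The coordinate expression `x ↦ u(φ(x))` of a section. -/
def rep (c : AdaptedChart m n π) (φ : M → E) (z : Euc m) : Euc n :=
  (c.total (φ (c.base.symm z))).2

end AdaptedChart

variable (m n)
/-- Two local sections have the same `k`-jet: same point, same value, and same partial derivatives
up to order `k` in adapted coordinates. -/
def jetSetoid (π : E → M) (k : ℕ) : Setoid (LocalSection m n π) where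
  r s t := s.pt = t.pt ∧ s.toFun s.pt = t.toFun t.pt ∧
    ∀ c : AdaptedChart m n π, s.toFun s.pt ∈ c.total.source → ∀ i ≤ k,
      iteratedFDeriv ℝ i (c.rep s.toFun) (c.base s.pt)
        = iteratedFDeriv ℝ i (c.rep t.toFun) (c.base t.pt)
  iseqv :=
    { refl := fun _ => ⟨rfl, rfl, fun _ _ _ _ => rfl⟩
      symm := fun {_ _} ⟨h1, h2, h3⟩ => ⟨h1.symm, h2.symm, fun c hc i hi => (h3 c (h2 ▸ hc) i hi).symm⟩
      trans := fun ⟨h1, h2, h3⟩ ⟨g1, g2, g3⟩ => ⟨h1.trans g1, h2.trans g2, fun c hc i hi =>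
        (h3 c hc i hi).trans (g3 c (h2 ▸ hc) i hi)⟩ }

/-- The `k`-th jet space `J^kπ`. -/
def Jet (π : E → M) (k : ℕ) : Type _ := Quotient (jetSetoid m n π k)

variable {m n}
variable {π : E → M}

namespace Jet
variable {k : ℕ}
/-- The `k`-jet of a local section. -/
def mk (k : ℕ) (s : LocalSection m n π) : Jet m n π k := Quotient.mk (jetSetoid m n π k) s

/-- The projection `J^kπ → M`. -/
def source (j : Jet m n π k) : M := Quotient.lift (s := jetSetoid m n π k) (fun s => s.pt) (fun _ _ h => h.1) j

/-- The projection `J^kπ → E`. -/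
def target (j : Jet m n π k) : E := Quotient.lift (s := jetSetoid m n π k) (fun s => s.toFun s.pt) (fun _ _ h => h.2.1) j

/-- The projection `J^kπ → J^rπ`. -/
def proj {k : ℕ} (r : ℕ) (h : r ≤ k) (j : Jet m n π k) : Jet m n π r :=
  Quotient.lift (s := jetSetoid m n π k) (fun s => mk r s)
    (fun _ _ g => Quotient.sound ⟨g.1, g.2.1, fun c hc i hi => g.2.2 c hc i (hi.trans h)⟩) j

/-- A section representing the jet. -/
def out (j : Jet m n π k) : LocalSection m n π := Quotient.out j

theorem mk_out (j : Jet m n π k) : mk k j.out = j := Quotient.out_eq j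

@[simp] theorem source_mk (s : LocalSection m n π) : (mk k s).source = s.pt := rfl
@[simp] theorem target_mk (s : LocalSection m n π) : (mk k s).target = s.toFun s.pt := rfl
@[simp] theorem proj_mk {r : ℕ} (h : r ≤ k) (s : LocalSection m n π) :
    (mk k s).proj r h = mk r s := rfl
@[simp] theorem proj_source {r : ℕ} (h : r ≤ k) (j : Jet m n π k) :
    (j.proj r h).source = j.source := by rw [← mk_out j]; rfl
@[simp] theorem proj_target {r : ℕ} (h : r ≤ k) (j : Jet m n π k) :
    (j.proj r h).target = j.target := by rw [← mk_out j]; rfl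
end Jet

namespace AdaptedChart

theorem exists_rep_contDiffOn (c : AdaptedChart m n π) {φ : M → E} {x : M}
    (hφ : IsLocalSectionAt m n π φ x) (hx : φ x ∈ c.total.source) :
    x ∈ c.base.source ∧ (c.total (φ x)).1 = c.base x ∧ ∃ O : Set (Euc m), IsOpen O ∧ c.base x ∈ O ∧
      O ⊆ c.base.target ∧ ContDiffOn ℝ ∞ (c.rep φ) O ∧
      ∀ z ∈ O, φ (c.base.symm z) ∈ c.total.source ∧ π (φ (c.base.symm z)) = c.base.symm z ∧
        c.total (φ (c.base.symm z)) = (z, c.rep φ z) := by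
  obtain ⟨U, hU, hxU, hs, hsec⟩ := hφ
  have hxb : x ∈ c.base.source := by
    have := c.proj_mem _ hx
    rwa [hsec x hxU] at this
  refine ⟨hxb, by rw [← c.proj_eq _ hx, hsec x hxU], ?_⟩
  have hU' : IsOpen (U ∩ φ ⁻¹' c.total.source) :=
    hs.continuousOn.isOpen_inter_preimage hU c.total.open_source
  refine ⟨c.base.target ∩ c.base.symm ⁻¹' (U ∩ φ ⁻¹' c.total.source),
    c.base.symm.isOpen_inter_preimage hU', ⟨c.base.map_source hxb, ?_⟩,
    Set.inter_subset_left, ?_, ?_⟩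
  · simp [c.base.left_inv hxb, hxU, hx]
  · have h1 : ContMDiffOn 𝓘(ℝ, Euc m) 𝓘(ℝ, Euc m × Euc n) ∞
        (fun z => c.total (φ (c.base.symm z)))
        (c.base.target ∩ c.base.symm ⁻¹' (U ∩ φ ⁻¹' c.total.source)) := by
      refine c.contMDiffOn_total.comp ((hs.mono Set.inter_subset_left).comp
        (c.contMDiffOn_base_symm.mono Set.inter_subset_left) (t := U ∩ φ ⁻¹' c.total.source) ?_) ?_
      · intro z hz; exact hz.2
      · intro z hz; exact hz.2.2
    exact (contMDiffOn_iff_contDiffOn.1 h1).snd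
  · rintro z ⟨hz1, hz2, hz3⟩
    refine ⟨hz3, hsec _ hz2, Prod.ext ?_ rfl⟩
    rw [← c.proj_eq _ hz3, hsec _ hz2, c.base.right_inv hz1]

/-- The section with a prescribed coordinate expression. -/
def graphSection (c : AdaptedChart m n π) (g : Euc m → Euc n) (y : M) : E :=
  c.total.symm (c.base y, g (c.base y))

theorem isLocalSectionAt_graphSection (c : AdaptedChart m n π) {g : Euc m → Euc n}
    (hg : ContDiff ℝ ∞ g) {x : M} (hx : x ∈ c.base.source)
    (h : (c.base x, g (c.base x)) ∈ c.total.target) :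
    IsLocalSectionAt m n π (c.graphSection g) x := by
  have hcont : ContMDiffOn 𝓘(ℝ, Euc m) 𝓘(ℝ, Euc m × Euc n) ∞
      (fun y => (c.base y, g (c.base y))) c.base.source := by
    have : ContDiff ℝ ∞ (fun z : Euc m => (z, g z)) := contDiff_id.prodMk hg
    exact this.contMDiff.comp_contMDiffOn c.contMDiffOn_base
  refine ⟨c.base.source ∩ (fun y => (c.base y, g (c.base y))) ⁻¹' c.total.target,
    hcont.continuousOn.isOpen_inter_preimage c.base.open_source c.total.open_target,
    ⟨hx, h⟩, ?_, ?_⟩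
  · exact c.contMDiffOn_total_symm.comp (hcont.mono Set.inter_subset_left) fun y hy => hy.2
  · rintro y ⟨hy1, hy2⟩
    have hs := c.total.map_target hy2
    refine c.base.injOn (c.proj_mem _ hs) hy1 ?_
    change c.base (π (c.total.symm (c.base y, g (c.base y)))) = c.base y
    rw [c.proj_eq _ hs, c.total.right_inv hy2]

theorem rep_graphSection (c : AdaptedChart m n π) {g : Euc m → Euc n} {z : Euc m}
    (hz : z ∈ c.base.target) (h : (z, g z) ∈ c.total.target) :
    c.rep (c.graphSection g) z = g z := by
  simp [rep, graphSection, c.base.right_inv hz, c.total.right_inv h]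

theorem fst_mem_target (c : AdaptedChart m n π) {p : Euc m × Euc n} (h : p ∈ c.total.target) :
    p.1 ∈ c.base.target ∧ c.base.symm p.1 = π (c.total.symm p) := by
  have hs := c.total.map_target h
  have h1 := c.proj_eq _ hs
  rw [c.total.right_inv h] at h1
  have h2 := c.proj_mem _ hs
  rw [← h1]
  exact ⟨c.base.map_source h2, c.base.left_inv h2⟩

theorem rep_congr_chart (c c₂ : AdaptedChart m n π) {φ φ' : M → E} {x : M} {k : ℕ}
    (hφ : IsLocalSectionAt m n π φ x) (hφ' : IsLocalSectionAt m n π φ' x)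
    (hx : φ x ∈ c.total.source) (hx' : φ x ∈ c₂.total.source) (he : φ x = φ' x)
    (h : ∀ i ≤ k, iteratedFDeriv ℝ i (c.rep φ) (c.base x)
      = iteratedFDeriv ℝ i (c.rep φ') (c.base x)) :
    ∀ i ≤ k, iteratedFDeriv ℝ i (c₂.rep φ) (c₂.base x)
      = iteratedFDeriv ℝ i (c₂.rep φ') (c₂.base x) := by
  obtain ⟨hxb, hxf, O, hO, hxO, hOt, hsm, hOs⟩ := c.exists_rep_contDiffOn hφ hx
  obtain ⟨-, hxf', O', hO', hxO', hOt', hsm', hOs'⟩ := c.exists_rep_contDiffOn hφ' (he ▸ hx)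
  obtain ⟨hxb', -, -⟩ := c₂.exists_rep_contDiffOn hφ hx'
  let f : Euc m → Euc m := fun z => c.base (c₂.base.symm z)
  let W : Set (Euc m) := c₂.base.target ∩ c₂.base.symm ⁻¹' c.base.source
  have hW : IsOpen W := c₂.base.symm.isOpen_inter_preimage c.base.open_source
  have hxW : c₂.base x ∈ W := ⟨c₂.base.map_source hxb', by simpa [c₂.base.left_inv hxb'] using hxb⟩
  have hfW : ContDiffOn ℝ ∞ f W := contMDiffOn_iff_contDiffOn.1
    (c.contMDiffOn_base.comp (c₂.contMDiffOn_base_symm.mono Set.inter_subset_left) fun z hz => hz.2)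
  have hf : ContDiffAt ℝ ∞ f (c₂.base x) := hfW.contDiffAt (hW.mem_nhds hxW)
  have hfx : f (c₂.base x) = c.base x := by simp [f, c₂.base.left_inv hxb']
  let Θ : Euc m × Euc n → Euc n := fun p => (c₂.total (c.total.symm p)).2
  let T : Set (Euc m × Euc n) := c.total.target ∩ c.total.symm ⁻¹' c₂.total.source
  have hT : IsOpen T := c.total.symm.isOpen_inter_preimage c₂.total.open_source
  have hΘT : ContDiffOn ℝ ∞ Θ T := (contMDiffOn_iff_contDiffOn.1
    (c₂.contMDiffOn_total.comp (c.contMDiffOn_total_symm.mono Set.inter_subset_left)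
      fun z hz => hz.2)).snd
  have key : ∀ (ψ : M → E) (P : Set (Euc m)), IsOpen P → c.base x ∈ P →
      (∀ z ∈ P, ψ (c.base.symm z) ∈ c.total.source ∧ π (ψ (c.base.symm z)) = c.base.symm z ∧
        c.total (ψ (c.base.symm z)) = (z, c.rep ψ z)) →
      c₂.rep ψ =ᶠ[𝓝 (c₂.base x)] (Θ ∘ fun z => (z, c.rep ψ z)) ∘ f := by
    intro ψ P hP hxP hψ
    have : f ⁻¹' P ∈ 𝓝 (c₂.base x) := hf.continuousAt.preimage_mem_nhds
      (by rw [hfx]; exact hP.mem_nhds hxP)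
    filter_upwards [this, hW.mem_nhds hxW] with z hz hzW
    obtain ⟨h1, h2, h3⟩ := hψ _ hz
    have h4 : c.base.symm (f z) = c₂.base.symm z := c.base.left_inv hzW.2
    change (c₂.total (ψ (c₂.base.symm z))).2 = (c₂.total (c.total.symm (f z, c.rep ψ (f z)))).2
    rw [← h3, c.total.left_inv h1, h4]
  have hpT : (c.base x, c.rep φ (c.base x)) ∈ T := by
    have := (hOs _ hxO).2.2
    rw [c.base.left_inv hxb] at this
    rw [← this]
    exact ⟨c.total.map_source hx, by simpa [c.total.left_inv hx] using hx'⟩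
  intro i hi
  rw [(key φ O hO hxO hOs).iteratedFDeriv (𝕜 := ℝ) i |>.eq_of_nhds,
    (key φ' O' hO' hxO' hOs').iteratedFDeriv (𝕜 := ℝ) i |>.eq_of_nhds]
  have s1 : ContDiffAt ℝ ∞ (c.rep φ) (c.base x) := hsm.contDiffAt (hO.mem_nhds hxO)
  have s2 : ContDiffAt ℝ ∞ (c.rep φ') (c.base x) := hsm'.contDiffAt (hO'.mem_nhds hxO')
  have p1 : ContDiffAt ℝ ∞ (fun z => (z, c.rep φ z)) (c.base x) := contDiffAt_id.prodMk s1
  have p2 : ContDiffAt ℝ ∞ (fun z => (z, c.rep φ' z)) (c.base x) := contDiffAt_id.prodMk s2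
  have h0 : c.rep φ (c.base x) = c.rep φ' (c.base x) := by
    simp [rep, c.base.left_inv hxb, he]
  have hΘ : ContDiffAt ℝ ∞ Θ (c.base x, c.rep φ (c.base x)) := hΘT.contDiffAt (hT.mem_nhds hpT)
  refine iteratedFDeriv_precomp_congr (k := k) hf ?_ ?_ ?_ i hi
  · rw [hfx]; exact ContDiffAt.comp (c.base x) (g := Θ) hΘ p1
  · rw [hfx]; exact ContDiffAt.comp (c.base x) (g := Θ) (h0 ▸ hΘ) p2
  · rw [hfx]
    refine iteratedFDeriv_comp_congr p1 p2 hΘ fun i hi => ?_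
    have hi' : ((i : ℕ∞) : WithTop ℕ∞) ≤ ∞ := by exact_mod_cast le_top
    refine (iteratedFDeriv_prodMk contDiffAt_id s1 hi').trans
      (Eq.trans ?_ (iteratedFDeriv_prodMk contDiffAt_id s2 hi').symm)
    rw [h i hi]

end AdaptedChart
end Jets

section JetCharts
variable {m n : ℕ} {M E : Type*}
  [TopologicalSpace M] [ChartedSpace (Euc m) M]
  [TopologicalSpace E] [ChartedSpace (Euc (m + n)) E] {π : E → M}

namespace AdaptedChart
variable (c : AdaptedChart m n π) (k : ℕ)

/-- The natural coordinates of the jet of a local section: base point and derivatives up to order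
`k` (which are already symmetric, so that the symmetrization changes nothing). -/
def sectionCoord (s : LocalSection m n π) : JetModel m n k :=
  (c.base s.pt, fun i => SymMul.symmetrize m n i (iteratedFDeriv ℝ i (c.rep s.toFun) (c.base s.pt)))

/-- The natural coordinates of a jet. -/
def jetCoord (j : Jet m n π k) : JetModel m n k := c.sectionCoord k j.out

theorem sectionCoord_congr {s t : LocalSection m n π} (h : jetSetoid m n π k s t)
    (hs : s.toFun s.pt ∈ c.total.source) : c.sectionCoord k s = c.sectionCoord k t := by
  have h2 := fun i : Fin (k + 1) => h.2.2 c hs i (Nat.lt_succ_iff.1 i.is_lt)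
  refine Prod.ext (by simp [sectionCoord, h.1]) ?_
  funext i
  simp only [sectionCoord, h2 i]

theorem jetCoord_mk {s : LocalSection m n π} (hs : s.toFun s.pt ∈ c.total.source) :
    c.jetCoord k (Jet.mk k s) = c.sectionCoord k s := by
  have h : jetSetoid m n π k s (Jet.mk k s).out :=
    (jetSetoid m n π k).symm (Quotient.exact (Jet.mk_out (Jet.mk k s)))
  exact (c.sectionCoord_congr k h hs).symm

theorem sectionCoord_snd {s : LocalSection m n π} (hs : s.toFun s.pt ∈ c.total.source)
    (i : Fin (k + 1)) :
    ((c.sectionCoord k s).2 i).toMap = iteratedFDeriv ℝ i (c.rep s.toFun) (c.base s.pt) := by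
  obtain ⟨hxb, hxf, O, hO, hxO, hOt, hsm, hOs⟩ := c.exists_rep_contDiffOn s.isLocalSectionAt hs
  exact SymMul.toMap_symmetrize_of_symm fun σ v => iteratedFDeriv_symm hO hsm hxO σ v

theorem sectionCoord_fst (s : LocalSection m n π) : (c.sectionCoord k s).1 = c.base s.pt := rfl

theorem sectionCoord_zero {s : LocalSection m n π} (hs : s.toFun s.pt ∈ c.total.source) :
    ((c.sectionCoord k s).1, ((c.sectionCoord k s).2 0).toMap 0) = c.total (s.toFun s.pt) := by
  obtain ⟨hxb, hxf, -⟩ := c.exists_rep_contDiffOn s.isLocalSectionAt hs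
  refine Prod.ext hxf.symm ?_
  rw [c.sectionCoord_snd k hs]
  refine (iteratedFDeriv_zero_apply (𝕜 := ℝ) (f := c.rep s.toFun) (x := c.base s.pt) 0).trans ?_
  rw [rep, c.base.left_inv hxb]

variable {k}
/-- The order-zero part `(x, u)` of jet coordinates. -/
def jetValue (v : JetModel m n k) : Euc m × Euc n := (v.1, (v.2 0).toMap 0)

theorem jetPoly_self (v : JetModel m n k) : jetPoly v v.1 = (v.2 0).toMap 0 := by
  have := iteratedFDeriv_jetPoly v 0
  have h2 := congrArg (fun q => q 0) this
  refine Eq.trans ?_ h2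
  change _ = iteratedFDeriv ℝ 0 (jetPoly v) v.1 0
  simp

theorem contDiff_jetPoly_right (v : JetModel m n k) : ContDiff ℝ ∞ (jetPoly v) :=
  contDiff_jetPoly.comp (f := fun z : Euc m => ((v, z) : JetModel m n k × Euc m))
    (contDiff_const.prodMk contDiff_id)

theorem base_symm_mem {v : JetModel m n k} (h : jetValue v ∈ c.total.target) :
    c.base.symm v.1 ∈ c.base.source :=
  c.base.map_target (c.fst_mem_target h).1

theorem base_right_inv {v : JetModel m n k} (h : jetValue v ∈ c.total.target) :
    c.base (c.base.symm v.1) = v.1 :=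
  c.base.right_inv (c.fst_mem_target h).1

/-- The polynomial section with given jet coordinates. -/
def polySection (v : JetModel m n k) (h : jetValue v ∈ c.total.target) : LocalSection m n π where
  pt := c.base.symm v.1
  toFun := c.graphSection (jetPoly v)
  isLocalSectionAt := c.isLocalSectionAt_graphSection (contDiff_jetPoly_right v)
    (c.base_symm_mem h) (by rw [c.base_right_inv h, jetPoly_self]; exact h)

theorem polySection_value (v : JetModel m n k) (h : jetValue v ∈ c.total.target) :
    (c.polySection v h).toFun (c.polySection v h).pt = c.total.symm (jetValue v) := by
  change c.total.symm (c.base (c.base.symm v.1), jetPoly v (c.base (c.base.symm v.1))) = _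
  rw [c.base_right_inv h, jetPoly_self]; rfl

theorem polySection_coord (v : JetModel m n k) (h : jetValue v ∈ c.total.target) :
    c.sectionCoord k (c.polySection v h) = v := by
  have hs : (c.polySection v h).toFun (c.polySection v h).pt ∈ c.total.source := by
    rw [polySection_value]; exact c.total.map_target h
  refine Prod.ext (c.base_right_inv h) ?_
  funext i
  refine SymMul.ext' fun w => ?_
  rw [c.sectionCoord_snd k hs]
  change iteratedFDeriv ℝ i (c.rep (c.graphSection (jetPoly v))) (c.base (c.base.symm v.1)) w = _
  rw [c.base_right_inv h, ← iteratedFDeriv_jetPoly v i]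
  have hcont : Continuous fun z => (z, jetPoly v z) :=
    continuous_id.prodMk (contDiff_jetPoly_right v).continuous
  have hev : c.rep (c.graphSection (jetPoly v)) =ᶠ[𝓝 v.1] jetPoly v := by
    have h1 : ∀ᶠ z in 𝓝 v.1, z ∈ c.base.target :=
      c.base.open_target.mem_nhds (c.fst_mem_target h).1
    have h2 : ∀ᶠ z in 𝓝 v.1, (z, jetPoly v z) ∈ c.total.target :=
      hcont.continuousAt.preimage_mem_nhds (c.total.open_target.mem_nhds (by
        rw [jetPoly_self]; exact h))
    filter_upwards [h1, h2] with z hz1 hz2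
    exact c.rep_graphSection hz1 hz2
  exact congrArg (fun q => q w) (hev.iteratedFDeriv (𝕜 := ℝ) i).eq_of_nhds

theorem contDiff_jetValue : ContDiff ℝ ∞ (jetValue : JetModel m n k → Euc m × Euc n) := by
  have h1 : ContDiff ℝ ∞ (fun v : JetModel m n k => ((v, v.1) : JetModel m n k × Euc m)) :=
    contDiff_id.prodMk contDiff_fst
  have h2 : ContDiff ℝ ∞ (fun v : JetModel m n k => jetPoly v v.1) :=
    contDiff_jetPoly.comp (f := fun v : JetModel m n k => ((v, v.1) : JetModel m n k × Euc m)) h1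
  have h : ContDiff ℝ ∞ (fun v : JetModel m n k => (v.1, jetPoly v v.1)) :=
    contDiff_fst.prodMk h2
  have e : (jetValue : JetModel m n k → Euc m × Euc n) = fun v => (v.1, jetPoly v v.1) :=
    funext fun v => Prod.ext rfl (jetPoly_self v).symm
  rw [e]
  exact h

/-- The domain of the change of adapted coordinates. -/
def overlap (c c₂ : AdaptedChart m n π) : Set (Euc m × Euc n) :=
  c.total.target ∩ c.total.symm ⁻¹' c₂.total.source

theorem isOpen_overlap (c c₂ : AdaptedChart m n π) : IsOpen (c.overlap c₂) :=
  c.total.symm.isOpen_inter_preimage c₂.total.open_source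

/-- The base part of the change of adapted coordinates. -/
def baseTrans (c c₂ : AdaptedChart m n π) (z : Euc m) : Euc m := c₂.base (c.base.symm z)

/-- The fibre part of the change of adapted coordinates. -/
def fibTrans (c c₂ : AdaptedChart m n π) (p : Euc m × Euc n) : Euc n := (c₂.total (c.total.symm p)).2

def baseOverlap (c c₂ : AdaptedChart m n π) : Set (Euc m) :=
  c.base.target ∩ c.base.symm ⁻¹' c₂.base.source

theorem isOpen_baseOverlap (c c₂ : AdaptedChart m n π) : IsOpen (c.baseOverlap c₂) :=
  c.base.symm.isOpen_inter_preimage c₂.base.open_source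

theorem contDiffOn_baseTrans (c c₂ : AdaptedChart m n π) :
    ContDiffOn ℝ ∞ (c.baseTrans c₂) (c.baseOverlap c₂) :=
  contMDiffOn_iff_contDiffOn.1
    (c₂.contMDiffOn_base.comp (c.contMDiffOn_base_symm.mono Set.inter_subset_left) fun _ hz => hz.2)

theorem contDiffOn_fibTrans (c c₂ : AdaptedChart m n π) :
    ContDiffOn ℝ ∞ (c.fibTrans c₂) (c.overlap c₂) :=
  (contMDiffOn_iff_contDiffOn.1
    (c₂.contMDiffOn_total.comp (c.contMDiffOn_total_symm.mono Set.inter_subset_left)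
      fun _ hz => hz.2)).snd

theorem overlap_fst {c c₂ : AdaptedChart m n π} {p : Euc m × Euc n} (h : p ∈ c.overlap c₂) :
    p.1 ∈ c.baseOverlap c₂ := by
  obtain ⟨h1, h2⟩ := c.fst_mem_target h.1
  exact ⟨h1, by rw [Set.mem_preimage, h2]; exact c₂.proj_mem _ h.2⟩

variable (k)
variable [IsManifold 𝓘(ℝ, Euc m) ∞ M] [IsManifold 𝓘(ℝ, Euc (m + n)) ∞ E]
  [IsFiberedManifold m n π]

theorem nonempty_localSection_at (e : E) : ∃ s : LocalSection m n π, s.toFun s.pt = e := by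
  obtain ⟨c, hc⟩ := exists_adaptedChart (m := m) (n := n) π e
  have hb := c.proj_mem _ hc
  have he : (c.base (π e), (c.total e).2) = c.total e := Prod.ext (c.proj_eq _ hc) rfl
  refine ⟨⟨π e, c.graphSection fun _ => (c.total e).2,
    c.isLocalSectionAt_graphSection contDiff_const hb ?_⟩, ?_⟩
  · rw [he]; exact c.total.map_source hc
  · change c.total.symm (c.base (π e), (c.total e).2) = e
    rw [he, c.total.left_inv hc]

theorem nonempty_jet (c : AdaptedChart m n π) (k : ℕ) : Nonempty (Jet m n π k) :=
  ⟨Jet.mk k (nonempty_localSection_at (c.total.symm 0)).choose⟩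

open Classical in
/-- The natural chart of `J^kπ` induced by an adapted chart. -/
def jetChart : PartialEquiv (Jet m n π k) (JetModel m n k) where
  toFun := c.jetCoord k
  invFun v := if h : jetValue v ∈ c.total.target then Jet.mk k (c.polySection v h)
    else Classical.choice (c.nonempty_jet k)
  source := Jet.target ⁻¹' c.total.source
  target := jetValue ⁻¹' c.total.target
  map_source' := by
    intro j hj
    rw [← Jet.mk_out j] at hj ⊢
    change jetValue (c.jetCoord k (Jet.mk k j.out)) ∈ c.total.target
    rw [c.jetCoord_mk k hj, jetValue, c.sectionCoord_zero k hj]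
    exact c.total.map_source hj
  map_target' := by
    intro v hv
    have hv' : jetValue v ∈ c.total.target := hv
    rw [dif_pos hv', Set.mem_preimage, Jet.target_mk, polySection_value]
    exact c.total.map_target hv
  left_inv' := by
    intro j hj
    rw [← Jet.mk_out j] at hj ⊢
    set s := j.out
    have hj' : s.toFun s.pt ∈ c.total.source := hj
    have hv : jetValue (c.sectionCoord k s) ∈ c.total.target := by
      rw [jetValue, c.sectionCoord_zero k hj']; exact c.total.map_source hj'
    rw [c.jetCoord_mk k hj', dif_pos hv]
    have hxb := (c.exists_rep_contDiffOn s.isLocalSectionAt hj').1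
    have hpt : (c.polySection _ hv).pt = s.pt := c.base.left_inv hxb
    have hval : (c.polySection _ hv).toFun (c.polySection _ hv).pt = s.toFun s.pt := by
      rw [polySection_value, jetValue, c.sectionCoord_zero k hj', c.total.left_inv hj']
    refine Quotient.sound ⟨hpt, hval, fun c₂ hc' i hi => ?_⟩
    have hval' : (c.polySection _ hv).toFun s.pt = s.toFun s.pt := hpt ▸ hval
    rw [hpt]
    refine rep_congr_chart c c₂ (hpt ▸ (c.polySection _ hv).isLocalSectionAt) s.isLocalSectionAt
      (hval' ▸ hj') (by rw [hval', ← hval]; exact hc') hval' (fun i hi => ?_) i hi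
    have e := c.polySection_coord (c.sectionCoord k s) hv
    have e1 := c.sectionCoord_snd k (s := c.polySection _ hv) (hval ▸ hj') ⟨i, Nat.lt_succ_of_le hi⟩
    have e2 := c.sectionCoord_snd k hj' ⟨i, Nat.lt_succ_of_le hi⟩
    rw [e, e2, hpt] at e1
    exact e1.symm
  right_inv' := by
    intro v hv
    have hv' : jetValue v ∈ c.total.target := hv
    rw [dif_pos hv', c.jetCoord_mk k (by rw [polySection_value]; exact c.total.map_target hv),
      polySection_coord]

open Classical in
theorem jetChart_symm_apply {v : JetModel m n k} (h : jetValue v ∈ c.total.target) :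
    (c.jetChart k).symm v = Jet.mk k (c.polySection v h) := by
  change (if h : jetValue v ∈ c.total.target then Jet.mk k (c.polySection v h)
    else Classical.choice (c.nonempty_jet k)) = _
  rw [dif_pos h]

theorem jetChart_apply (j : Jet m n π k) : c.jetChart k j = c.jetCoord k j := rfl

theorem jet_trans_source (c c₂ : AdaptedChart m n π) :
    ((c.jetChart k).symm.trans (c₂.jetChart k)).source = jetValue ⁻¹' (c.overlap c₂) := by
  ext v
  constructor
  · rintro ⟨h1, h2⟩
    have h1' : jetValue v ∈ c.total.target := h1
    refine ⟨h1', ?_⟩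
    have h2' : ((c.jetChart k).symm v).target ∈ c₂.total.source := h2
    rwa [c.jetChart_symm_apply k h1', Jet.target_mk, polySection_value] at h2'
  · rintro ⟨h1, h2⟩
    refine ⟨h1, ?_⟩
    change ((c.jetChart k).symm v).target ∈ c₂.total.source
    rwa [c.jetChart_symm_apply k h1, Jet.target_mk, polySection_value]

theorem isOpen_jet_trans_source (c c₂ : AdaptedChart m n π) :
    IsOpen ((c.jetChart k).symm.trans (c₂.jetChart k)).source := by
  rw [jet_trans_source]
  exact (c.isOpen_overlap c₂).preimage contDiff_jetValue.continuous

theorem jet_trans_apply (c c₂ : AdaptedChart m n π) {v : JetModel m n k}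
    (hv : jetValue v ∈ c.overlap c₂) :
    ((c.jetChart k).symm.trans (c₂.jetChart k) v).1 = c.baseTrans c₂ v.1 ∧
    ∀ i, (((c.jetChart k).symm.trans (c₂.jetChart k) v).2 i).toMap =
      iteratedFDeriv ℝ i (fun y => c.fibTrans c₂ (c₂.baseTrans c y, jetPoly v (c₂.baseTrans c y)))
        (c.baseTrans c₂ v.1) := by
  have e : (c.jetChart k).symm.trans (c₂.jetChart k) v
      = c₂.sectionCoord k (c.polySection v hv.1) := by
    rw [PartialEquiv.trans_apply, c.jetChart_symm_apply k hv.1, jetChart_apply,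
      c₂.jetCoord_mk k (by rw [polySection_value]; exact hv.2)]
  rw [e]
  refine ⟨rfl, fun i => ?_⟩
  rw [c₂.sectionCoord_snd k (by rw [polySection_value]; exact hv.2)]
  rfl

theorem jet_trans_contDiffOn (c c₂ : AdaptedChart m n π) :
    ContDiffOn ℝ ∞ ((c.jetChart k).symm.trans (c₂.jetChart k))
      ((c.jetChart k).symm.trans (c₂.jetChart k)).source := by
  rw [jet_trans_source]
  set S := (jetValue : JetModel m n k → _) ⁻¹' (c.overlap c₂) with hS
  have hbase : ContDiffOn ℝ ∞ (fun v : JetModel m n k => c.baseTrans c₂ v.1) S :=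
    (c.contDiffOn_baseTrans c₂).comp contDiffOn_fst fun v hv => overlap_fst (p := jetValue v) hv
  refine ContDiffOn.congr (f := fun v => (((c.jetChart k).symm.trans (c₂.jetChart k) v).1,
    ((c.jetChart k).symm.trans (c₂.jetChart k) v).2)) ?_ (fun _ _ => rfl)
  refine ContDiffOn.prodMk (hbase.congr fun v hv => (jet_trans_apply k c c₂ hv).1) ?_
  rw [contDiffOn_pi]
  intro i
  let G : JetModel m n k × Euc m → Euc n := fun p =>
    c.fibTrans c₂ (c₂.baseTrans c p.2, jetPoly p.1 (c₂.baseTrans c p.2))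
  let O1 : Set (JetModel m n k × Euc m) := Prod.snd ⁻¹' (c₂.baseOverlap c)
  have hO1 : IsOpen O1 := (c₂.isOpen_baseOverlap c).preimage continuous_snd
  have hin : ContDiffOn ℝ ∞ (fun p : JetModel m n k × Euc m =>
      (c₂.baseTrans c p.2, jetPoly p.1 (c₂.baseTrans c p.2))) O1 := by
    have hb : ContDiffOn ℝ ∞ (fun p : JetModel m n k × Euc m => c₂.baseTrans c p.2) O1 :=
      (c₂.contDiffOn_baseTrans c).comp contDiffOn_snd fun _ hp => hp
    exact hb.prodMk (contDiff_jetPoly.comp_contDiffOn (contDiffOn_fst.prodMk hb))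
  let O : Set (JetModel m n k × Euc m) := O1 ∩ (fun p : JetModel m n k × Euc m =>
      (c₂.baseTrans c p.2, jetPoly p.1 (c₂.baseTrans c p.2))) ⁻¹' (c.overlap c₂)
  have hO : IsOpen O := hin.continuousOn.isOpen_inter_preimage hO1 (c.isOpen_overlap c₂)
  have hG : ContDiffOn ℝ ∞ G O :=
    (c.contDiffOn_fibTrans c₂).comp (hin.mono Set.inter_subset_left) fun _ hp => hp.2
  have hP := contDiffOn_iteratedFDeriv_param hO hG i
  have hcomp := hP.comp (contDiffOn_id.prodMk hbase) (s := S) (by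
    intro v hv
    have h1 : v.1 ∈ c.baseOverlap c₂ := overlap_fst (p := jetValue v) hv
    have hbb : c₂.baseTrans c (c.baseTrans c₂ v.1) = v.1 := by
      simp only [baseTrans]
      rw [c₂.base.left_inv h1.2, c.base.right_inv h1.1]
    refine ⟨⟨c₂.base.map_source h1.2, ?_⟩, ?_⟩
    · change c₂.base.symm (c₂.base (c.base.symm v.1)) ∈ c.base.source
      rw [c₂.base.left_inv h1.2]; exact c.base.map_target h1.1
    · change (c₂.baseTrans c (c.baseTrans c₂ v.1), jetPoly v (c₂.baseTrans c (c.baseTrans c₂ v.1)))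
        ∈ c.overlap c₂
      rw [hbb, jetPoly_self]; exact hv)
  refine ((SymMul.symmetrize m n i).contDiff.comp_contDiffOn hcomp).congr fun v hv => ?_
  rw [← SymMul.symmetrize_toMap (((c.jetChart k).symm.trans (c₂.jetChart k) v).2 i),
    (jet_trans_apply k c c₂ hv).2 i]
  rfl

end AdaptedChart

variable [IsManifold 𝓘(ℝ, Euc m) ∞ M] [IsManifold 𝓘(ℝ, Euc (m + n)) ∞ E]

variable (m n) in
/-- The atlas of natural charts of `J^kπ`. -/
def jetAtlas (π : E → M) [IsFiberedManifold m n π] (k : ℕ) :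
    SmoothAtlas (JetModel m n k) (Jet m n π k) where
  charts := Set.range fun c : AdaptedChart m n π => c.jetChart k
  cover j := by
    obtain ⟨c, hc⟩ := exists_adaptedChart (m := m) (n := n) π j.target
    exact ⟨_, ⟨c, rfl⟩, hc⟩
  open_source := by
    rintro _ ⟨c, rfl⟩ _ ⟨c₂, rfl⟩
    exact c.isOpen_jet_trans_source k c₂
  contDiffOn := by
    rintro _ ⟨c, rfl⟩ _ ⟨c₂, rfl⟩
    exact c.jet_trans_contDiffOn k c₂

variable [IsFiberedManifold m n π] {k : ℕ}
instance : TopologicalSpace (Jet m n π k) := (jetAtlas m n π k).toCore.toTopologicalSpace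
instance : ChartedSpace (JetModel m n k) (Jet m n π k) := (jetAtlas m n π k).toCore.toChartedSpace
instance : IsManifold 𝓘(ℝ, JetModel m n k) ∞ (Jet m n π k) := (jetAtlas m n π k).isManifold
end JetCharts

section Forms
variable {m n : ℕ}

/-- The vector in natural coordinates on `J¹π` that has horizontal part `a` and no other
component; for `a` the `k`-th standard basis vector this is `∂/∂x_k`. -/
def horVec (m n : ℕ) : Euc m →L[ℝ] JetModel m n 1 :=
  ContinuousLinearMap.inl ℝ (Euc m) ((i : Fin 2) → SymMul m n i)

/-- Linear maps as symmetric `1`-linear maps. -/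
def SymMul.ofLin (z : Euc m →L[ℝ] Euc n) : SymMul m n 1 :=
  SymMul.symmetrize m n 1 (ContinuousMultilinearMap.ofSubsingleton ℝ (Euc m) (Euc n) (0 : Fin 1) z)

theorem SymMul.ofLin_toMap (z : Euc m →L[ℝ] Euc n) (v : Fin 1 → Euc m) :
    (SymMul.ofLin z).toMap v = z (v 0) := by
  rw [SymMul.ofLin, SymMul.toMap_symmetrize]
  simp

/-- The vertical vector with first-derivative component `z`. -/
def topVec (m n : ℕ) : (Euc m →L[ℝ] Euc n) →ₗ[ℝ] JetModel m n 1 where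
  toFun z := (0, Pi.single (1 : Fin 2) (SymMul.ofLin z))
  map_add' z z' := by
    have : SymMul.ofLin (z + z') = SymMul.ofLin z + SymMul.ofLin z' :=
      SymMul.ext' fun v => by simp [SymMul.ofLin_toMap]
    rw [this, Pi.single_add]; simp
  map_smul' a z := by
    have : SymMul.ofLin (a • z) = a • SymMul.ofLin z :=
      SymMul.ext' fun v => by simp [SymMul.ofLin_toMap]
    rw [this, Pi.single_smul]; simp

/-- The coordinate vectors `∂/∂x_k`. -/
def dxVec (m n : ℕ) (k : Fin m) : JetModel m n 1 := horVec m n (EuclideanSpace.single k 1)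

/-- The coordinate vectors `∂/∂u_i^α`. -/
def duVec (i : Fin m) (α : Fin n) : JetModel m n 1 :=
  topVec m n ((EuclideanSpace.proj i).smulRight (EuclideanSpace.single α (1 : ℝ)))

instance (X : Type*) [NormedAddCommGroup X] [NormedSpace ℝ X] [FiniteDimensional ℝ X] (k : ℕ) :
    FiniteDimensional ℝ (X [⋀^Fin k]→L[ℝ] ℝ) := by
  have : FiniteDimensional ℝ (ContinuousMultilinearMap ℝ (fun _ : Fin k => X) ℝ) :=
    FiniteDimensional.of_injective
      (ContinuousMultilinearMap.toMultilinearMapLinear :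
        (ContinuousMultilinearMap ℝ (fun _ : Fin k => X) ℝ) →ₗ[ℝ] MultilinearMap ℝ (fun _ : Fin k => X) ℝ)
      ContinuousMultilinearMap.toMultilinearMap_injective
  exact FiniteDimensional.of_injective
    (ContinuousAlternatingMap.toContinuousMultilinearMapLinear (R := ℝ) (A := ℝ) (M := X) (N := ℝ) (ι := Fin k))
    ContinuousAlternatingMap.toContinuousMultilinearMap_injective

/-- The coefficient `p_α^{ij}` of `du_i^α ∧ d^{m-1}x_j` in a form written in natural coordinates of
`J¹π`, where `d^{m-1}x_j` is the contraction of `dx_1 ∧ … ∧ dx_m` with `∂/∂x_j`. -/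
def topMomentum (θ : JetModel m n 1 [⋀^Fin m]→L[ℝ] ℝ) (i j : Fin m) (α : Fin n) : ℝ :=
  θ (Function.update (dxVec m n) j (duVec i α))

/-- The coordinate expressions of the extended symmetric multimomentum forms: `m`-covectors that
vanish on two vertical vectors and satisfy `p_α^{ij} = p_α^{ji}`. -/
def dagModel (m n : ℕ) : Submodule ℝ (JetModel m n 1 [⋀^Fin m]→L[ℝ] ℝ) where
  carrier := {θ | (∀ (X : Fin m → JetModel m n 1) (k l : Fin m), k ≠ l →
      (X k).1 = 0 → (X l).1 = 0 → θ X = 0) ∧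
    ∀ i j α, topMomentum θ i j α = topMomentum θ j i α}
  add_mem' := fun {θ θ'} h h' => ⟨fun X k l hkl hk hl => by
      rw [ContinuousAlternatingMap.add_apply, h.1 X k l hkl hk hl, h'.1 X k l hkl hk hl, add_zero],
    fun i j α => by
      have e := h.2 i j α
      have e' := h'.2 i j α
      simp only [topMomentum, ContinuousAlternatingMap.add_apply] at e e' ⊢
      rw [e, e']⟩
  zero_mem' := ⟨fun _ _ _ _ _ _ => rfl, fun _ _ _ => rfl⟩
  smul_mem' := fun c θ h => ⟨fun X k l hkl hk hl => by
      rw [ContinuousAlternatingMap.smul_apply, h.1 X k l hkl hk hl, smul_zero],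
    fun i j α => by
      have e := h.2 i j α
      simp only [topMomentum, ContinuousAlternatingMap.smul_apply] at e ⊢
      rw [e]⟩

theorem smulRight_expand (ℓ : Euc m →L[ℝ] ℝ) (b : Euc n) :
    ℓ.smulRight b = ∑ i, ∑ α, (ℓ (EuclideanSpace.single i 1) * b α) •
      ((EuclideanSpace.proj i : Euc m →L[ℝ] ℝ).smulRight (EuclideanSpace.single α (1 : ℝ))) := by
  ext x β
  have hx : ℓ x = ∑ i, x i * ℓ (EuclideanSpace.single i 1) := by
    conv_lhs => rw [← (EuclideanSpace.basisFun (Fin m) ℝ).sum_repr x]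
    simp
  simp [hx, Finset.sum_mul, Pi.single_apply]
  exact Finset.sum_congr rfl fun i _ => by ring

variable {θ : JetModel m n 1 [⋀^Fin m]→L[ℝ] ℝ}

theorem topMomentum_expand (θ : JetModel m n 1 [⋀^Fin m]→L[ℝ] ℝ) (j : Fin m) (ℓ : Euc m →L[ℝ] ℝ) (b : Euc n) :
    θ (Function.update (dxVec m n) j (topVec m n (ℓ.smulRight b)))
      = ∑ i, ∑ α, (ℓ (EuclideanSpace.single i 1) * b α) * topMomentum θ i j α := by
  have := congrArg ((θ.toMultilinearMap.toLinearMap (dxVec m n) j).comp (topVec m n))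
    (smulRight_expand ℓ b)
  simp only [map_sum, map_smul] at this
  exact this

/-- Insertion of `y` followed by the exterior product with the covector `ℓ`. -/
theorem exists_alternating_derivation (θ : JetModel m n 1 [⋀^Fin m]→L[ℝ] ℝ)
    (ℓ : Euc m →L[ℝ] ℝ) (y : JetModel m n 1) :
    ∃ S : Euc m [⋀^Fin m]→ₗ[ℝ] ℝ, ∀ a, S a =
      ∑ j, ℓ (a j) * θ (Function.update (fun k => horVec m n (a k)) j y) := by
  let f : MultilinearMap ℝ (fun _ : Fin m => Euc m) ℝ :=
    ∑ j, θ.toMultilinearMap.compLinearMap fun k =>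
      if k = j then ((ℓ.smulRight y : Euc m →L[ℝ] JetModel m n 1) : Euc m →ₗ[ℝ] JetModel m n 1)
        else (horVec m n : Euc m →ₗ[ℝ] JetModel m n 1)
  have hf : ∀ a, f a = ∑ j, ℓ (a j) * θ (Function.update (fun k => horVec m n (a k)) j y) := by
    intro a
    simp only [f, sum_apply, MultilinearMap.compLinearMap_apply]
    refine Finset.sum_congr rfl fun j _ => ?_
    rw [← smul_eq_mul, ← ContinuousAlternatingMap.map_update_smul]
    change θ _ = θ _
    congr 1
    funext k
    by_cases h : k = j
    · subst h; simp
    · simp [h]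
  refine ⟨{ f with map_eq_zero_of_eq' := ?_ }, hf⟩
  intro a k l hkl hne
  change f a = 0
  rw [hf]
  have hz : ∀ j, j ≠ k → j ≠ l →
      ℓ (a j) * θ (Function.update (fun k => horVec m n (a k)) j y) = 0 := by
    intro j hk hl
    rw [θ.map_eq_zero_of_eq _ (i := k) (j := l) _ hne, mul_zero]
    simp [hk.symm, hl.symm, hkl]
  rw [Finset.sum_eq_add k l hne (fun j _ h => hz j h.1 h.2) (by simp) (by simp), hkl, ← mul_add]
  have : Function.update (fun k => horVec m n (a k)) l y
      = Function.update (fun k => horVec m n (a k)) k y ∘ Equiv.swap k l := by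
    funext i
    simp only [Function.comp]
    rcases eq_or_ne i k with rfl | hik
    · simp [hne, hne.symm, hkl]
    rcases eq_or_ne i l with rfl | hil
    · simp
    · simp [Equiv.swap_apply_of_ne_of_ne hik hil, hik, hil]
  have hsw := θ.toAlternatingMap.map_swap (Function.update (fun k => horVec m n (a k)) k y) hne
  have hsw' : θ (Function.update (fun k => horVec m n (a k)) k y ∘ Equiv.swap k l)
      = - θ (Function.update (fun k => horVec m n (a k)) k y) := hsw
  rw [this, hsw', add_neg_cancel, mul_zero]

theorem dagModel_symm (hθ : θ ∈ dagModel m n) (a : Fin m → Euc m) (ℓ ℓ' : Euc m →L[ℝ] ℝ)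
    (b : Euc n) :
    ∑ j, ℓ' (a j) * θ (Function.update (fun k => horVec m n (a k)) j
        (topVec m n (ℓ.smulRight b)))
      = ∑ j, ℓ (a j) * θ (Function.update (fun k => horVec m n (a k)) j
        (topVec m n (ℓ'.smulRight b))) := by
  obtain ⟨S, hS⟩ := exists_alternating_derivation θ ℓ' (topVec m n (ℓ.smulRight b))
  obtain ⟨S', hS'⟩ := exists_alternating_derivation θ ℓ (topVec m n (ℓ'.smulRight b))
  rw [← hS, ← hS']
  have : S = S' := by
    let e := (EuclideanSpace.basisFun (Fin m) ℝ).toBasis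
    rw [S.eq_smul_basis_det e, S'.eq_smul_basis_det e]
    congr 1
    rw [hS, hS']
    have he : ∀ k, e k = EuclideanSpace.single k (1 : ℝ) := fun k => by simp [e]
    have h1 : (fun k => horVec m n (EuclideanSpace.single k 1)) = dxVec m n := rfl
    simp only [he]
    simp only [h1, topMomentum_expand, Finset.mul_sum]
    rw [Finset.sum_comm]
    refine Finset.sum_congr rfl fun i _ => Finset.sum_congr rfl fun j _ =>
      Finset.sum_congr rfl fun α _ => ?_
    rw [hθ.2 i j α]
    ring
  rw [this]

theorem dagModel_update_congr (hθ : θ ∈ dagModel m n) {X X' : Fin m → JetModel m n 1}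
    (h : ∀ k, (X k).1 = (X' k).1) (j : Fin m) {y : JetModel m n 1} (hy : y.1 = 0) :
    θ (Function.update X j y) = θ (Function.update X' j y) := by
  have key : ∀ s : Finset (Fin m),
      θ (Function.update (s.piecewise X' X) j y) = θ (Function.update X j y) := by
    intro s
    induction s using Finset.induction_on with
    | empty => simp
    | insert k s hk ih =>
      rw [← ih]
      rcases eq_or_ne k j with rfl | hkj
      · rw [Finset.piecewise_insert, Function.update_idem]
      rw [Finset.piecewise_insert, Function.update_comm hkj]
      have e : Function.update (s.piecewise X' X) j y
          = Function.update (Function.update (s.piecewise X' X) j y) k (X k) := by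
        funext i
        rcases eq_or_ne i k with rfl | hik
        · simp [hkj, hk]
        · simp [hik]
      conv_rhs => rw [e]
      rw [← sub_eq_zero, ← ContinuousAlternatingMap.map_update_sub]
      refine hθ.1 _ k j hkj ?_ ?_
      · simp [h k]
      · simp [hkj.symm, hy]
  have := key Finset.univ
  rw [Finset.piecewise_univ] at this
  exact this.symm

theorem dagModel_comp (hθ : θ ∈ dagModel m n) (A : JetModel m n 1 →L[ℝ] JetModel m n 1)
    (G G' : Euc m →L[ℝ] Euc m) (H : Euc n →L[ℝ] Euc n) (hG : ∀ x, G' (G x) = x)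
    (hA1 : ∀ w, (A w).1 = G w.1) (hA2 : ∀ z, A (topVec m n z) = topVec m n (H.comp (z.comp G'))) :
    θ.compContinuousLinearMap A ∈ dagModel m n := by
  refine ⟨fun X k l hkl hk hl => hθ.1 _ k l hkl ?_ ?_, ?_⟩
  · simp [hA1, hk]
  · simp [hA1, hl]
  have main : ∀ (j : Fin m) (ℓ : Euc m →L[ℝ] ℝ) (b : Euc n),
      θ.compContinuousLinearMap A (Function.update (dxVec m n) j (topVec m n (ℓ.smulRight b)))
      = θ (Function.update (fun k => horVec m n (G (EuclideanSpace.single k 1))) j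
        (topVec m n ((ℓ.comp G').smulRight (H b)))) := by
    intro j ℓ b
    have e : (A ∘ Function.update (dxVec m n) j (topVec m n (ℓ.smulRight b)))
      = Function.update (fun k => A (dxVec m n k)) j
        (topVec m n ((ℓ.comp G').smulRight (H b))) := by
      funext k
      rcases eq_or_ne k j with rfl | hk
      · simp only [Function.comp, Function.update_self, hA2]
        congr 1
        ext x; simp
      · simp [hk]
    rw [ContinuousAlternatingMap.compContinuousLinearMap_apply, e]
    refine dagModel_update_congr hθ (fun k => ?_) j rfl
    rw [hA1]; rfl
  intro i j α
  have hs := dagModel_symm hθ (fun k => G (EuclideanSpace.single k 1))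
    ((EuclideanSpace.proj i : Euc m →L[ℝ] ℝ).comp G')
    ((EuclideanSpace.proj j : Euc m →L[ℝ] ℝ).comp G') (H (EuclideanSpace.single α 1))
  have hp : ∀ i k : Fin m, (EuclideanSpace.proj i : Euc m →L[ℝ] ℝ) (EuclideanSpace.single k 1)
      = if i = k then 1 else 0 := fun i k => by simp
  simp only [ContinuousLinearMap.comp_apply, hG, hp, ite_mul, one_mul, zero_mul, Finset.sum_ite_eq,
    Finset.mem_univ, if_true] at hs
  simp only [topMomentum, duVec, main]
  exact hs

/-- The model fibre of `J²π^†`, with coordinates `(p, p_α^i, p_α^I)`. -/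
def DagModel (m n : ℕ) : Type := dagModel m n
namespace DagModel
instance : NormedAddCommGroup (DagModel m n) := inferInstanceAs (NormedAddCommGroup (dagModel m n))
instance : NormedSpace ℝ (DagModel m n) := inferInstanceAs (NormedSpace ℝ (dagModel m n))
instance : FiniteDimensional ℝ (DagModel m n) :=
  inferInstanceAs (FiniteDimensional ℝ (dagModel m n))

/-- The underlying form. -/
def toForm : DagModel m n →L[ℝ] (JetModel m n 1 [⋀^Fin m]→L[ℝ] ℝ) where
  toFun u := u.1
  map_add' _ _ := rfl
  map_smul' _ _ := rfl
  cont := continuous_subtype_val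

theorem toForm_mem (u : DagModel m n) : u.toForm ∈ dagModel m n := u.2
def ofForm (θ : JetModel m n 1 [⋀^Fin m]→L[ℝ] ℝ) (h : θ ∈ dagModel m n) : DagModel m n := ⟨θ, h⟩
theorem toForm_ofForm (θ : JetModel m n 1 [⋀^Fin m]→L[ℝ] ℝ) (h : θ ∈ dagModel m n) :
    (ofForm θ h).toForm = θ := rfl
theorem toForm_injective : Function.Injective (toForm : DagModel m n → _) :=
  fun _ _ h => Subtype.ext h

/-- The model semibasic forms: those that vanish on one vertical vector. -/
def semibasic (m n : ℕ) : Submodule ℝ (DagModel m n) where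
  carrier := {u | ∀ (X : Fin m → JetModel m n 1) (k : Fin m), (X k).1 = 0 → u.toForm X = 0}
  add_mem' := fun {u u'} h h' X k hk => by
    rw [map_add, ContinuousAlternatingMap.add_apply, h X k hk, h' X k hk, add_zero]
  zero_mem' := fun X k hk => by simp
  smul_mem' := fun c u h X k hk => by
    rw [map_smul, ContinuousAlternatingMap.smul_apply, h X k hk, smul_zero]

end DagModel

/-- The model fibre of `J²π^‡`, with coordinates `(p_α^i, p_α^I)`. -/
def DdagModel (m n : ℕ) : Type := DagModel m n ⧸ DagModel.semibasic m n

namespace DdagModel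
instance : IsClosed (DagModel.semibasic m n : Set (DagModel m n)) :=
  Submodule.closed_of_finiteDimensional _
instance : NormedAddCommGroup (DdagModel m n) :=
  inferInstanceAs (NormedAddCommGroup (DagModel m n ⧸ DagModel.semibasic m n))
instance : NormedSpace ℝ (DdagModel m n) :=
  inferInstanceAs (NormedSpace ℝ (DagModel m n ⧸ DagModel.semibasic m n))
instance : FiniteDimensional ℝ (DdagModel m n) :=
  inferInstanceAs (FiniteDimensional ℝ (DagModel m n ⧸ DagModel.semibasic m n))
end DdagModel

def DagModel.toDdagₗ (m n : ℕ) : DagModel m n →ₗ[ℝ] DdagModel m n := (DagModel.semibasic m n).mkQ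

/-- The quotient map of the model fibres. -/
def DagModel.toDdag (m n : ℕ) : DagModel m n →L[ℝ] DdagModel m n :=
  (DagModel.toDdagₗ m n).toContinuousLinearMap

/-- Pull-back of forms depends smoothly on the form and on the linear map. -/
theorem contDiffOn_pullback {P : Type*} [NormedAddCommGroup P] [NormedSpace ℝ P] {s : Set P}
    {a : P → DagModel m n} {A : P → JetModel m n 1 →L[ℝ] JetModel m n 1} {b : P → DagModel m n}
    (ha : ContDiffOn ℝ ∞ a s) (hA : ContDiffOn ℝ ∞ A s)
    (hb : ∀ p ∈ s, (b p).toForm = (a p).toForm.compContinuousLinearMap (A p)) :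
    ContDiffOn ℝ ∞ b s := by
  let N := ContinuousMultilinearMap ℝ (fun _ : Fin m => JetModel m n 1) ℝ
  have : FiniteDimensional ℝ N :=
    FiniteDimensional.of_injective
      (ContinuousMultilinearMap.toMultilinearMapLinear :
        N →ₗ[ℝ] MultilinearMap ℝ (fun _ : Fin m => JetModel m n 1) ℝ)
      ContinuousMultilinearMap.toMultilinearMap_injective
  let ι : DagModel m n →ₗ[ℝ] N :=
    (ContinuousAlternatingMap.toContinuousMultilinearMapLinear (R := ℝ) (A := ℝ)
      (M := JetModel m n 1) (N := ℝ) (ι := Fin m)).comp DagModel.toForm.toLinearMap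
  have hι : Function.Injective ι :=
    ContinuousAlternatingMap.toContinuousMultilinearMap_injective.comp DagModel.toForm_injective
  obtain ⟨ρ, hρ⟩ := ι.exists_leftInverse_of_injective (LinearMap.ker_eq_bot.2 hι)
  have h1 : ContDiffOn ℝ ∞ (fun p => ι.toContinuousLinearMap (a p)) s :=
    ι.toContinuousLinearMap.contDiff.comp_contDiffOn ha
  have h2 : ContDiffOn ℝ ∞ (fun p =>
      ContinuousMultilinearMap.compContinuousLinearMapContinuousMultilinear ℝ
        (fun _ : Fin m => JetModel m n 1) (fun _ : Fin m => JetModel m n 1) ℝ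
          (fun _ : Fin m => A p)) s :=
    (ContinuousMultilinearMap.contDiff _).comp_contDiffOn (contDiffOn_pi.2 fun _ => hA)
  refine ((ρ.toContinuousLinearMap).contDiff.comp_contDiffOn (h2.clm_apply h1)).congr ?_
  intro p hp
  have h3 : b p = ρ (ι (b p)) := (LinearMap.congr_fun hρ (b p)).symm
  rw [h3]
  change _ = ρ _
  congr 1
  change (b p).toForm.toContinuousMultilinearMap = _
  rw [hb p hp]
  rfl
end Forms

section JetCalculus
variable {m n : ℕ} {M E : Type*}
  [TopologicalSpace M] [ChartedSpace (Euc m) M]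
  [TopologicalSpace E] [ChartedSpace (Euc (m + n)) E] {π : E → M}
  [IsManifold 𝓘(ℝ, Euc m) ∞ M] [IsManifold 𝓘(ℝ, Euc (m + n)) ∞ E] [IsFiberedManifold m n π]

namespace AdaptedChart
variable (c c₂ : AdaptedChart m n π) (k : ℕ)

/-- The natural chart as a chart of the manifold of jets. -/
def jetHomeo : OpenPartialHomeomorph (Jet m n π k) (JetModel m n k) :=
  (jetAtlas m n π k).toCore.openPartialHomeomorph (c.jetChart k) ⟨c, rfl⟩

theorem jetHomeo_mem : c.jetHomeo k ∈ atlas (JetModel m n k) (Jet m n π k) :=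
  Set.mem_iUnion₂.2 ⟨c.jetChart k, ⟨c, rfl⟩, rfl⟩

theorem jetHomeo_apply (j : Jet m n π k) : c.jetHomeo k j = c.jetCoord k j := rfl
theorem jetHomeo_symm_apply (v : JetModel m n k) : (c.jetHomeo k).symm v = (c.jetChart k).symm v := rfl
theorem jetHomeo_source : (c.jetHomeo k).source = Jet.target ⁻¹' c.total.source := rfl
theorem jetHomeo_target : (c.jetHomeo k).target = jetValue ⁻¹' c.total.target := rfl

theorem jetHomeo_mdiff : (c.jetHomeo k).MDifferentiable 𝓘(ℝ, JetModel m n k) 𝓘(ℝ, JetModel m n k) :=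
  have : IsManifold 𝓘(ℝ, JetModel m n k) 1 (Jet m n π k) := IsManifold.of_le (n := ∞) (by simp)
  mdifferentiable_of_mem_atlas (c.jetHomeo_mem k)

/-- The transition map between natural charts. -/
def jetTrans : JetModel m n k → JetModel m n k := (c.jetChart k).symm.trans (c₂.jetChart k)

theorem jetTrans_add_topVec {v : JetModel m n 1} (hv : jetValue v ∈ c.overlap c₂)
    (z : Euc m →L[ℝ] Euc n) (t : ℝ) :
    c.jetTrans c₂ 1 (v + t • topVec m n z) = c.jetTrans c₂ 1 v + t • topVec m n
      (((fderiv ℝ (c.fibTrans c₂) (jetValue v)).comp (ContinuousLinearMap.inr ℝ (Euc m) (Euc n))).comp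
        (z.comp (fderiv ℝ (c₂.baseTrans c) (c.baseTrans c₂ v.1)))) := by
  set u : JetModel m n 1 := v + t • topVec m n z with hu
  have hu1 : u.1 = v.1 := by simp [hu, topVec]
  have hu0 : (u.2 0).toMap 0 = (v.2 0).toMap 0 := by
    have : u.2 0 = v.2 0 := by simp [hu, topVec]
    rw [this]
  have hval : jetValue u = jetValue v := Prod.ext hu1 hu0
  have hutop : ∀ x : Euc m, (u.2 1).toMap (fun _ => x) = (v.2 1).toMap (fun _ => x) + t • z x := by
    intro x
    let top : JetModel m n 1 → SymMul m n 1 := fun w => w.2 1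
    have h1 : top u = top v + t • SymMul.ofLin z := by simp [top, hu, topVec]
    have h2 : (top u).toMap = (top v).toMap + t • (SymMul.ofLin z).toMap := by
      rw [h1, map_add, map_smul]
    have h3 := congrArg (fun q => q (fun _ => x)) h2
    simp only [add_apply, smul_apply, SymMul.ofLin_toMap] at h3
    exact h3
  have huv : jetValue u ∈ c.overlap c₂ := hval ▸ hv
  obtain ⟨h1, h2⟩ := jet_trans_apply 1 c c₂ hv
  obtain ⟨g1, g2⟩ := jet_trans_apply 1 c c₂ huv
  have hb := overlap_fst hv
  have hbb : c₂.baseTrans c (c.baseTrans c₂ v.1) = v.1 := by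
    have hb' : v.1 ∈ c.baseOverlap c₂ := hb
    simp only [baseTrans]
    rw [c₂.base.left_inv hb'.2, c.base.right_inv hb'.1]
  have hb' : c.baseTrans c₂ v.1 ∈ c₂.baseOverlap c := by
    have hb' : v.1 ∈ c.baseOverlap c₂ := hb
    refine ⟨c₂.base.map_source hb'.2, ?_⟩
    change c₂.base.symm (c₂.base (c.base.symm v.1)) ∈ c.base.source
    rw [c₂.base.left_inv hb'.2]; exact c.base.map_target hb'.1
  have hdb : HasFDerivAt (c₂.baseTrans c) (fderiv ℝ (c₂.baseTrans c) (c.baseTrans c₂ v.1))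
      (c.baseTrans c₂ v.1) :=
    (((c₂.contDiffOn_baseTrans c).contDiffAt ((c₂.isOpen_baseOverlap c).mem_nhds hb')).differentiableAt
      (by simp)).hasFDerivAt
  have hdf : HasFDerivAt (c.fibTrans c₂) (fderiv ℝ (c.fibTrans c₂) (jetValue v)) (jetValue v) :=
    (((c.contDiffOn_fibTrans c₂).contDiffAt ((c.isOpen_overlap c₂).mem_nhds hv)).differentiableAt
      (by simp)).hasFDerivAt
  have hpoly : ∀ w : JetModel m n 1,
      HasFDerivAt (jetPoly w) (fderiv ℝ (jetPoly w) v.1) v.1 := fun w =>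
    ((contDiff_jetPoly_right w).differentiable (by simp) _).hasFDerivAt
  have hpoly' : ∀ w : JetModel m n 1, ∀ x, fderiv ℝ (jetPoly w) w.1 x = (w.2 1).toMap (fun _ => x) := by
    intro w x
    have := iteratedFDeriv_jetPoly w 1
    have h2 := congrArg (fun q => q (fun _ => x)) this
    refine Eq.trans ?_ h2
    change _ = iteratedFDeriv ℝ 1 (jetPoly w) w.1 _
    rw [iteratedFDeriv_one_apply]
  have hself : ∀ w : JetModel m n 1, jetValue w = jetValue v → jetPoly w v.1 = (jetValue v).2 := by
    intro w hw
    have hw1 : (jetValue w).1 = (jetValue v).1 := by rw [hw]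
    have hw1 : w.1 = v.1 := hw1
    rw [← hw1, jetPoly_self, ← hw]; rfl
  have hder : ∀ w : JetModel m n 1, jetValue w = jetValue v →
      HasFDerivAt (fun y => c.fibTrans c₂ (c₂.baseTrans c y, jetPoly w (c₂.baseTrans c y)))
        (((fderiv ℝ (c.fibTrans c₂) (jetValue v)).comp
          ((ContinuousLinearMap.id ℝ (Euc m)).prod (fderiv ℝ (jetPoly w) v.1))).comp
            (fderiv ℝ (c₂.baseTrans c) (c.baseTrans c₂ v.1))) (c.baseTrans c₂ v.1) := by
    intro w hw
    have e1 : HasFDerivAt (fun y => (y, jetPoly w y))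
        ((ContinuousLinearMap.id ℝ (Euc m)).prod (fderiv ℝ (jetPoly w) v.1)) v.1 :=
      (hasFDerivAt_id v.1).prodMk (hpoly w)
    have e2 : HasFDerivAt (fun y => c.fibTrans c₂ (y, jetPoly w y))
        ((fderiv ℝ (c.fibTrans c₂) (jetValue v)).comp
          ((ContinuousLinearMap.id ℝ (Euc m)).prod (fderiv ℝ (jetPoly w) v.1))) v.1 := by
      refine HasFDerivAt.comp v.1 (g := c.fibTrans c₂) (f := fun y => (y, jetPoly w y)) ?_ e1
      have : (v.1, jetPoly w v.1) = jetValue v := Prod.ext rfl (hself w hw)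
      simp only [this]
      exact hdf
    rw [← hbb] at e2
    have e3 := e2.comp (c.baseTrans c₂ v.1) hdb
    rw [hbb] at e3
    exact e3
  refine Prod.ext ?_ ?_
  · rw [Prod.fst_add, Prod.smul_fst]
    have e1 : (c.jetTrans c₂ 1 u).1 = c.baseTrans c₂ u.1 := g1
    have e2 : (c.jetTrans c₂ 1 v).1 = c.baseTrans c₂ v.1 := h1
    rw [e1, e2, hu1]
    simp [topVec]
  · funext i
    refine SymMul.ext' fun w => ?_
    have e1 : ((c.jetTrans c₂ 1 u).2 i).toMap = _ := g2 i
    have e2 : ((c.jetTrans c₂ 1 v).2 i).toMap = _ := h2 i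
    rw [e1, Prod.snd_add, Pi.add_apply, map_add, add_apply, e2, hu1]
    rcases Fin.eq_zero_or_eq_succ i with rfl | ⟨i, rfl⟩
    · simp only [Fin.val_zero, Prod.smul_snd, Pi.smul_apply, map_smul]
      simp only [topVec]
      have h0 : ∀ (F : Euc m → Euc n) y (w : Fin 0 → Euc m), iteratedFDeriv ℝ 0 F y w = F y := by
        intro F y w; simp
      refine (h0 _ _ w).trans (Eq.trans ?_ (congrArg₂ (· + ·) (h0 _ _ w).symm rfl))
      rw [hbb, hself u hval, hself v rfl]
      simp
    · obtain rfl : i = 0 := Subsingleton.elim _ _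
      have h0 : ∀ (F : Euc m → Euc n) y (w : Fin 1 → Euc m),
          iteratedFDeriv ℝ 1 F y w = fderiv ℝ F y (w 0) := by
        intro F y w; rw [iteratedFDeriv_one_apply]
      refine (h0 _ _ w).trans (Eq.trans ?_ (congrArg₂ (· + ·) (h0 _ _ w).symm rfl))
      rw [(hder u hval).fderiv, (hder v rfl).fderiv]
      have hP : ∀ x, fderiv ℝ (jetPoly u) v.1 x = fderiv ℝ (jetPoly v) v.1 x + t • z x := by
        intro x
        have := hpoly' u x
        rw [hu1] at this
        rw [this, hpoly' v x, hutop]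
      have hT : ∀ (y : Euc m →L[ℝ] Euc n) (w : Fin 1 → Euc m),
          ((t • topVec m n y).2 1).toMap w = t • y (w 0) := by
        intro y w
        have : (t • topVec m n y).2 1 = t • SymMul.ofLin y := by simp [topVec]
        have h2 : ((t • topVec m n y).2 1).toMap = t • (SymMul.ofLin y).toMap := by
          rw [this, map_smul]
        rw [h2, smul_apply, SymMul.ofLin_toMap]
      refine Eq.trans ?_ (congrArg₂ (· + ·) rfl (hT _ w).symm)
      simp only [ContinuousLinearMap.comp_apply, ContinuousLinearMap.prod_apply, hP,
        ContinuousLinearMap.id_apply, ContinuousLinearMap.inr_apply]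
      set D := fderiv ℝ (c.fibTrans c₂) (jetValue v)
      rw [← D.map_smul, ← D.map_add]
      congr 1
      simp
end AdaptedChart
end JetCalculus

section JetForms
variable {m n : ℕ} {M E : Type*}
  [TopologicalSpace M] [ChartedSpace (Euc m) M]
  [TopologicalSpace E] [ChartedSpace (Euc (m + n)) E] {π : E → M}
  [IsManifold 𝓘(ℝ, Euc m) ∞ M] [IsManifold 𝓘(ℝ, Euc (m + n)) ∞ E] [IsFiberedManifold m n π]

/-- The tangent space of `J¹π` at a jet. -/
abbrev JetTangent (j : Jet m n π 1) := TangentSpace 𝓘(ℝ, JetModel m n 1) j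

/-- Tangent vectors of `J¹π` that are vertical for the projection `J¹π → M`. -/
def IsVertical {j : Jet m n π 1} (v : JetTangent j) : Prop :=
  mfderiv 𝓘(ℝ, JetModel m n 1) 𝓘(ℝ, Euc m) (Jet.source : Jet m n π 1 → M) j v = 0

namespace AdaptedChart
variable (c c₂ : AdaptedChart m n π)

theorem jetCoord_target {k : ℕ} {j : Jet m n π k} (h : j.target ∈ c.total.source) :
    jetValue (c.jetCoord k j) ∈ c.total.target := (c.jetChart k).map_source h

theorem jetChart_left_inv {k : ℕ} {j : Jet m n π k} (h : j.target ∈ c.total.source) :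
    (c.jetChart k).symm (c.jetCoord k j) = j := (c.jetChart k).left_inv h

theorem jetCoord_overlap {k : ℕ} {j : Jet m n π k} (h : j.target ∈ c.total.source)
    (h' : j.target ∈ c₂.total.source) : jetValue (c.jetCoord k j) ∈ c.overlap c₂ := by
  have : c.jetCoord k j ∈ ((c.jetChart k).symm.trans (c₂.jetChart k)).source := by
    refine ⟨c.jetCoord_target h, ?_⟩
    change ((c.jetChart k).symm (c.jetCoord k j)).target ∈ c₂.total.source
    rwa [c.jetChart_left_inv h]
  rwa [jet_trans_source] at this

theorem jetTrans_coord {k : ℕ} {j : Jet m n π k} (h : j.target ∈ c.total.source) :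
    c.jetTrans c₂ k (c.jetCoord k j) = c₂.jetCoord k j := by
  change c₂.jetCoord k ((c.jetChart k).symm (c.jetCoord k j)) = _
  rw [c.jetChart_left_inv h]

theorem hasFDerivAt_jetTrans {k : ℕ} {v : JetModel m n k} (hv : jetValue v ∈ c.overlap c₂) :
    HasFDerivAt (c.jetTrans c₂ k) (fderiv ℝ (c.jetTrans c₂ k) v) v := by
  have h := c.jet_trans_contDiffOn k c₂
  have hv' : v ∈ ((c.jetChart k).symm.trans (c₂.jetChart k)).source := by
    rw [jet_trans_source]; exact hv
  exact ((h.contDiffAt ((c.isOpen_jet_trans_source k c₂).mem_nhds hv')).differentiableAt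
    (by simp)).hasFDerivAt

theorem fderiv_jetTrans_topVec {v : JetModel m n 1} (hv : jetValue v ∈ c.overlap c₂)
    (z : Euc m →L[ℝ] Euc n) :
    fderiv ℝ (c.jetTrans c₂ 1) v (topVec m n z) = topVec m n
      (((fderiv ℝ (c.fibTrans c₂) (jetValue v)).comp (ContinuousLinearMap.inr ℝ (Euc m) (Euc n))).comp
        (z.comp (fderiv ℝ (c₂.baseTrans c) (c.baseTrans c₂ v.1)))) := by
  have h1 : HasDerivAt (fun t : ℝ => v + t • topVec m n z) (topVec m n z) 0 := by
    simpa using ((hasDerivAt_id (0 : ℝ)).smul_const (topVec m n z)).const_add v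
  have h2 := (c.hasFDerivAt_jetTrans c₂ hv)
  have h2' : HasFDerivAt (c.jetTrans c₂ 1) (fderiv ℝ (c.jetTrans c₂ 1) v)
      (v + (0 : ℝ) • topVec m n z) := by simpa using h2
  have h3 := h2'.comp_hasDerivAt (0 : ℝ) h1
  set y := topVec m n
      (((fderiv ℝ (c.fibTrans c₂) (jetValue v)).comp (ContinuousLinearMap.inr ℝ (Euc m) (Euc n))).comp
        (z.comp (fderiv ℝ (c₂.baseTrans c) (c.baseTrans c₂ v.1)))) with hy
  have h4 : HasDerivAt (fun t : ℝ => c.jetTrans c₂ 1 v + t • y) y 0 := by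
    simpa using ((hasDerivAt_id (0 : ℝ)).smul_const y).const_add (c.jetTrans c₂ 1 v)
  refine h3.unique (h4.congr_of_eventuallyEq (Filter.Eventually.of_forall fun t => ?_))
  exact c.jetTrans_add_topVec c₂ hv z t

theorem hasFDerivAt_baseTrans {z : Euc m} (hz : z ∈ c.baseOverlap c₂) :
    HasFDerivAt (c.baseTrans c₂) (fderiv ℝ (c.baseTrans c₂) z) z :=
  (((c.contDiffOn_baseTrans c₂).contDiffAt ((c.isOpen_baseOverlap c₂).mem_nhds hz)).differentiableAt
    (by simp)).hasFDerivAt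

theorem fderiv_jetTrans_fst {v : JetModel m n 1} (hv : jetValue v ∈ c.overlap c₂)
    (w : JetModel m n 1) :
    (fderiv ℝ (c.jetTrans c₂ 1) v w).1 = fderiv ℝ (c.baseTrans c₂) v.1 w.1 := by
  have h1 := (c.hasFDerivAt_jetTrans c₂ hv).fst
  have h2 : HasFDerivAt (fun v : JetModel m n 1 => c.baseTrans c₂ v.1)
      ((fderiv ℝ (c.baseTrans c₂) v.1).comp (ContinuousLinearMap.fst ℝ _ _)) v :=
    (c.hasFDerivAt_baseTrans c₂ (z := v.1) (overlap_fst (p := jetValue v) hv)).comp v hasFDerivAt_fst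
  have he : (fun v => (c.jetTrans c₂ 1 v).1) =ᶠ[𝓝 v] fun v => c.baseTrans c₂ v.1 := by
    have := (c.isOpen_jet_trans_source 1 c₂).mem_nhds (x := v) (by rw [jet_trans_source]; exact hv)
    filter_upwards [this] with u hu
    rw [jet_trans_source] at hu
    exact (jet_trans_apply 1 c c₂ hu).1
  exact congrArg (fun A => A w) (h1.unique (h2.congr_of_eventuallyEq he))

theorem baseTrans_baseTrans {z : Euc m} (hz : z ∈ c.baseOverlap c₂) :
    c.baseTrans c₂ z ∈ c₂.baseOverlap c ∧ c₂.baseTrans c (c.baseTrans c₂ z) = z := by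
  refine ⟨⟨c₂.base.map_source hz.2, ?_⟩, ?_⟩
  · change c₂.base.symm (c₂.base (c.base.symm z)) ∈ c.base.source
    rw [c₂.base.left_inv hz.2]; exact c.base.map_target hz.1
  · simp only [baseTrans]
    rw [c₂.base.left_inv hz.2, c.base.right_inv hz.1]

theorem fderiv_baseTrans_inv {z : Euc m} (hz : z ∈ c.baseOverlap c₂) (x : Euc m) :
    fderiv ℝ (c₂.baseTrans c) (c.baseTrans c₂ z) (fderiv ℝ (c.baseTrans c₂) z x) = x := by
  have h1 := (c₂.hasFDerivAt_baseTrans c (c.baseTrans_baseTrans c₂ hz).1).comp z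
    (c.hasFDerivAt_baseTrans c₂ hz)
  have he : c₂.baseTrans c ∘ c.baseTrans c₂ =ᶠ[𝓝 z] id := by
    filter_upwards [(c.isOpen_baseOverlap c₂).mem_nhds hz] with y hy
    exact (c.baseTrans_baseTrans c₂ hy).2
  have := h1.unique ((hasFDerivAt_id z).congr_of_eventuallyEq he)
  exact congrArg (fun A => A x) this

/-- The coordinate condition is preserved by changes of natural coordinates. -/
theorem dagModel_pullback {v : JetModel m n 1} (hv : jetValue v ∈ c.overlap c₂)
    {θ : JetModel m n 1 [⋀^Fin m]→L[ℝ] ℝ} (hθ : θ ∈ dagModel m n) :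
    θ.compContinuousLinearMap (fderiv ℝ (c.jetTrans c₂ 1) v) ∈ dagModel m n :=
  dagModel_comp hθ _ _ _ _ (c.fderiv_baseTrans_inv c₂ (z := v.1) (overlap_fst (p := jetValue v) hv))
    (c.fderiv_jetTrans_fst c₂ hv) (c.fderiv_jetTrans_topVec c₂ hv)

/-- The frame of natural coordinate vectors at a jet. -/
def frame (j : Jet m n π 1) : JetModel m n 1 →L[ℝ] JetTangent j :=
  mfderiv 𝓘(ℝ, JetModel m n 1) 𝓘(ℝ, JetModel m n 1) (c.jetHomeo 1).symm (c.jetCoord 1 j)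

/-- The coframe of natural coordinate differentials at a jet. -/
def coframe (j : Jet m n π 1) : JetTangent j →L[ℝ] JetModel m n 1 :=
  mfderiv 𝓘(ℝ, JetModel m n 1) 𝓘(ℝ, JetModel m n 1) (c.jetHomeo 1) j

variable {c c₂} {j : Jet m n π 1}

theorem coframe_frame (h : j.target ∈ c.total.source) (w : JetModel m n 1) :
    c.coframe j (c.frame j w) = w := by
  have := (c.jetHomeo_mdiff 1).comp_symm_deriv (x := c.jetCoord 1 j) (c.jetCoord_target h)
  have e : (c.jetHomeo 1).symm (c.jetCoord 1 j) = j := c.jetChart_left_inv h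
  rw [e] at this
  exact congrArg (fun A => A w) this

theorem frame_coframe (h : j.target ∈ c.total.source) (w : JetTangent j) :
    c.frame j (c.coframe j w) = w := by
  have := (c.jetHomeo_mdiff 1).symm_comp_deriv (x := j) h
  exact congrArg (fun A => A w) this

theorem frame_eq (h : j.target ∈ c.total.source) (h' : j.target ∈ c₂.total.source)
    (w : JetModel m n 1) :
    c.frame j w = c₂.frame j (fderiv ℝ (c.jetTrans c₂ 1) (c.jetCoord 1 j) w) := by
  have e : c.jetTrans c₂ 1 (c.jetCoord 1 j) = c₂.jetCoord 1 j := c.jetTrans_coord c₂ h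
  have h1 : HasMFDerivAt 𝓘(ℝ, JetModel m n 1) 𝓘(ℝ, JetModel m n 1) (c₂.jetHomeo 1).symm
      (c.jetTrans c₂ 1 (c.jetCoord 1 j)) (mfderiv 𝓘(ℝ, JetModel m n 1) 𝓘(ℝ, JetModel m n 1)
        (c₂.jetHomeo 1).symm (c.jetTrans c₂ 1 (c.jetCoord 1 j))) := by
    refine ((c₂.jetHomeo_mdiff 1).mdifferentiableAt_symm ?_).hasMFDerivAt
    rw [e]; exact c₂.jetCoord_target h'
  have h2 := (c.hasFDerivAt_jetTrans c₂ (c.jetCoord_overlap c₂ h h')).hasMFDerivAt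
  have h3 := HasMFDerivAt.comp _ h1 h2
  have he : (c.jetHomeo 1).symm =ᶠ[𝓝 (c.jetCoord 1 j)] (c₂.jetHomeo 1).symm ∘ c.jetTrans c₂ 1 := by
    have := (c.isOpen_jet_trans_source 1 c₂).mem_nhds (x := c.jetCoord 1 j)
      (by rw [jet_trans_source]; exact c.jetCoord_overlap c₂ h h')
    filter_upwards [this] with u hu
    exact ((c₂.jetChart 1).left_inv hu.2).symm
  have h4 := (h3.congr_of_eventuallyEq he).mfderiv
  have h5 := congrArg (fun A => A w) h4
  have h6 : ∀ p q : JetModel m n 1, p = q → ∀ x : JetModel m n 1,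
      (mfderiv 𝓘(ℝ, JetModel m n 1) 𝓘(ℝ, JetModel m n 1) (c₂.jetHomeo 1).symm p :
        JetModel m n 1 →L[ℝ] JetModel m n 1) x
      = (mfderiv 𝓘(ℝ, JetModel m n 1) 𝓘(ℝ, JetModel m n 1) (c₂.jetHomeo 1).symm q :
        JetModel m n 1 →L[ℝ] JetModel m n 1) x := by
    rintro _ _ rfl _; rfl
  exact h5.trans (h6 _ _ e _)

theorem mfderiv_source_frame (h : j.target ∈ c.total.source) (w : JetModel m n 1) :
    IsVertical (c.frame j w) ↔ w.1 = 0 := by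
  set v := c.jetCoord 1 j with hv
  have hvt : jetValue v ∈ c.total.target := c.jetCoord_target h
  have hv1 : v.1 ∈ c.base.target := (c.fst_mem_target hvt).1
  have hbs : MDifferentiableAt 𝓘(ℝ, Euc m) 𝓘(ℝ, Euc m) c.base.symm v.1 :=
    ((c.contMDiffOn_base_symm).contMDiffAt (c.base.open_target.mem_nhds hv1)).mdifferentiableAt
      (by simp)
  have hfst : HasMFDerivAt 𝓘(ℝ, JetModel m n 1) 𝓘(ℝ, Euc m) (fun u : JetModel m n 1 => u.1) v
      (ContinuousLinearMap.fst ℝ (Euc m) ((i : Fin 2) → SymMul m n i)) :=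
    (hasFDerivAt_fst (𝕜 := ℝ) (p := v)).hasMFDerivAt
  have hfj : HasMFDerivAt 𝓘(ℝ, JetModel m n 1) 𝓘(ℝ, JetModel m n 1) (c.jetHomeo 1) j (c.coframe j) :=
    ((c.jetHomeo_mdiff 1).mdifferentiableAt h).hasMFDerivAt
  have h1 := HasMFDerivAt.comp j (HasMFDerivAt.comp (c.jetHomeo 1 j) hbs.hasMFDerivAt hfst) hfj
  have hsrc : (Jet.target ⁻¹' c.total.source : Set (Jet m n π 1)) ∈ 𝓝 j :=
    (c.jetHomeo 1).open_source.mem_nhds h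
  have hbase : ∀ i : Jet m n π 1, i.target ∈ c.total.source →
      i.source ∈ c.base.source ∧ c.base i.source = (c.jetCoord 1 i).1 := by
    intro i hi
    rw [← Jet.mk_out i] at hi ⊢
    rw [c.jetCoord_mk 1 hi]
    exact ⟨(c.exists_rep_contDiffOn i.out.isLocalSectionAt hi).1, rfl⟩
  have he : (Jet.source : Jet m n π 1 → M) =ᶠ[𝓝 j]
      (c.base.symm ∘ fun u : JetModel m n 1 => u.1) ∘ c.jetHomeo 1 := by
    filter_upwards [hsrc] with i hi
    obtain ⟨a, b⟩ := hbase i hi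
    change i.source = c.base.symm (c.jetCoord 1 i).1
    rw [← b, c.base.left_inv a]
  have h2 := h1.congr_of_eventuallyEq he
  have hb : MDifferentiableAt 𝓘(ℝ, Euc m) 𝓘(ℝ, Euc m) c.base j.source :=
    ((c.contMDiffOn_base).contMDiffAt
      (c.base.open_source.mem_nhds (hbase j h).1)).mdifferentiableAt (by simp)
  have h3 := HasMFDerivAt.comp j hb.hasMFDerivAt h2
  have h4 := HasMFDerivAt.comp j hfst hfj
  have he' : c.base ∘ (Jet.source : Jet m n π 1 → M) =ᶠ[𝓝 j]
      (fun u : JetModel m n 1 => u.1) ∘ c.jetHomeo 1 := by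
    filter_upwards [hsrc] with i hi
    exact (hbase i hi).2
  have h5 := hasMFDerivAt_unique h3 (h4.congr_of_eventuallyEq he')
  have hcf := coframe_frame h w
  unfold IsVertical
  rw [h2.mfderiv]
  constructor
  · intro h0
    have h6 := congrArg (fun A => A (c.frame j w)) h5
    have h7 : (mfderiv 𝓘(ℝ, Euc m) 𝓘(ℝ, Euc m) c.base j.source) 0 = (c.coframe j (c.frame j w)).1 :=
      (congrArg _ h0.symm).trans h6
    rw [hcf] at h7
    rw [← h7]
    exact map_zero (mfderiv 𝓘(ℝ, Euc m) 𝓘(ℝ, Euc m) c.base j.source)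
  · intro h0
    have h7 : (c.coframe j (c.frame j w)).1 = 0 := by rw [hcf, h0]
    change mfderiv 𝓘(ℝ, Euc m) 𝓘(ℝ, Euc m) c.base.symm v.1 ((c.coframe j (c.frame j w)).1) = 0
    rw [h7]
    exact map_zero (mfderiv 𝓘(ℝ, Euc m) 𝓘(ℝ, Euc m) c.base.symm v.1)

theorem isVertical_iff (h : j.target ∈ c.total.source) (w : JetTangent j) :
    IsVertical w ↔ (c.coframe j w).1 = 0 := by
  conv_lhs => rw [← frame_coframe h w]
  exact mfderiv_source_frame h _

end AdaptedChart
end JetForms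

section JetPullback
open AdaptedChart
variable {m n : ℕ} {M E : Type*}
  [TopologicalSpace M] [ChartedSpace (Euc m) M]
  [TopologicalSpace E] [ChartedSpace (Euc (m + n)) E] {π : E → M}

/-- The fibre product `J³π ×_{J¹π} V` for a family of fibres `V` over `J¹π`: pairs of a `3`-jet and
an element of the fibre over the underlying `1`-jet. -/
structure JetPullback (V : Jet m n π 1 → Type*) where
  jet : Jet m n π 3
  val : V (jet.proj 1 (by norm_num))

/-- The projection `J³π → J¹π` in natural coordinates. -/
def jetTrunc (v : JetModel m n 3) : JetModel m n 1 :=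
  (v.1, fun i => v.2 (Fin.castLE (by norm_num : 2 ≤ 4) i))

theorem contDiff_jetTrunc : ContDiff ℝ ∞ (jetTrunc : JetModel m n 3 → JetModel m n 1) := by
  refine contDiff_fst.prodMk (contDiff_pi.2 fun i => ?_)
  exact contDiff_pi.1 (contDiff_snd : ContDiff ℝ ∞ (Prod.snd : JetModel m n 3 → _))
    (Fin.castLE (by norm_num : 2 ≤ 4) i)

theorem AdaptedChart.jetCoord_proj (c : AdaptedChart m n π) {j : Jet m n π 3}
    (h : j.target ∈ c.total.source) :
    c.jetCoord 1 (j.proj 1 (by norm_num)) = jetTrunc (c.jetCoord 3 j) := by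
  rw [← Jet.mk_out j] at h ⊢
  rw [Jet.proj_mk, c.jetCoord_mk 1 h, c.jetCoord_mk 3 h]
  rfl

variable [IsManifold 𝓘(ℝ, Euc m) ∞ M] [IsManifold 𝓘(ℝ, Euc (m + n)) ∞ E] [IsFiberedManifold m n π]

/-- Fibre coordinates, over each adapted chart, for a family `V` of fibres over `J¹π`, with smooth
changes of coordinates. -/
structure FibreCoord (V : Jet m n π 1 → Type*) (F : Type*) [NormedAddCommGroup F]
    [NormedSpace ℝ F] where
  coord : ∀ (c : AdaptedChart m n π) (j : Jet m n π 1), j.target ∈ c.total.source → V j ≃ F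
  trans : AdaptedChart m n π → AdaptedChart m n π → JetModel m n 1 → F → F
  coord_eq : ∀ (c c₂ : AdaptedChart m n π) (j : Jet m n π 1) (h : j.target ∈ c.total.source)
    (h' : j.target ∈ c₂.total.source) (x : V j),
    coord c₂ j h' x = trans c c₂ (c.jetCoord 1 j) (coord c j h x)
  contDiffOn : ∀ c c₂ : AdaptedChart m n π,
    ContDiffOn ℝ ∞ (fun p : JetModel m n 1 × F => trans c c₂ p.1 p.2)
      ((fun p : JetModel m n 1 × F => jetValue p.1) ⁻¹' c.overlap c₂)

namespace FibreCoord
variable {V : Jet m n π 1 → Type*} {F : Type*} [NormedAddCommGroup F] [NormedSpace ℝ F]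
  (f : FibreCoord V F) (c c₂ : AdaptedChart m n π)

open Classical in
/-- The fibre coordinates of a point of the fibre product. -/
def toFibre (w : JetPullback V) : F :=
  if h : w.jet.target ∈ c.total.source then
    f.coord c (w.jet.proj 1 (by norm_num)) (by rwa [Jet.proj_target]) w.val
  else 0

theorem toFibre_of_mem {w : JetPullback V} (h : w.jet.target ∈ c.total.source) :
    f.toFibre c w
      = f.coord c (w.jet.proj 1 (by norm_num)) (by rwa [Jet.proj_target]) w.val := dif_pos h

theorem ext_fibre {w w' : JetPullback V} (hj : w.jet = w'.jet) (h : w.jet.target ∈ c.total.source)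
    (he : f.toFibre c w = f.toFibre c w') : w = w' := by
  obtain ⟨j, x⟩ := w
  obtain ⟨j', x'⟩ := w'
  obtain rfl : j = j' := hj
  rw [f.toFibre_of_mem c (w := ⟨j, x⟩) h, f.toFibre_of_mem c (w := ⟨j, x'⟩) h] at he
  have hx : x = x' := (f.coord c _ _).injective he
  rw [hx]

/-- The point with given coordinates. -/
def ofCoord (v : JetModel m n 3 × F) (h : jetValue v.1 ∈ c.total.target) : JetPullback V :=
  ⟨(c.jetChart 3).symm v.1, (f.coord c _ (by
    rw [Jet.proj_target]; exact (c.jetChart 3).map_target h)).symm v.2⟩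

theorem toFibre_ofCoord (v : JetModel m n 3 × F) (h : jetValue v.1 ∈ c.total.target) :
    f.toFibre c (f.ofCoord c v h) = v.2 := by
  rw [f.toFibre_of_mem c (w := f.ofCoord c v h) ((c.jetChart 3).map_target h)]
  exact Equiv.apply_symm_apply _ _

theorem nonempty (f : FibreCoord V F) (c : AdaptedChart m n π) : Nonempty (JetPullback V) := by
  let e : E := c.total.symm 0
  obtain ⟨c₂, hc'⟩ := exists_adaptedChart (m := m) (n := n) π e
  obtain ⟨s, hs⟩ := nonempty_localSection_at (m := m) (n := n) (π := π) e
  have h : s.toFun s.pt ∈ c₂.total.source := by rw [hs]; exact hc'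
  exact ⟨⟨Jet.mk 3 s, (f.coord c₂ (Jet.mk 1 s) h).symm 0⟩⟩

open Classical in
/-- The natural chart of the fibre product. -/
def chart : PartialEquiv (JetPullback V) (JetModel m n 3 × F) where
  toFun w := (c.jetCoord 3 w.jet, f.toFibre c w)
  invFun v := if h : jetValue v.1 ∈ c.total.target then f.ofCoord c v h
    else Classical.choice (f.nonempty c)
  source := (fun w => w.jet.target) ⁻¹' c.total.source
  target := (fun v => jetValue v.1) ⁻¹' c.total.target
  map_source' w hw := c.jetCoord_target hw
  map_target' v hv := by
    have hv' : jetValue v.1 ∈ c.total.target := hv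
    rw [dif_pos hv']
    exact (c.jetChart 3).map_target hv'
  left_inv' w hw := by
    have hv' : jetValue (c.jetCoord 3 w.jet) ∈ c.total.target := c.jetCoord_target hw
    rw [dif_pos hv']
    refine f.ext_fibre c (c.jetChart_left_inv hw) ((c.jetChart 3).map_target hv') ?_
    rw [toFibre_ofCoord]
  right_inv' v hv := by
    have hv' : jetValue v.1 ∈ c.total.target := hv
    rw [dif_pos hv', toFibre_ofCoord]
    exact Prod.ext ((c.jetChart 3).right_inv hv') rfl

theorem chart_symm_apply {v : JetModel m n 3 × F} (h : jetValue v.1 ∈ c.total.target) :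
    (f.chart c).symm v = f.ofCoord c v h := dif_pos h

theorem chart_trans_source : ((f.chart c).symm.trans (f.chart c₂)).source
    = (fun v : JetModel m n 3 × F => jetValue v.1) ⁻¹' c.overlap c₂ := by
  ext v
  have key : ∀ h : jetValue v.1 ∈ c.total.target,
      (((f.chart c).symm v).jet.target ∈ c₂.total.source ↔ jetValue v.1 ∈ c.overlap c₂) := by
    intro h
    rw [f.chart_symm_apply c h]
    have := Set.ext_iff.1 (jet_trans_source 3 c c₂) v.1
    constructor
    · intro h2; exact this.1 ⟨h, h2⟩
    · intro h2; exact (this.2 h2).2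
  constructor
  · rintro ⟨h1, h2⟩; exact (key h1).1 h2
  · intro h; exact ⟨h.1, (key h.1).2 h⟩

theorem contDiff_jetValue_fst :
    ContDiff ℝ ∞ (fun v : JetModel m n 3 × F => (jetValue v.1 : Euc m × Euc n)) :=
  contDiff_jetValue.comp contDiff_fst

theorem chart_trans_apply {v : JetModel m n 3 × F} (hv : jetValue v.1 ∈ c.overlap c₂) :
    (f.chart c).symm.trans (f.chart c₂) v
      = (c.jetTrans c₂ 3 v.1, f.trans c c₂ (jetTrunc v.1) v.2) := by
  rw [PartialEquiv.trans_apply, f.chart_symm_apply c hv.1]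
  set w := f.ofCoord c v hv.1 with hw
  have hs : w.jet.target ∈ c.total.source := (c.jetChart 3).map_target hv.1
  have hs' : w.jet.target ∈ c₂.total.source := by
    have := (Set.ext_iff.1 (jet_trans_source 3 c c₂) v.1).2 hv
    exact this.2
  refine Prod.ext rfl ?_
  change f.toFibre c₂ w = f.trans c c₂ (jetTrunc v.1) v.2
  rw [f.toFibre_of_mem c₂ hs',
    f.coord_eq c c₂ _ (by rwa [Jet.proj_target]) (by rwa [Jet.proj_target]),
    ← f.toFibre_of_mem c hs, hw, f.toFibre_ofCoord, c.jetCoord_proj hs]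
  have : c.jetCoord 3 w.jet = v.1 := (c.jetChart 3).right_inv hv.1
  rw [this]

theorem chart_trans_contDiffOn : ContDiffOn ℝ ∞ ((f.chart c).symm.trans (f.chart c₂))
    ((f.chart c).symm.trans (f.chart c₂)).source := by
  rw [chart_trans_source]
  have h1 : ContDiffOn ℝ ∞ (fun v : JetModel m n 3 × F => c.jetTrans c₂ 3 v.1)
      ((fun v : JetModel m n 3 × F => jetValue v.1) ⁻¹' c.overlap c₂) := by
    have := c.jet_trans_contDiffOn 3 c₂
    rw [jet_trans_source] at this
    exact this.comp contDiffOn_fst fun v hv => hv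
  have h2 : ContDiffOn ℝ ∞ (fun v : JetModel m n 3 × F => f.trans c c₂ (jetTrunc v.1) v.2)
      ((fun v : JetModel m n 3 × F => jetValue v.1) ⁻¹' c.overlap c₂) :=
    (f.contDiffOn c c₂).comp
      ((contDiff_jetTrunc.comp contDiff_fst).prodMk contDiff_snd).contDiffOn fun v hv => hv
  exact (h1.prodMk h2).congr fun v hv => f.chart_trans_apply c c₂ hv

/-- The atlas of natural charts of the fibre product. -/
def toAtlas : SmoothAtlas (JetModel m n 3 × F) (JetPullback V) where
  charts := Set.range f.chart
  cover w := by
    obtain ⟨c, hc⟩ := exists_adaptedChart (m := m) (n := n) π w.jet.target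
    exact ⟨_, ⟨c, rfl⟩, hc⟩
  open_source := by
    rintro _ ⟨c, rfl⟩ _ ⟨c₂, rfl⟩
    rw [chart_trans_source]
    exact (c.isOpen_overlap c₂).preimage contDiff_jetValue_fst.continuous
  contDiffOn := by
    rintro _ ⟨c, rfl⟩ _ ⟨c₂, rfl⟩
    exact f.chart_trans_contDiffOn c c₂

end FibreCoord
end JetPullback

section Forms
open AdaptedChart
variable {m n : ℕ} {M E : Type*}
  [TopologicalSpace M] [ChartedSpace (Euc m) M]
  [TopologicalSpace E] [ChartedSpace (Euc (m + n)) E] {π : E → M}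
  [IsManifold 𝓘(ℝ, Euc m) ∞ M] [IsManifold 𝓘(ℝ, Euc (m + n)) ∞ E] [IsFiberedManifold m n π]

/-- The expression of an `m`-form at a jet in natural coordinates. -/
def AdaptedChart.coordForm (c : AdaptedChart m n π) {j : Jet m n π 1}
    (θ : JetTangent j [⋀^Fin m]→L[ℝ] ℝ) : JetModel m n 1 [⋀^Fin m]→L[ℝ] ℝ :=
  θ.compContinuousLinearMap (c.frame j)

/-- The fibre of `J²π^†` over `j ∈ J¹π`: the `m`-forms at `j` that vanish when two arguments are
vertical over `M` and whose coefficients satisfy `p_α^{ij} = p_α^{ji}` in natural coordinates. -/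
def symForms (j : Jet m n π 1) : Submodule ℝ (JetTangent j [⋀^Fin m]→L[ℝ] ℝ) where
  carrier := {θ | (∀ (X : Fin m → JetTangent j) (k l : Fin m), k ≠ l →
      IsVertical (X k) → IsVertical (X l) → θ X = 0) ∧
    ∀ c : AdaptedChart m n π, j.target ∈ c.total.source → ∀ i k α,
      topMomentum (c.coordForm θ) i k α = topMomentum (c.coordForm θ) k i α}
  add_mem' := fun {θ θ'} h h' => ⟨fun X k l hkl hk hl => by
      rw [ContinuousAlternatingMap.add_apply, h.1 X k l hkl hk hl, h'.1 X k l hkl hk hl, add_zero],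
    fun c hc i k α => congrArg₂ (· + ·) (h.2 c hc i k α) (h'.2 c hc i k α)⟩
  zero_mem' := ⟨fun _ _ _ _ _ _ => rfl, fun _ _ _ _ _ => rfl⟩
  smul_mem' := fun a θ h => ⟨fun X k l hkl hk hl => by
      rw [ContinuousAlternatingMap.smul_apply, h.1 X k l hkl hk hl, smul_zero],
    fun c hc i k α => congrArg (a • ·) (h.2 c hc i k α)⟩

/-- The fibre of the extended symmetric multimomentum bundle `J²π^†` over `j ∈ J¹π`. -/
def SymForm (j : Jet m n π 1) : Type := symForms j

namespace SymForm
variable {j : Jet m n π 1}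
instance : AddCommGroup (SymForm j) := inferInstanceAs (AddCommGroup (symForms j))
instance : Module ℝ (SymForm j) := inferInstanceAs (Module ℝ (symForms j))
/-- The underlying form. -/
def toForm : SymForm j →ₗ[ℝ] (JetTangent j [⋀^Fin m]→L[ℝ] ℝ) := (symForms j).subtype
end SymForm

/-- The semibasic forms: those that vanish when one argument is vertical over `M`. -/
def semibasicForms (j : Jet m n π 1) : Submodule ℝ (SymForm j) where
  carrier := {θ | ∀ (X : Fin m → JetTangent j) (k : Fin m), IsVertical (X k) → θ.toForm X = 0}
  add_mem' := fun {θ θ'} h h' X k hk => by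
    rw [map_add, ContinuousAlternatingMap.add_apply, h X k hk, h' X k hk, add_zero]
  zero_mem' := fun _ _ _ => rfl
  smul_mem' := fun a θ h X k hk => by
    rw [map_smul, ContinuousAlternatingMap.smul_apply, h X k hk, smul_zero]

namespace AdaptedChart
variable (c c₂ : AdaptedChart m n π) {j : Jet m n π 1}

theorem coordForm_mem (h : j.target ∈ c.total.source) (θ : SymForm j) :
    c.coordForm θ.toForm ∈ dagModel m n :=
  ⟨fun _ k l hkl hk hl => θ.2.1 _ k l hkl ((mfderiv_source_frame h _).2 hk)
    ((mfderiv_source_frame h _).2 hl), θ.2.2 c h⟩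

theorem coordForm_trans (h : j.target ∈ c.total.source) (h' : j.target ∈ c₂.total.source)
    (θ : JetTangent j [⋀^Fin m]→L[ℝ] ℝ) :
    c₂.coordForm θ = (c.coordForm θ).compContinuousLinearMap
      (fderiv ℝ (c₂.jetTrans c 1) (c₂.jetCoord 1 j)) := by
  ext X
  change θ (c₂.frame j ∘ X) = θ (c.frame j ∘ _)
  congr 1
  funext k
  exact frame_eq h' h (X k)

/-- The natural fibre coordinates of `J²π^†`. -/
def symCoord (j : Jet m n π 1) (h : j.target ∈ c.total.source) : SymForm j ≃ₗ[ℝ] DagModel m n where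
  toFun θ := DagModel.ofForm (c.coordForm θ.toForm) (c.coordForm_mem h θ)
  map_add' _ _ := rfl
  map_smul' _ _ := rfl
  invFun u := (⟨u.toForm.compContinuousLinearMap (c.coframe j), by
    refine ⟨fun X k l hkl hk hl => u.toForm_mem.1 _ k l hkl ((isVertical_iff h _).1 hk)
      ((isVertical_iff h _).1 hl), fun c₂ hc' => ?_⟩
    have e : c₂.coordForm (u.toForm.compContinuousLinearMap (c.coframe j))
        = u.toForm.compContinuousLinearMap (fderiv ℝ (c₂.jetTrans c 1) (c₂.jetCoord 1 j)) := by
      ext X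
      change u.toForm (c.coframe j ∘ c₂.frame j ∘ X) = u.toForm (_ ∘ X)
      congr 1
      funext k
      change c.coframe j (c₂.frame j (X k)) = _
      rw [frame_eq hc' h, coframe_frame h]
      rfl
    rw [e]
    exact (c₂.dagModel_pullback c (c₂.jetCoord_overlap c hc' h) u.toForm_mem).2⟩ : symForms j)
  left_inv θ := by
    refine Subtype.ext (ContinuousAlternatingMap.ext fun X => ?_)
    change θ.toForm (c.frame j ∘ c.coframe j ∘ X) = θ.toForm X
    congr 1
    funext k
    exact frame_coframe h (X k)
  right_inv u := by
    refine DagModel.toForm_injective (ContinuousAlternatingMap.ext fun X => ?_)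
    change u.toForm (c.coframe j ∘ c.frame j ∘ X) = u.toForm X
    congr 1
    funext k
    exact coframe_frame h (X k)

theorem symCoord_toForm (h : j.target ∈ c.total.source) (θ : SymForm j) :
    (c.symCoord j h θ).toForm = c.coordForm θ.toForm := rfl

theorem symCoord_semibasic (h : j.target ∈ c.total.source) :
    (semibasicForms j).map (c.symCoord j h : SymForm j →ₗ[ℝ] DagModel m n)
      = DagModel.semibasic m n := by
  ext u
  constructor
  · rintro ⟨θ, hθ, rfl⟩ X k hk
    exact hθ _ k ((mfderiv_source_frame h _).2 hk)
  · intro hu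
    refine ⟨(c.symCoord j h).symm u, fun X k hk => ?_, (c.symCoord j h).apply_symm_apply u⟩
    exact hu _ k ((isVertical_iff h _).1 hk)

/-- The natural fibre coordinates of `J²π^‡`. -/
def redCoord (j : Jet m n π 1) (h : j.target ∈ c.total.source) :
    (SymForm j ⧸ semibasicForms j) ≃ₗ[ℝ] DdagModel m n :=
  Submodule.Quotient.equiv (semibasicForms j) (DagModel.semibasic m n) (c.symCoord j h)
    (c.symCoord_semibasic h)

theorem redCoord_mk (h : j.target ∈ c.total.source) (θ : SymForm j) :
    c.redCoord j h (Submodule.Quotient.mk θ) = DagModel.toDdag m n (c.symCoord j h θ) := rfl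

open Classical in
/-- The change of natural fibre coordinates of `J²π^†`. -/
def symTrans (v : JetModel m n 1) (u : DagModel m n) : DagModel m n :=
  if h : jetValue (c.jetTrans c₂ 1 v) ∈ c₂.overlap c then
    DagModel.ofForm _ (c₂.dagModel_pullback c h u.toForm_mem) else 0

theorem symTrans_toForm {v : JetModel m n 1} (h : jetValue (c.jetTrans c₂ 1 v) ∈ c₂.overlap c)
    (u : DagModel m n) : (c.symTrans c₂ v u).toForm = u.toForm.compContinuousLinearMap
      (fderiv ℝ (c₂.jetTrans c 1) (c.jetTrans c₂ 1 v)) := by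
  rw [symTrans, dif_pos h]; rfl

theorem jetTrans_mem {v : JetModel m n 1} (hv : jetValue v ∈ c.overlap c₂) :
    jetValue (c.jetTrans c₂ 1 v) ∈ c₂.overlap c := by
  set j := (c.jetChart 1).symm v with hj
  have h1 : j.target ∈ c.total.source := (c.jetChart 1).map_target hv.1
  have h2 : j.target ∈ c₂.total.source := by
    have := (Set.ext_iff.1 (jet_trans_source 1 c c₂) v).2 hv
    exact this.2
  exact c₂.jetCoord_overlap c h2 h1

theorem contDiffOn_symTrans :
    ContDiffOn ℝ ∞ (fun p : JetModel m n 1 × DagModel m n => c.symTrans c₂ p.1 p.2)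
      ((fun p : JetModel m n 1 × DagModel m n => jetValue p.1) ⁻¹' c.overlap c₂) := by
  have h1 : ContDiffOn ℝ ∞ (fun p : JetModel m n 1 × DagModel m n => c.jetTrans c₂ 1 p.1)
      ((fun p : JetModel m n 1 × DagModel m n => jetValue p.1) ⁻¹' c.overlap c₂) := by
    have := c.jet_trans_contDiffOn 1 c₂
    rw [jet_trans_source] at this
    exact this.comp contDiffOn_fst fun v hv => hv
  have h2 : ContDiffOn ℝ ∞ (fderiv ℝ (c₂.jetTrans c 1)) (jetValue ⁻¹' c₂.overlap c) := by
    have h3 := c₂.jet_trans_contDiffOn 1 c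
    have h4 := c₂.isOpen_jet_trans_source 1 c
    rw [jet_trans_source] at h3 h4
    exact h3.fderiv_of_isOpen h4 le_rfl
  refine contDiffOn_pullback contDiffOn_snd (h2.comp h1 fun p hp => c.jetTrans_mem c₂ hp)
    fun p hp => ?_
  rw [c.symTrans_toForm c₂ (c.jetTrans_mem c₂ hp)]
  rfl

theorem symCoord_trans (h : j.target ∈ c.total.source) (h' : j.target ∈ c₂.total.source)
    (θ : SymForm j) :
    c₂.symCoord j h' θ = c.symTrans c₂ (c.jetCoord 1 j) (c.symCoord j h θ) := by
  refine DagModel.toForm_injective ?_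
  have e : c.jetTrans c₂ 1 (c.jetCoord 1 j) = c₂.jetCoord 1 j := c.jetTrans_coord c₂ h
  rw [c.symTrans_toForm c₂ (c.jetTrans_mem c₂ (c.jetCoord_overlap c₂ h h')), symCoord_toForm,
    symCoord_toForm, e]
  exact c.coordForm_trans c₂ h h' θ.toForm

end AdaptedChart

/-- The natural fibre coordinates of `J²π^†` with their changes. -/
def symFibreCoord : FibreCoord (fun j : Jet m n π 1 => SymForm j) (DagModel m n) where
  coord c j h := (c.symCoord j h).toEquiv
  trans c c₂ := c.symTrans c₂
  coord_eq c c₂ _ h h' θ := c.symCoord_trans c₂ h h' θ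
  contDiffOn c c₂ := c.contDiffOn_symTrans c₂

theorem exists_section_toDdag (m n : ℕ) :
    ∃ s : DdagModel m n →L[ℝ] DagModel m n, ∀ u, DagModel.toDdag m n (s u) = u := by
  obtain ⟨s, hs⟩ := (DagModel.toDdagₗ m n).exists_rightInverse_of_surjective
    (LinearMap.range_eq_top.2 (Submodule.mkQ_surjective _))
  exact ⟨s.toContinuousLinearMap, fun u => LinearMap.congr_fun hs u⟩

/-- A linear choice of representatives for the quotient of the model fibres. -/
def ddagSection (m n : ℕ) : DdagModel m n →L[ℝ] DagModel m n :=
  Classical.choose (exists_section_toDdag m n)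

theorem toDdag_ddagSection (u : DdagModel m n) : DagModel.toDdag m n (ddagSection m n u) = u :=
  Classical.choose_spec (exists_section_toDdag m n) u

theorem AdaptedChart.contDiffOn_redTrans (c c₂ : AdaptedChart m n π) :
    ContDiffOn ℝ ∞ (fun p : JetModel m n 1 × DdagModel m n =>
        DagModel.toDdag m n (c.symTrans c₂ p.1 (ddagSection m n p.2)))
      ((fun p : JetModel m n 1 × DdagModel m n => jetValue p.1) ⁻¹' c.overlap c₂) := by
  have h0 : ContDiff ℝ ∞ (fun p : JetModel m n 1 × DdagModel m n => (p.1, ddagSection m n p.2)) :=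
    contDiff_fst.prodMk ((ddagSection m n).contDiff.comp contDiff_snd)
  have h1 : ContDiffOn ℝ ∞ (fun p : JetModel m n 1 × DdagModel m n =>
      c.symTrans c₂ p.1 (ddagSection m n p.2))
      ((fun p : JetModel m n 1 × DdagModel m n => jetValue p.1) ⁻¹' c.overlap c₂) :=
    (c.contDiffOn_symTrans c₂).comp (f := fun p : JetModel m n 1 × DdagModel m n =>
      (p.1, ddagSection m n p.2)) h0.contDiffOn fun p hp => hp
  exact (DagModel.toDdag m n).contDiff.comp_contDiffOn h1

/-- The natural fibre coordinates of `J²π^‡` with their changes. -/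
def redFibreCoord :
    FibreCoord (fun j : Jet m n π 1 => SymForm j ⧸ semibasicForms j) (DdagModel m n) where
  coord c j h := (c.redCoord j h).toEquiv
  trans c c₂ v u := DagModel.toDdag m n (c.symTrans c₂ v (ddagSection m n u))
  coord_eq c c₂ j h h' x := by
    change c₂.redCoord j h' x = DagModel.toDdag m n (c.symTrans c₂ (c.jetCoord 1 j)
      (ddagSection m n (c.redCoord j h x)))
    set θ := (c.symCoord j h).symm (ddagSection m n (c.redCoord j h x)) with hθ
    have e1 : c.symCoord j h θ = ddagSection m n (c.redCoord j h x) := by simp [hθ]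
    have e2 : x = Submodule.Quotient.mk θ := by
      apply (c.redCoord j h).injective
      rw [c.redCoord_mk h, e1, toDdag_ddagSection]
    rw [← e1, ← c.symCoord_trans c₂ h h', ← c₂.redCoord_mk h', ← e2]
  contDiffOn c c₂ := c.contDiffOn_redTrans c₂

variable (m n π) in
/-- The unified jet-multimomentum bundle `W = J³π ×_{J¹π} J²π^†`. -/
def PhaseSpace : Type _ := JetPullback fun j : Jet m n π 1 => SymForm j
variable (m n π) in
/-- The restricted unified bundle `W_r = J³π ×_{J¹π} J²π^‡`, where `J²π^‡` is the quotient of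
`J²π^†` by the semibasic forms. -/
def ReducedPhaseSpace : Type _ := JetPullback fun j : Jet m n π 1 => SymForm j ⧸ semibasicForms j

/-- The model space of `W`. -/
abbrev PhaseModel (m n : ℕ) := JetModel m n 3 × DagModel m n
/-- The model space of `W_r`. -/
abbrev ReducedPhaseModel (m n : ℕ) := JetModel m n 3 × DdagModel m n

instance : TopologicalSpace (PhaseSpace m n π) :=
  (symFibreCoord (π := π)).toAtlas.toCore.toTopologicalSpace
instance : ChartedSpace (PhaseModel m n) (PhaseSpace m n π) :=
  (symFibreCoord (π := π)).toAtlas.toCore.toChartedSpace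
instance : IsManifold 𝓘(ℝ, PhaseModel m n) ∞ (PhaseSpace m n π) :=
  (symFibreCoord (π := π)).toAtlas.isManifold
instance : TopologicalSpace (ReducedPhaseSpace m n π) :=
  (redFibreCoord (π := π)).toAtlas.toCore.toTopologicalSpace
instance : ChartedSpace (ReducedPhaseModel m n) (ReducedPhaseSpace m n π) :=
  (redFibreCoord (π := π)).toAtlas.toCore.toChartedSpace
instance : IsManifold 𝓘(ℝ, ReducedPhaseModel m n) ∞ (ReducedPhaseSpace m n π) :=
  (redFibreCoord (π := π)).toAtlas.isManifold

namespace PhaseSpace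
/-- The `3`-jet component. -/
def jet (w : PhaseSpace m n π) : Jet m n π 3 := JetPullback.jet w
/-- The multimomentum form component, a form at the underlying `1`-jet. -/
def form (w : PhaseSpace m n π) : SymForm (w.jet.proj 1 (by norm_num)) := JetPullback.val w

/-- The quotient map `μ_W : W → W_r`. -/
def toReduced (w : PhaseSpace m n π) : ReducedPhaseSpace m n π :=
  ⟨w.jet, Submodule.Quotient.mk w.form⟩
end PhaseSpace

open Classical in
/-- The first prolongation `j¹φ : M → J¹π` of a local section `φ` (with a dummy value at points
near which `φ` is not a section). -/
def LocalSection.prolong (s : LocalSection m n π) (y : M) : Jet m n π 1 :=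
  if h : IsLocalSectionAt m n π s.toFun y then Jet.mk 1 ⟨y, s.toFun, h⟩ else Jet.mk 1 s

/-- The second-order coupling form at `w = (j³_xφ, ω) ∈ W`: the pull-back `(j¹φ)^*_x ω`, an `m`-form
on `T_xM` (a form on `W` that is semibasic over `M` is the same as such a family). -/
def PhaseSpace.coupling (w : PhaseSpace m n π) :
    TangentSpace 𝓘(ℝ, Euc m) w.jet.source [⋀^Fin m]→L[ℝ] ℝ :=
  ContinuousAlternatingMap.compContinuousLinearMap (w.form.toForm)
    (mfderiv 𝓘(ℝ, Euc m) 𝓘(ℝ, JetModel m n 1) w.jet.out.prolong w.jet.source)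

/-- Smoothness of a differential `m`-form on `M`, in charts. -/
def IsSmoothForm (η : (x : M) → TangentSpace 𝓘(ℝ, Euc m) x [⋀^Fin m]→L[ℝ] ℝ) : Prop :=
  ∀ φ ∈ atlas (Euc m) M, ContDiffOn ℝ ∞
    (fun y : Euc m => ((η (φ.symm y)).compContinuousLinearMap
      (mfderiv 𝓘(ℝ, Euc m) 𝓘(ℝ, Euc m) φ.symm y) : Euc m [⋀^Fin m]→L[ℝ] ℝ)) φ.target

/-- The Hamiltonian submanifold `W_o ⊂ W`: the points where the Lagrangian `m`-form
`L · η` equals the coupling form. -/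
def hamiltonianSubmanifold (η : (x : M) → TangentSpace 𝓘(ℝ, Euc m) x [⋀^Fin m]→L[ℝ] ℝ)
    (L : Jet m n π 2 → ℝ) : Set (PhaseSpace m n π) :=
  {w | L (w.jet.proj 2 (by norm_num)) • η w.jet.source = w.coupling}

end Forms

end JetGeometry

/-!
The submanifold `W_o` is the image of a section of `μ_W : W → W_r`, and everything follows from
that section being a smooth immersion.

Fix an adapted chart of `π`. The semibasic elements of the model fibre of `J²π^†` are the multiples
of `dx^1 ∧ … ∧ dx^m` (`DagModel.eq_smul_vol`), so that the model space of `W` splits as that of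
`W_r` times a line with coordinate `p` (`phaseSplitting`). The differential of the first
prolongation of a section is given by the total derivatives `d/dx^i`, whose coefficients are the
jet coordinates of order at most two (`AdaptedChart.hasMFDerivAt_prolong`). Hence the coefficient
of the coupling form with respect to `dx^1 ∧ … ∧ dx^m` is a smooth function of the natural
coordinates of `W`, of the form `p + (terms independent of p)` (`couplingCoeff_add_smul_vol`). As
`T_xM` has dimension `m`, the equation `L η = coupling` is a single scalar equation
(`AdaptedChart.mem_hamiltonianSubmanifold_iff`), and it can be solved for `p`: in natural charts
`W_o` is the graph `p = H` of a smooth function on `W_r`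
(`AdaptedChart.mem_hamiltonianSubmanifold_iff_graph`).

Therefore every fibre of `μ_W` meets `W_o` exactly once, which defines the Hamiltonian section
`W_r → W` with image `W_o`. Replacing the coordinate `p` by `p - H` gives charts of `W` in which
this section is the inclusion of the first factor, so it is an immersion with one-dimensional
complement (`isImmersion_hamiltonianSection`).

The image of an immersive section `h` of any smooth map `μ` carries the manifold structure pulled
back along the homeomorphism `μ|_{im h}`. With it the inclusion is `h` composed with a
diffeomorphism, and transversality is linear algebra: since `dμ ∘ dι` is bijective, the range of
`dι` is a complement of the kernel of `dμ` (`exists_chartedSpace_range_section`).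
-/

noncomputable section
set_option linter.unusedSectionVars false

/-! ### Manifold structure on the image of a smooth section -/

section Transport
variable {H X N : Type*} [TopologicalSpace H] [TopologicalSpace X] [TopologicalSpace N]
  [ChartedSpace H N]

/-- The charted space structure pulled back along a homeomorphism `f : X ≃ₜ N`; its charts are
exactly the charts of `N` precomposed with `f`. -/
@[reducible] def Homeomorph.pullbackChartedSpace (f : X ≃ₜ N) : ChartedSpace H X where
  atlas := f.transOpenPartialHomeomorph '' atlas H N
  chartAt x := f.transOpenPartialHomeomorph (chartAt H (f x))
  mem_chart_source x := mem_chart_source H (f x)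
  chart_mem_atlas x := ⟨_, chart_mem_atlas H (f x), rfl⟩

variable {B : Type*} [NormedAddCommGroup B] [NormedSpace ℝ B] [ChartedSpace B N]
  [IsManifold 𝓘(ℝ, B) ∞ N]

theorem Homeomorph.isManifold_pullback (f : X ≃ₜ N) :
    @IsManifold ℝ _ B _ _ B _ 𝓘(ℝ, B) ∞ X _ f.pullbackChartedSpace := by
  let _ : ChartedSpace B X := f.pullbackChartedSpace
  refine isManifold_of_contDiffOn 𝓘(ℝ, B) ∞ X ?_
  rintro _ _ ⟨e, he, rfl⟩ ⟨e', he', rfl⟩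
  have h : ContDiffOn ℝ ∞ (e.symm.trans e') (e.symm.trans e').source := by
    simpa using contMDiffOn_iff_contDiffOn.1 (contMDiffOn_of_mem_contDiffGroupoid
      (HasGroupoid.compatible (G := contDiffGroupoid ∞ 𝓘(ℝ, B)) he he'))
  refine h.congr_mono (fun x _ => ?_) fun x hx => ?_
  · simp
  · simpa using hx

theorem Homeomorph.contMDiff_pullback (f : X ≃ₜ N) :
    @ContMDiff ℝ _ B _ _ B _ 𝓘(ℝ, B) X _ f.pullbackChartedSpace B _ _ B _ 𝓘(ℝ, B) N _ _ ∞ f := by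
  let _ : ChartedSpace B X := f.pullbackChartedSpace
  have : IsManifold 𝓘(ℝ, B) ∞ X := f.isManifold_pullback
  intro x
  have h1 : ContMDiffAt 𝓘(ℝ, B) 𝓘(ℝ, B) ∞ (chartAt B x) x :=
    contMDiffAt_of_mem_maximalAtlas (IsManifold.chart_mem_maximalAtlas x) (mem_chart_source B x)
  have h2 : ContMDiffAt 𝓘(ℝ, B) 𝓘(ℝ, B) ∞ (chartAt B (f x)).symm (chartAt B x x) :=
    contMDiffAt_symm_of_mem_maximalAtlas (IsManifold.chart_mem_maximalAtlas (f x))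
      (mem_chart_target B (f x))
  refine (h2.comp x h1).congr_of_eventuallyEq ?_
  filter_upwards [(chartAt B x).open_source.mem_nhds (mem_chart_source B x)] with y hy
  exact ((chartAt B (f x)).left_inv hy).symm

theorem Homeomorph.contMDiff_symm_pullback (f : X ≃ₜ N) :
    @ContMDiff ℝ _ B _ _ B _ 𝓘(ℝ, B) N _ _ B _ _ B _ 𝓘(ℝ, B) X _ f.pullbackChartedSpace ∞
      f.symm := by
  let _ : ChartedSpace B X := f.pullbackChartedSpace
  have : IsManifold 𝓘(ℝ, B) ∞ X := f.isManifold_pullback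
  intro y
  have h1 : ContMDiffAt 𝓘(ℝ, B) 𝓘(ℝ, B) ∞ (chartAt B y) y :=
    contMDiffAt_of_mem_maximalAtlas (IsManifold.chart_mem_maximalAtlas y) (mem_chart_source B y)
  have e : chartAt B (f.symm y) = f.transOpenPartialHomeomorph (chartAt B y) := by
    change f.transOpenPartialHomeomorph (chartAt B (f (f.symm y))) = _
    rw [f.apply_symm_apply]
  have h2 : ContMDiffAt 𝓘(ℝ, B) 𝓘(ℝ, B) ∞ (f.transOpenPartialHomeomorph (chartAt B y)).symm
      (chartAt B y y) := by
    rw [← e]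
    refine contMDiffAt_symm_of_mem_maximalAtlas (IsManifold.chart_mem_maximalAtlas (f.symm y)) ?_
    rw [e]
    exact mem_chart_target B y
  refine (h2.comp y h1).congr_of_eventuallyEq ?_
  filter_upwards [(chartAt B y).open_source.mem_nhds (mem_chart_source B y)] with z hz
  exact congrArg f.symm ((chartAt B y).left_inv hz).symm

end Transport

theorem LinearMap.isCompl_range_ker_of_bijective_comp {R U V W : Type*} [Ring R] [AddCommGroup U]
    [Module R U] [AddCommGroup V] [Module R V] [AddCommGroup W] [Module R W]
    (A : U →ₗ[R] V) (B : V →ₗ[R] W) (h : Function.Bijective (B ∘ₗ A)) :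
    IsCompl (LinearMap.range A) (LinearMap.ker B) := by
  refine IsCompl.of_eq ?_ ?_
  · rw [Submodule.eq_bot_iff]
    rintro _ ⟨⟨u, rfl⟩, hu⟩
    have : u = 0 := h.1 (by simpa using hu)
    rw [this, map_zero]
  · rw [Submodule.eq_top_iff']
    intro v
    obtain ⟨u, hu⟩ := h.2 (B v)
    refine Submodule.mem_sup.2 ⟨A u, ⟨u, rfl⟩, v - A u, ?_, by abel⟩
    rw [LinearMap.mem_ker, map_sub, ← hu, LinearMap.comp_apply, sub_self]

section SectionImage
open Manifold

/-- The image `S` of an immersive section `h` of a smooth map `μ : X → N` is an embedded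
submanifold, transverse to `μ` and mapped diffeomorphically onto `N`. -/
theorem exists_chartedSpace_range_section {B C F X N : Type*} [NormedAddCommGroup B]
    [NormedSpace ℝ B] [NormedAddCommGroup C] [NormedSpace ℝ C] [NormedAddCommGroup F]
    [NormedSpace ℝ F] [TopologicalSpace X] [ChartedSpace C X]
    [TopologicalSpace N] [ChartedSpace B N] [IsManifold 𝓘(ℝ, B) ∞ N]
    {μ : X → N} {h : N → X} {S : Set X} (hμ : ContMDiff 𝓘(ℝ, C) 𝓘(ℝ, B) ∞ μ)
    (hh : IsImmersionOfComplement F 𝓘(ℝ, B) 𝓘(ℝ, C) ∞ h) (hμh : ∀ r, μ (h r) = r)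
    (hS : Set.range h = S) :
    ∃ _ : ChartedSpace B S, IsManifold 𝓘(ℝ, B) ∞ S ∧
      IsSmoothEmbedding 𝓘(ℝ, B) 𝓘(ℝ, C) ∞ (Subtype.val : S → X) ∧
      IsImmersionOfComplement F 𝓘(ℝ, B) 𝓘(ℝ, C) ∞ (Subtype.val : S → X) ∧
      ContMDiff 𝓘(ℝ, C) 𝓘(ℝ, B) ∞ μ ∧
      (∀ w : S, IsCompl
        (LinearMap.range (mfderiv 𝓘(ℝ, B) 𝓘(ℝ, C) (Subtype.val : S → X) w).toLinearMap)
        (LinearMap.ker (mfderiv 𝓘(ℝ, C) 𝓘(ℝ, B) μ w.1).toLinearMap)) ∧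
      ∃ Φ : Diffeomorph 𝓘(ℝ, B) 𝓘(ℝ, B) S N ∞, (∀ w, Φ w = μ w.1) ∧
        ∃ g : N → X, (∀ r, g r = (Φ.symm r).1) ∧ ContMDiff 𝓘(ℝ, B) 𝓘(ℝ, C) ∞ g ∧
          ∀ r, μ (g r) = r := by
  subst hS
  have hsm : ContMDiff 𝓘(ℝ, B) 𝓘(ℝ, C) ∞ h := hh.contMDiff
  let f : Set.range h ≃ₜ N :=
    { toFun := fun w => μ w.1
      invFun := fun r => ⟨h r, r, rfl⟩
      left_inv := by
        rintro ⟨_, r, rfl⟩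
        exact Subtype.ext (congrArg h (hμh r))
      right_inv := hμh
      continuous_toFun := hμ.continuous.comp continuous_subtype_val
      continuous_invFun := hsm.continuous.subtype_mk _ }
  let _ : ChartedSpace B (Set.range h) := f.pullbackChartedSpace
  have hM : IsManifold 𝓘(ℝ, B) ∞ (Set.range h) := f.isManifold_pullback
  have hval : (Subtype.val : Set.range h → X) = h ∘ f := by
    funext w
    exact congrArg Subtype.val (f.symm_apply_apply w).symm
  have himm : IsImmersionOfComplement F 𝓘(ℝ, B) 𝓘(ℝ, C) ∞ (Subtype.val : Set.range h → X) := by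
    intro w
    have hw := hh (f w)
    refine IsImmersionAtOfComplement.mk_of_charts hw.equiv
      (f.transOpenPartialHomeomorph hw.domChart) hw.codChart hw.mem_domChart_source ?_ ?_
      hw.codChart_mem_maximalAtlas ?_ ?_
    · rw [hval]; exact hw.mem_codChart_source
    · refine OpenPartialHomeomorph.mem_maximalAtlas_of_contMDiffOn _ ?_ ?_
      · exact (contMDiffOn_of_mem_maximalAtlas hw.domChart_mem_maximalAtlas).comp
          f.contMDiff_pullback.contMDiffOn fun _ hx => hx
      · exact f.contMDiff_symm_pullback.comp_contMDiffOn
          (contMDiffOn_symm_of_mem_maximalAtlas hw.domChart_mem_maximalAtlas)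
    · rw [hval]; exact fun x hx => hw.source_subset_preimage_source hx
    · rw [hval]
      intro x hx
      have hx' : x ∈ (hw.domChart.extend 𝓘(ℝ, B)).target := by simpa using hx
      simpa using hw.writtenInCharts hx'
  let Φ : Diffeomorph 𝓘(ℝ, B) 𝓘(ℝ, B) (Set.range h) N ∞ :=
    { f.toEquiv with
      contMDiff_toFun := f.contMDiff_pullback
      contMDiff_invFun := f.contMDiff_symm_pullback }
  refine ⟨inferInstance, hM, ⟨himm.isImmersion, Topology.IsEmbedding.subtypeVal⟩, himm, hμ, ?_,
    Φ, fun _ => rfl, h, fun _ => rfl, hsm, hμh⟩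
  intro w
  refine LinearMap.isCompl_range_ker_of_bijective_comp _ _ ?_
  have h1 : MDifferentiableAt 𝓘(ℝ, B) 𝓘(ℝ, C) (Subtype.val : Set.range h → X) w :=
    himm.contMDiff.mdifferentiable (by simp) w
  have h2 : MDifferentiableAt 𝓘(ℝ, C) 𝓘(ℝ, B) μ w.1 := hμ.mdifferentiable (by simp) w.1
  have h3 := mfderiv_comp w h2 h1
  have h4 : Function.Bijective (mfderiv 𝓘(ℝ, B) 𝓘(ℝ, B) Φ w) :=
    (Φ.mfderivToContinuousLinearEquiv (by simp) w).bijective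
  have h5 : mfderiv 𝓘(ℝ, B) 𝓘(ℝ, B) Φ w
    = (mfderiv 𝓘(ℝ, C) 𝓘(ℝ, B) μ w.1).comp (mfderiv 𝓘(ℝ, B) 𝓘(ℝ, C) Subtype.val w) := h3
  rw [h5] at h4
  exact h4

end SectionImage

/-! ### The model fibres -/

section ModelFibre
variable {m n : ℕ}

/-- The semibasic volume form `dx^1 ∧ … ∧ dx^m` in natural coordinates on `J¹π`. -/
def DagModel.volForm (m n : ℕ) : JetModel m n 1 [⋀^Fin m]→L[ℝ] ℝ :=
  { (Matrix.detRowAlternating : (Fin m → ℝ) [⋀^Fin m]→ₗ[ℝ] ℝ).compLinearMap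
      ((EuclideanSpace.equiv (Fin m) ℝ).toLinearMap ∘ₗ
        LinearMap.fst ℝ (Euc m) ((i : Fin 2) → SymMul m n i)) with
    cont := by
      have h : Continuous fun X : Fin m → JetModel m n 1 =>
          (Matrix.of fun i j => (X i).1 j).det := by
        refine Continuous.matrix_det (continuous_matrix fun i j => ?_)
        simp only [Matrix.of_apply]
        fun_prop
      exact h }

theorem DagModel.volForm_apply (X : Fin m → JetModel m n 1) :
    DagModel.volForm m n X = (Matrix.of fun i j => (X i).1 j).det := rfl

theorem DagModel.volForm_eq_zero {X : Fin m → JetModel m n 1} {k : Fin m} (h : (X k).1 = 0) :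
    DagModel.volForm m n X = 0 := by
  rw [volForm_apply]
  exact Matrix.det_eq_zero_of_row_eq_zero k fun j => by simp [h]

/-- The form `dx^1 ∧ … ∧ dx^m` as an element of the model fibre of `J²π^†`. -/
def DagModel.vol (m n : ℕ) : DagModel m n :=
  DagModel.ofForm (DagModel.volForm m n) <| by
    refine ⟨fun X k _ _ hk _ => volForm_eq_zero hk, fun i j α => ?_⟩
    have h : ∀ i j : Fin m, topMomentum (volForm m n) i j α = 0 := fun i j =>
      volForm_eq_zero (k := j) (by simp [duVec, topVec])
    rw [h, h]

theorem DagModel.vol_apply_of_fst {X : Fin m → JetModel m n 1}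
    (h : ∀ k, (X k).1 = EuclideanSpace.single k 1) : (DagModel.vol m n).toForm X = 1 := by
  change volForm m n X = 1
  rw [volForm_apply]
  convert Matrix.det_one (n := Fin m) (R := ℝ)
  ext i j
  simp [h, Matrix.one_apply, eq_comm]

theorem DagModel.vol_mem_semibasic : DagModel.vol m n ∈ DagModel.semibasic m n :=
  fun _ _ hk => volForm_eq_zero hk

theorem DagModel.toDdag_vol : DagModel.toDdag m n (DagModel.vol m n) = 0 :=
  (Submodule.Quotient.mk_eq_zero _).2 DagModel.vol_mem_semibasic

theorem DagModel.toDdag_eq_zero {u : DagModel m n} :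
    DagModel.toDdag m n u = 0 ↔ u ∈ DagModel.semibasic m n :=
  Submodule.Quotient.mk_eq_zero _

/-- A semibasic form depends only on the horizontal parts of its arguments. -/
theorem DagModel.semibasic_congr {u : DagModel m n} (hu : u ∈ DagModel.semibasic m n)
    {X X' : Fin m → JetModel m n 1} (h : ∀ k, (X k).1 = (X' k).1) :
    u.toForm X = u.toForm X' := by
  have key : ∀ s : Finset (Fin m), u.toForm (s.piecewise X' X) = u.toForm X := by
    intro s
    induction s using Finset.induction_on with
    | empty => simp
    | insert k s hk ih =>
      rw [← ih, Finset.piecewise_insert]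
      have e : s.piecewise X' X = Function.update (s.piecewise X' X) k (X k) := by
        rw [eq_comm, Function.update_eq_self_iff]
        simp [hk]
      conv_rhs => rw [e]
      rw [← sub_eq_zero, ← ContinuousAlternatingMap.map_update_sub]
      exact hu _ k (by simp [h k])
  have := key Finset.univ
  rw [Finset.piecewise_univ] at this
  exact this.symm

/-- The semibasic forms of the model fibre are the multiples of `dx^1 ∧ … ∧ dx^m`. -/
theorem DagModel.eq_smul_vol {u : DagModel m n} (hu : u ∈ DagModel.semibasic m n) :
    u = u.toForm (dxVec m n) • DagModel.vol m n := by
  have hb : ∀ k, (EuclideanSpace.basisFun (Fin m) ℝ).toBasis k = EuclideanSpace.single k (1 : ℝ) :=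
    fun k => by simp
  have hrestr : ∀ w : DagModel m n, w ∈ DagModel.semibasic m n → w.toForm (dxVec m n) = 0 →
      w = 0 := by
    intro w hw hw0
    refine DagModel.toForm_injective (ContinuousAlternatingMap.ext fun X => ?_)
    refine (DagModel.semibasic_congr (X := X) (X' := fun k => horVec m n (X k).1) hw
      fun k => rfl).trans ?_
    have h0 := (w.toForm.toAlternatingMap.compLinearMap (horVec m n).toLinearMap).eq_smul_basis_det
      (EuclideanSpace.basisFun (Fin m) ℝ).toBasis
    have h1 : (w.toForm.toAlternatingMap.compLinearMap (horVec m n).toLinearMap)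
        ((EuclideanSpace.basisFun (Fin m) ℝ).toBasis) = 0 := by
      refine Eq.trans ?_ hw0
      change w.toForm (fun k => horVec m n _) = w.toForm (fun k => horVec m n _)
      simp only [hb]
    rw [h1, zero_smul] at h0
    exact congrArg (fun A => A fun k => (X k).1) h0
  rw [← sub_eq_zero]
  refine hrestr _ (Submodule.sub_mem _ hu (Submodule.smul_mem _ _ DagModel.vol_mem_semibasic)) ?_
  rw [map_sub, map_smul, ContinuousAlternatingMap.sub_apply,
    ContinuousAlternatingMap.smul_apply,
    DagModel.vol_apply_of_fst (fun k => rfl), smul_eq_mul, mul_one, sub_self]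

/-- The splitting of the model fibre of `J²π^†` into the coordinates `(p_α^i, p_α^I)` of the
quotient and the coordinate `p` of the semibasic part. -/
def fibreSplitting (m n : ℕ) : (DdagModel m n × ℝ) ≃ₗ[ℝ] DagModel m n where
  toFun p := ddagSection m n p.1 + p.2 • DagModel.vol m n
  map_add' p q := by simp only [Prod.fst_add, Prod.snd_add, map_add, add_smul]; abel
  map_smul' a p := by simp [mul_smul]
  invFun u := (DagModel.toDdag m n u,
    (u - ddagSection m n (DagModel.toDdag m n u)).toForm (dxVec m n))
  left_inv p := by
    have h : DagModel.toDdag m n (ddagSection m n p.1 + p.2 • DagModel.vol m n) = p.1 := by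
      rw [map_add, map_smul, toDdag_ddagSection, DagModel.toDdag_vol, smul_zero, add_zero]
    refine Prod.ext h ?_
    dsimp only
    rw [h, add_sub_cancel_left, map_smul,
      ContinuousAlternatingMap.smul_apply, DagModel.vol_apply_of_fst (fun k => rfl),
      smul_eq_mul, mul_one]
  right_inv u := by
    dsimp only
    rw [← DagModel.eq_smul_vol (DagModel.toDdag_eq_zero.1 ?_), add_sub_cancel]
    rw [map_sub, toDdag_ddagSection, sub_self]

/-- The splitting `W ≅ W_r × ℝ` of the model spaces. -/
def phaseSplitting (m n : ℕ) : (ReducedPhaseModel m n × ℝ) ≃L[ℝ] PhaseModel m n :=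
  (ContinuousLinearEquiv.prodAssoc ℝ (JetModel m n 3) (DdagModel m n) ℝ).trans
    ((ContinuousLinearEquiv.refl ℝ (JetModel m n 3)).prodCongr
      (fibreSplitting m n).toContinuousLinearEquiv)

theorem phaseSplitting_apply (p : ReducedPhaseModel m n) (t : ℝ) :
    phaseSplitting m n (p, t) = (p.1, ddagSection m n p.2 + t • DagModel.vol m n) := rfl

end ModelFibre

/-! ### The coupling form in coordinates -/

section ModelCoupling
variable {m n : ℕ}

/-- The total derivatives `d/dx^i = ∂/∂x^i + u_i^α ∂/∂u^α + u_{ij}^α ∂/∂u_j^α` in natural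
coordinates, as a linear map from the base to `J¹π`: the differential of the first prolongation of
a section with jet coordinates `v`. -/
def totalDeriv (v : JetModel m n 3) : Euc m →L[ℝ] JetModel m n 1 :=
  (ContinuousLinearMap.id ℝ (Euc m)).prod (ContinuousLinearMap.pi fun i : Fin 2 =>
    (SymMul.symmetrize m n i).comp
      (continuousMultilinearCurryLeftEquiv ℝ (fun _ : Fin ((i : ℕ) + 1) => Euc m) (Euc n)
        (v.2 ⟨(i : ℕ) + 1, by omega⟩).toMap))

theorem totalDeriv_fst (v : JetModel m n 3) (a : Euc m) : (totalDeriv v a).1 = a := rfl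

theorem contDiff_totalDeriv_apply (a : Euc m) :
    ContDiff ℝ ∞ fun v : JetModel m n 3 => totalDeriv v a := by
  refine contDiff_const.prodMk (contDiff_pi.2 fun i => ?_)
  refine (SymMul.symmetrize m n i).contDiff.comp ?_
  have h1 : ContDiff ℝ ∞ fun v : JetModel m n 3 => v.2 ⟨(i : ℕ) + 1, by omega⟩ :=
    contDiff_pi.1 contDiff_snd _
  have h2 : ContDiff ℝ ∞ fun v : JetModel m n 3 => (v.2 ⟨(i : ℕ) + 1, by omega⟩).toMap :=
    SymMul.toMap.contDiff.comp h1
  exact ((continuousMultilinearCurryLeftEquiv ℝ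
    (fun _ : Fin ((i : ℕ) + 1) => Euc m) (Euc n)).contDiff.comp h2).clm_apply contDiff_const

/-- The coefficient of the coupling form with respect to `dx^1 ∧ … ∧ dx^m`. -/
def couplingCoeff (v : JetModel m n 3) (u : DagModel m n) : ℝ :=
  u.toForm fun k => totalDeriv v (EuclideanSpace.single k 1)

theorem contDiff_couplingCoeff :
    ContDiff ℝ ∞ fun p : PhaseModel m n => couplingCoeff p.1 p.2 := by
  have h1 : ContDiff ℝ ∞ fun p : PhaseModel m n => p.2.toForm.toContinuousMultilinearMap :=
    (ContinuousAlternatingMap.toContinuousMultilinearMapCLM (𝕜 := ℝ) (E := JetModel m n 1)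
      (F := ℝ) (ι := Fin m) ℝ).contDiff.comp (DagModel.toForm.contDiff.comp contDiff_snd)
  have h2 : ContDiff ℝ ∞ fun p : PhaseModel m n => fun k : Fin m =>
      totalDeriv p.1 (EuclideanSpace.single k 1) :=
    contDiff_pi.2 fun k => (contDiff_totalDeriv_apply _).comp contDiff_fst
  exact contDiff_multilinear_apply.comp (h1.prodMk h2)

theorem couplingCoeff_add_smul_vol (v : JetModel m n 3) (u : DagModel m n) (t : ℝ) :
    couplingCoeff v (u + t • DagModel.vol m n) = couplingCoeff v u + t := by
  rw [couplingCoeff, map_add, map_smul, ContinuousAlternatingMap.add_apply,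
    ContinuousAlternatingMap.smul_apply,
    DagModel.vol_apply_of_fst (totalDeriv_fst v <| EuclideanSpace.single · 1),
    smul_eq_mul, mul_one, couplingCoeff]

end ModelCoupling

/-! ### The equation of `W_o` in natural coordinates -/

section CouplingInCharts
variable {m n : ℕ} {M E : Type*}
  [TopologicalSpace M] [ChartedSpace (Euc m) M]
  [TopologicalSpace E] [ChartedSpace (Euc (m + n)) E] {π : E → M}

namespace AdaptedChart
variable (c : AdaptedChart m n π)

theorem mdifferentiable_base : c.base.MDifferentiable 𝓘(ℝ, Euc m) 𝓘(ℝ, Euc m) :=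
  ⟨c.contMDiffOn_base.mdifferentiableOn (by simp),
    c.contMDiffOn_base_symm.mdifferentiableOn (by simp)⟩

/-- The coefficient `η(∂/∂x^1, …, ∂/∂x^m)` of an `m`-form on `M` in the coordinates of `c`. -/
def formCoeff (η : (x : M) → TangentSpace 𝓘(ℝ, Euc m) x [⋀^Fin m]→L[ℝ] ℝ) (z : Euc m) : ℝ :=
  η (c.base.symm z) fun k =>
    mfderiv 𝓘(ℝ, Euc m) 𝓘(ℝ, Euc m) c.base.symm z (EuclideanSpace.single k (1 : ℝ) : Euc m)

theorem contDiffOn_formCoeff [IsManifold 𝓘(ℝ, Euc m) ∞ M]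
    {η : (x : M) → TangentSpace 𝓘(ℝ, Euc m) x [⋀^Fin m]→L[ℝ] ℝ} (hη : IsSmoothForm η) :
    ContDiffOn ℝ ∞ (c.formCoeff η) c.base.target := by
  intro z₀ hz₀
  refine ContDiffAt.contDiffWithinAt ?_
  set φ := chartAt (Euc m) (c.base.symm z₀) with hφ
  have hφa : φ ∈ atlas (Euc m) M := chart_mem_atlas _ _
  -- the change of coordinates from `c.base` to a chart of the atlas of `M`
  let τ : Euc m → Euc m := fun z => φ (c.base.symm z)
  let O : Set (Euc m) := c.base.target ∩ c.base.symm ⁻¹' φ.source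
  have hO : IsOpen O := c.base.symm.isOpen_inter_preimage φ.open_source
  have hzO : z₀ ∈ O := ⟨hz₀, mem_chart_source (Euc m) (c.base.symm z₀)⟩
  have hτ : ContDiffOn ℝ ∞ τ O := contMDiffOn_iff_contDiffOn.1
    ((contMDiffOn_of_mem_maximalAtlas (IsManifold.subset_maximalAtlas hφa)).comp
      (c.contMDiffOn_base_symm.mono Set.inter_subset_left) fun z hz => hz.2)
  let A : Euc m → Euc m [⋀^Fin m]→L[ℝ] ℝ := fun y => ((η (φ.symm y)).compContinuousLinearMap
      (mfderiv 𝓘(ℝ, Euc m) 𝓘(ℝ, Euc m) φ.symm y) : Euc m [⋀^Fin m]→L[ℝ] ℝ)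
  have hA : ContDiffOn ℝ ∞ A φ.target := hη φ hφa
  have h1 : ContDiffOn ℝ ∞ (fun z => (A (τ z)).toContinuousMultilinearMap) O :=
    (ContinuousAlternatingMap.toContinuousMultilinearMapCLM (𝕜 := ℝ) (E := Euc m)
      (F := ℝ) (ι := Fin m) ℝ).contDiff.comp_contDiffOn
        (hA.comp hτ fun z hz => φ.map_source hz.2)
  have h2 : ContDiffOn ℝ ∞ (fun z => fun k : Fin m =>
      fderiv ℝ τ z (EuclideanSpace.single k (1 : ℝ))) O :=
    contDiffOn_pi.2 fun k => (hτ.fderiv_of_isOpen hO le_rfl).clm_apply contDiffOn_const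
  have h3 : ContDiffOn ℝ ∞
      (fun z => A (τ z) fun k => fderiv ℝ τ z (EuclideanSpace.single k (1 : ℝ))) O :=
    contDiff_multilinear_apply.comp_contDiffOn (h1.prodMk h2)
  refine (h3.congr fun z hz => ?_).contDiffAt (hO.mem_nhds hzO)
  have hd : MDifferentiableAt 𝓘(ℝ, Euc m) 𝓘(ℝ, Euc m) φ.symm (τ z) :=
    (mdifferentiable_of_mem_atlas hφa).mdifferentiableAt_symm (φ.map_source hz.2)
  have hτz : HasMFDerivAt 𝓘(ℝ, Euc m) 𝓘(ℝ, Euc m) τ z (fderiv ℝ τ z) :=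
    ((hτ.contDiffAt (hO.mem_nhds hz)).differentiableAt (by simp)).hasFDerivAt.hasMFDerivAt
  have he : c.base.symm =ᶠ[𝓝 z] φ.symm ∘ τ := by
    filter_upwards [hO.mem_nhds hz] with y hy
    exact (φ.left_inv hy.2).symm
  have h4 := ((HasMFDerivAt.comp z hd.hasMFDerivAt hτz).congr_of_eventuallyEq he).mfderiv
  have h5 : ∀ (p q : M), p = q → ∀ X : Fin m → Euc m,
      (η p : Euc m [⋀^Fin m]→L[ℝ] ℝ) X = (η q : Euc m [⋀^Fin m]→L[ℝ] ℝ) X := by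
    rintro p _ rfl X; rfl
  refine (h5 _ _ (φ.left_inv hz.2).symm _).trans ?_
  change (η (φ.symm (τ z)) : Euc m [⋀^Fin m]→L[ℝ] ℝ) _ =
    (η (φ.symm (τ z)) : Euc m [⋀^Fin m]→L[ℝ] ℝ) _
  congr 1
  funext k
  exact congrArg (fun A : Euc m →L[ℝ] Euc m => A (EuclideanSpace.single k (1 : ℝ))) h4

/-- The coordinate expression of the first prolongation has the total derivatives as its
differential. -/
theorem hasFDerivAt_prolong_coord {s : LocalSection m n π} (hs : s.toFun s.pt ∈ c.total.source) :
    HasFDerivAt (fun z : Euc m => ((z, fun i : Fin 2 => SymMul.symmetrize m n i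
        (iteratedFDeriv ℝ i (c.rep s.toFun) z)) : JetModel m n 1))
      (totalDeriv (c.sectionCoord 3 s)) (c.base s.pt) := by
  obtain ⟨-, -, O, hO, hxO, -, hsm, -⟩ := c.exists_rep_contDiffOn s.isLocalSectionAt hs
  refine (hasFDerivAt_id _).prodMk (hasFDerivAt_pi.2 fun i => ?_)
  refine (SymMul.symmetrize m n i).hasFDerivAt.comp _ ?_
  have h1 : DifferentiableAt ℝ (iteratedFDeriv ℝ i (c.rep s.toFun)) (c.base s.pt) :=
    (hsm.contDiffAt (hO.mem_nhds hxO)).differentiableAt_iteratedFDeriv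
      (by exact_mod_cast ENat.natCast_lt_top _)
  have h2 := h1.hasFDerivAt
  rw [fderiv_iteratedFDeriv] at h2
  have h3 := c.sectionCoord_snd 3 hs ⟨(i : ℕ) + 1, by omega⟩
  dsimp only [Function.comp] at h2
  rw [h3]
  exact h2

variable [IsManifold 𝓘(ℝ, Euc m) ∞ M] [IsManifold 𝓘(ℝ, Euc (m + n)) ∞ E] [IsFiberedManifold m n π]

/-- The differential of the first prolongation, in the natural frame. -/
theorem hasMFDerivAt_prolong {s : LocalSection m n π} (hs : s.toFun s.pt ∈ c.total.source) :
    HasMFDerivAt 𝓘(ℝ, Euc m) 𝓘(ℝ, JetModel m n 1) s.prolong s.pt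
      ((c.frame (Jet.mk 1 s) : JetModel m n 1 →L[ℝ] JetModel m n 1).comp
        ((totalDeriv (c.sectionCoord 3 s)).comp
          (mfderiv 𝓘(ℝ, Euc m) 𝓘(ℝ, Euc m) c.base s.pt : Euc m →L[ℝ] Euc m)) :
        Euc m →L[ℝ] JetModel m n 1) := by
  obtain ⟨hxb, -, O, hO, hxO, hOt, hsm, hOs⟩ := c.exists_rep_contDiffOn s.isLocalSectionAt hs
  let G : Euc m → JetModel m n 1 := fun z => (z, fun i : Fin 2 => SymMul.symmetrize m n i
        (iteratedFDeriv ℝ i (c.rep s.toFun) z))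
  have hG : G (c.base s.pt) = c.jetCoord 1 (Jet.mk 1 s) := (c.jetCoord_mk 1 hs).symm
  have h1 : HasMFDerivAt 𝓘(ℝ, Euc m) 𝓘(ℝ, Euc m) c.base s.pt
      (mfderiv 𝓘(ℝ, Euc m) 𝓘(ℝ, Euc m) c.base s.pt) :=
    (c.mdifferentiable_base.mdifferentiableAt hxb).hasMFDerivAt
  have h2 : HasMFDerivAt 𝓘(ℝ, Euc m) 𝓘(ℝ, JetModel m n 1) G (c.base s.pt)
      (totalDeriv (c.sectionCoord 3 s)) := (c.hasFDerivAt_prolong_coord hs).hasMFDerivAt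
  have h3 : HasMFDerivAt 𝓘(ℝ, JetModel m n 1) 𝓘(ℝ, JetModel m n 1) (c.jetHomeo 1).symm
      (G (c.base s.pt)) (c.frame (Jet.mk 1 s) : JetModel m n 1 →L[ℝ] JetModel m n 1) := by
    rw [hG]
    exact ((c.jetHomeo_mdiff 1).mdifferentiableAt_symm
      (c.jetCoord_target (j := Jet.mk 1 s) hs)).hasMFDerivAt
  refine (HasMFDerivAt.comp s.pt h3 (HasMFDerivAt.comp s.pt h2 h1)).congr_of_eventuallyEq ?_
  obtain ⟨U, hU, hxU, hsU, hsec⟩ := s.isLocalSectionAt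
  have hO' : c.base ⁻¹' O ∈ 𝓝 s.pt :=
    (c.base.continuousAt hxb).preimage_mem_nhds (hO.mem_nhds hxO)
  filter_upwards [hO', hU.mem_nhds hxU, c.base.open_source.mem_nhds hxb] with y hyO hyU hyb
  have hy : IsLocalSectionAt m n π s.toFun y := ⟨U, hU, hyU, hsU, hsec⟩
  have hyt : s.toFun y ∈ c.total.source := by
    have := (hOs _ hyO).1
    rwa [c.base.left_inv hyb] at this
  have h4 : s.prolong y = Jet.mk 1 ⟨y, s.toFun, hy⟩ := dif_pos hy
  have h5 : G (c.base y) = c.jetCoord 1 (Jet.mk 1 ⟨y, s.toFun, hy⟩) :=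
    (c.jetCoord_mk 1 (s := ⟨y, s.toFun, hy⟩) hyt).symm
  change s.prolong y = (c.jetHomeo 1).symm (G (c.base y))
  rw [h4, h5]
  exact (c.jetChart_left_inv (j := Jet.mk 1 ⟨y, s.toFun, hy⟩) hyt).symm

end AdaptedChart

end CouplingInCharts

section Membership
variable {m n : ℕ} {M E : Type*}
  [TopologicalSpace M] [ChartedSpace (Euc m) M]
  [TopologicalSpace E] [ChartedSpace (Euc (m + n)) E] {π : E → M}
  [IsManifold 𝓘(ℝ, Euc m) ∞ M] [IsManifold 𝓘(ℝ, Euc (m + n)) ∞ E] [IsFiberedManifold m n π]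

namespace AdaptedChart
variable (c : AdaptedChart m n π)

/-- The coupling form `(j¹φ)^*ω` in natural coordinates: the coordinate expression of `ω` evaluated
on total derivatives. -/
theorem coupling_apply {w : PhaseSpace m n π} (h : w.jet.target ∈ c.total.source)
    (a : Fin m → Euc m) :
    (w.coupling : Euc m [⋀^Fin m]→L[ℝ] ℝ) a =
      (symFibreCoord.toFibre c w).toForm fun k => totalDeriv (c.jetCoord 3 w.jet)
        ((mfderiv 𝓘(ℝ, Euc m) 𝓘(ℝ, Euc m) c.base w.jet.source : Euc m →L[ℝ] Euc m) (a k)) := by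
  set s := w.jet.out with hs
  have hj : Jet.mk 3 s = w.jet := Jet.mk_out w.jet
  have hpt : s.pt = w.jet.source := congrArg Jet.source hj
  have hst : s.toFun s.pt ∈ c.total.source := by
    have : s.toFun s.pt = w.jet.target := congrArg Jet.target hj
    rwa [this]
  have hproj : w.jet.proj 1 (by norm_num) = Jet.mk 1 s := by rw [← hj]; rfl
  -- tangent spaces at equal points are identified with the same model space
  have hframe : (c.frame (w.jet.proj 1 (by norm_num)) : JetModel m n 1 →L[ℝ] JetModel m n 1)
      = c.frame (Jet.mk 1 s) := by rw [hproj]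
  have hprol : ∀ x, s.pt = x →
      (mfderiv 𝓘(ℝ, Euc m) 𝓘(ℝ, JetModel m n 1) s.prolong x : Euc m →L[ℝ] JetModel m n 1)
      = (c.frame (Jet.mk 1 s) : JetModel m n 1 →L[ℝ] JetModel m n 1).comp
        ((totalDeriv (c.sectionCoord 3 s)).comp
          (mfderiv 𝓘(ℝ, Euc m) 𝓘(ℝ, Euc m) c.base x : Euc m →L[ℝ] Euc m)) := by
    rintro _ rfl
    exact (c.hasMFDerivAt_prolong hst).mfderiv
  have hcoord : c.jetCoord 3 w.jet = c.sectionCoord 3 s := rfl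
  rw [symFibreCoord.toFibre_of_mem c h]
  change (w.form.toForm : JetModel m n 1 [⋀^Fin m]→L[ℝ] ℝ) (fun k =>
      (mfderiv 𝓘(ℝ, Euc m) 𝓘(ℝ, JetModel m n 1) s.prolong w.jet.source :
        Euc m →L[ℝ] JetModel m n 1) (a k))
    = (w.form.toForm : JetModel m n 1 [⋀^Fin m]→L[ℝ] ℝ) (fun k =>
      (c.frame (w.jet.proj 1 (by norm_num)) : JetModel m n 1 →L[ℝ] JetModel m n 1) _)
  rw [hframe, hprol _ hpt]
  rfl

/-- The base coordinates of a jet are coordinates of its source. -/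
theorem base_source {k : ℕ} {j : Jet m n π k} (h : j.target ∈ c.total.source) :
    j.source ∈ c.base.source ∧ c.base j.source = (c.jetCoord k j).1 := by
  rw [← Jet.mk_out j] at h ⊢
  rw [c.jetCoord_mk k h]
  exact ⟨(c.exists_rep_contDiffOn j.out.isLocalSectionAt h).1, rfl⟩

/-- The projection `J³π → J²π` in natural coordinates. -/
def trunc₂ (v : JetModel m n 3) : JetModel m n 2 :=
  (v.1, fun i => v.2 (Fin.castLE (by norm_num : 3 ≤ 4) i))

/-- The coefficient `L · η(∂/∂x^1, …, ∂/∂x^m)` of the Lagrangian density in natural coordinates. -/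
def lagrangianCoeff (η : (x : M) → TangentSpace 𝓘(ℝ, Euc m) x [⋀^Fin m]→L[ℝ] ℝ)
    (L : Jet m n π 2 → ℝ) (v : JetModel m n 3) : ℝ :=
  L ((c.jetHomeo 2).symm (trunc₂ v)) * c.formCoeff η v.1

theorem contDiffOn_lagrangianCoeff
    {η : (x : M) → TangentSpace 𝓘(ℝ, Euc m) x [⋀^Fin m]→L[ℝ] ℝ} (hη : IsSmoothForm η)
    {L : Jet m n π 2 → ℝ} (hL : ContMDiff 𝓘(ℝ, JetModel m n 2) 𝓘(ℝ, ℝ) ∞ L) :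
    ContDiffOn ℝ ∞ (c.lagrangianCoeff η L) (jetValue ⁻¹' c.total.target) := by
  have ht : ContDiff ℝ ∞ (trunc₂ : JetModel m n 3 → JetModel m n 2) :=
    contDiff_fst.prodMk (contDiff_pi.2 fun i => contDiff_pi.1
      (contDiff_snd : ContDiff ℝ ∞ (Prod.snd : JetModel m n 3 → _)) _)
  have h1 : ContDiffOn ℝ ∞ (fun v => L ((c.jetHomeo 2).symm v)) (c.jetHomeo 2).target :=
    contMDiffOn_iff_contDiffOn.1 (hL.comp_contMDiffOn (contMDiffOn_symm_of_mem_maximalAtlas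
      (IsManifold.subset_maximalAtlas (c.jetHomeo_mem 2))))
  exact (h1.comp ht.contDiffOn fun v hv => hv).mul
    ((c.contDiffOn_formCoeff hη).comp contDiffOn_fst fun v hv =>
      (c.fst_mem_target (p := jetValue v) hv).1)

/-- The equation of `W_o` is scalar: both sides are `m`-forms on the `m`-dimensional space `T_xM`,
and so agree as soon as they agree on the coordinate basis. -/
theorem mem_hamiltonianSubmanifold_iff {w : PhaseSpace m n π} (h : w.jet.target ∈ c.total.source)
    (η : (x : M) → TangentSpace 𝓘(ℝ, Euc m) x [⋀^Fin m]→L[ℝ] ℝ) (L : Jet m n π 2 → ℝ) :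
    w ∈ hamiltonianSubmanifold η L ↔ c.lagrangianCoeff η L (c.jetCoord 3 w.jet)
      = couplingCoeff (c.jetCoord 3 w.jet) (symFibreCoord.toFibre c w) := by
  obtain ⟨hsrc, hbase⟩ := c.base_source h
  set x := w.jet.source with hx
  have hL : (c.jetHomeo 2).symm (trunc₂ (c.jetCoord 3 w.jet)) = w.jet.proj 2 (by norm_num) := by
    have h1 : c.jetCoord 2 (w.jet.proj 2 (by norm_num)) = trunc₂ (c.jetCoord 3 w.jet) := by
      have h' := h
      rw [← Jet.mk_out w.jet] at h' ⊢
      rw [Jet.proj_mk, c.jetCoord_mk 2 h', c.jetCoord_mk 3 h']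
      rfl
    rw [← h1]
    exact c.jetChart_left_inv (by rwa [Jet.proj_target])
  -- the coordinate vectors `∂/∂x^k` form a basis of `T_xM`
  have hT : c.base x ∈ c.base.symm.source := c.base.map_source hsrc
  let T : Euc m →L[ℝ] Euc m := mfderiv 𝓘(ℝ, Euc m) 𝓘(ℝ, Euc m) c.base.symm (c.base x)
  have hTb : Function.Bijective T := c.mdifferentiable_base.symm.mfderiv_bijective hT
  let b : Module.Basis (Fin m) ℝ (Euc m) := (EuclideanSpace.basisFun (Fin m) ℝ).toBasis.map
    (LinearEquiv.ofBijective T.toLinearMap hTb)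
  have hb : ∀ k, b k = T (EuclideanSpace.single k 1) := fun k => by simp [b]
  have hcomp : ∀ a : Euc m,
      (mfderiv 𝓘(ℝ, Euc m) 𝓘(ℝ, Euc m) c.base x : Euc m →L[ℝ] Euc m) (T a) = a := by
    intro a
    have h1 := c.mdifferentiable_base.comp_symm_deriv hT
    have h2 : ∀ p q : M, p = q →
        (mfderiv 𝓘(ℝ, Euc m) 𝓘(ℝ, Euc m) c.base p : Euc m →L[ℝ] Euc m)
        = mfderiv 𝓘(ℝ, Euc m) 𝓘(ℝ, Euc m) c.base q := by rintro p _ rfl; rfl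
    have h3 := congrArg (fun A : Euc m →L[ℝ] Euc m => A a) h1
    rw [h2 _ _ (c.base.left_inv hsrc).symm]
    exact h3
  let A : Euc m [⋀^Fin m]→L[ℝ] ℝ := L (w.jet.proj 2 (by norm_num)) • η x
  let B : Euc m [⋀^Fin m]→L[ℝ] ℝ := w.coupling
  have hAB : A = B ↔ A b = B b := by
    refine ⟨fun h => by rw [h], fun h => ?_⟩
    refine ContinuousAlternatingMap.toAlternatingMap_injective ?_
    rw [A.toAlternatingMap.eq_smul_basis_det b, B.toAlternatingMap.eq_smul_basis_det b]
    exact congrArg (· • b.det) h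
  have hA : A b = c.lagrangianCoeff η L (c.jetCoord 3 w.jet) := by
    have h5 : ∀ (p q : M), p = q → ∀ X : Fin m → Euc m,
        (η p : Euc m [⋀^Fin m]→L[ℝ] ℝ) X = (η q : Euc m [⋀^Fin m]→L[ℝ] ℝ) X := by
      rintro p _ rfl X; rfl
    rw [lagrangianCoeff, hL, ← hbase]
    change L _ * (η x : Euc m [⋀^Fin m]→L[ℝ] ℝ) b
      = L _ * (η (c.base.symm (c.base x)) : Euc m [⋀^Fin m]→L[ℝ] ℝ) fun k => T _
    rw [h5 _ _ (c.base.left_inv hsrc), funext hb]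
  have hB : B b = couplingCoeff (c.jetCoord 3 w.jet) (symFibreCoord.toFibre c w) := by
    refine (c.coupling_apply h b).trans ?_
    simp only [couplingCoeff, hb]
    congr 1
    funext k
    exact congrArg _ (hcomp _)
  rw [← hA, ← hB]
  exact hAB

end AdaptedChart
end Membership

/-! ### The Hamiltonian section -/

section HamiltonianSection
open Manifold
variable {m n : ℕ} {M E : Type*}
  [TopologicalSpace M] [ChartedSpace (Euc m) M]
  [TopologicalSpace E] [ChartedSpace (Euc (m + n)) E] {π : E → M}
  [IsManifold 𝓘(ℝ, Euc m) ∞ M] [IsManifold 𝓘(ℝ, Euc (m + n)) ∞ E] [IsFiberedManifold m n π]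

namespace AdaptedChart
variable (c : AdaptedChart m n π)

/-- The natural chart of `W`. -/
def phaseHomeo : OpenPartialHomeomorph (PhaseSpace m n π) (PhaseModel m n) :=
  (symFibreCoord (π := π)).toAtlas.toCore.openPartialHomeomorph (symFibreCoord.chart c) ⟨c, rfl⟩

/-- The natural chart of `W_r`. -/
def reducedHomeo : OpenPartialHomeomorph (ReducedPhaseSpace m n π) (ReducedPhaseModel m n) :=
  (redFibreCoord (π := π)).toAtlas.toCore.openPartialHomeomorph (redFibreCoord.chart c) ⟨c, rfl⟩

theorem phaseHomeo_mem :
    c.phaseHomeo ∈ IsManifold.maximalAtlas 𝓘(ℝ, PhaseModel m n) ∞ (PhaseSpace m n π) :=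
  IsManifold.subset_maximalAtlas
    (Set.mem_iUnion₂.2 ⟨symFibreCoord.chart c, ⟨c, rfl⟩, rfl⟩)

theorem reducedHomeo_mem : c.reducedHomeo ∈
    IsManifold.maximalAtlas 𝓘(ℝ, ReducedPhaseModel m n) ∞ (ReducedPhaseSpace m n π) :=
  IsManifold.subset_maximalAtlas
    (Set.mem_iUnion₂.2 ⟨redFibreCoord.chart c, ⟨c, rfl⟩, rfl⟩)

theorem phaseHomeo_apply (w : PhaseSpace m n π) :
    c.phaseHomeo w = (c.jetCoord 3 w.jet, symFibreCoord.toFibre c w) := rfl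

/-- In natural charts `μ_W` is the quotient map of the model fibres. -/
theorem reducedHomeo_toReduced {w : PhaseSpace m n π} (h : w ∈ c.phaseHomeo.source) :
    c.reducedHomeo w.toReduced = ((c.phaseHomeo w).1, DagModel.toDdag m n (c.phaseHomeo w).2) := by
  refine Prod.ext rfl ?_
  change redFibreCoord.toFibre c w.toReduced = DagModel.toDdag m n (symFibreCoord.toFibre c w)
  rw [redFibreCoord.toFibre_of_mem c (w := w.toReduced) h, symFibreCoord.toFibre_of_mem c h]
  rfl

theorem _root_.PhaseSpace.contMDiff_toReduced :
    ContMDiff 𝓘(ℝ, PhaseModel m n) 𝓘(ℝ, ReducedPhaseModel m n) ∞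
      (PhaseSpace.toReduced : PhaseSpace m n π → ReducedPhaseSpace m n π) := by
  intro w
  obtain ⟨c, hc⟩ := exists_adaptedChart (m := m) (n := n) π w.jet.target
  have hw : w ∈ c.phaseHomeo.source := hc
  have h1 := contMDiffAt_of_mem_maximalAtlas c.phaseHomeo_mem hw
  have h2 : ContDiff ℝ ∞ fun p : PhaseModel m n => (p.1, DagModel.toDdag m n p.2) :=
    contDiff_fst.prodMk ((DagModel.toDdag m n).contDiff.comp contDiff_snd)
  have hr : w.toReduced ∈ c.reducedHomeo.source := hc
  have h3 : ContMDiffAt 𝓘(ℝ, ReducedPhaseModel m n) 𝓘(ℝ, ReducedPhaseModel m n) ∞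
      c.reducedHomeo.symm ((c.phaseHomeo w).1, DagModel.toDdag m n (c.phaseHomeo w).2) :=
    contMDiffAt_symm_of_mem_maximalAtlas c.reducedHomeo_mem
      (by rw [← c.reducedHomeo_toReduced hw]; exact c.reducedHomeo.map_source hr)
  refine (h3.comp w (h2.contMDiff.contMDiffAt.comp w h1)).congr_of_eventuallyEq ?_
  filter_upwards [c.phaseHomeo.open_source.mem_nhds hw] with y hy
  change y.toReduced = c.reducedHomeo.symm (_, _)
  rw [← c.reducedHomeo_toReduced hy]
  exact (c.reducedHomeo.left_inv (show y.toReduced ∈ c.reducedHomeo.source from hy)).symm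

variable (η : (x : M) → TangentSpace 𝓘(ℝ, Euc m) x [⋀^Fin m]→L[ℝ] ℝ) (L : Jet m n π 2 → ℝ)

/-- The Hamiltonian function in natural coordinates: the value of the coordinate `p` on `W_o`,
as a function of the remaining coordinates. -/
def hamiltonianCoeff (p : ReducedPhaseModel m n) : ℝ :=
  c.lagrangianCoeff η L p.1 - couplingCoeff p.1 (ddagSection m n p.2)

variable {η L}

theorem contDiffOn_hamiltonianCoeff (hη : IsSmoothForm η)
    (hL : ContMDiff 𝓘(ℝ, JetModel m n 2) 𝓘(ℝ, ℝ) ∞ L) :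
    ContDiffOn ℝ ∞ (c.hamiltonianCoeff η L) c.reducedHomeo.target := by
  refine ((c.contDiffOn_lagrangianCoeff hη hL).comp contDiffOn_fst fun p hp => hp).sub ?_
  have h : ContDiff ℝ ∞ fun p : ReducedPhaseModel m n => (p.1, ddagSection m n p.2) :=
    contDiff_fst.prodMk ((ddagSection m n).contDiff.comp contDiff_snd)
  exact (contDiff_couplingCoeff.comp h).contDiffOn

/-- In natural charts `W_o` is the graph of the Hamiltonian function over `W_r`. -/
theorem mem_hamiltonianSubmanifold_iff_graph {w : PhaseSpace m n π} (h : w ∈ c.phaseHomeo.source) :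
    w ∈ hamiltonianSubmanifold η L ↔ c.phaseHomeo w = phaseSplitting m n
      (c.reducedHomeo w.toReduced, c.hamiltonianCoeff η L (c.reducedHomeo w.toReduced)) := by
  rw [c.mem_hamiltonianSubmanifold_iff h, c.reducedHomeo_toReduced h, phaseHomeo_apply]
  set v := c.jetCoord 3 w.jet
  obtain ⟨⟨ū, t⟩, hu⟩ := (fibreSplitting m n).surjective (symFibreCoord.toFibre c w)
  have hū : DagModel.toDdag m n (symFibreCoord.toFibre c w) = ū := by
    rw [← hu]; exact congrArg Prod.fst ((fibreSplitting m n).symm_apply_apply (ū, t))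
  have h1 : symFibreCoord.toFibre c w = ddagSection m n ū + t • DagModel.vol m n := hu.symm
  change _ ↔ _ = phaseSplitting m n ((v, DagModel.toDdag m n (symFibreCoord.toFibre c w)),
    c.hamiltonianCoeff η L (v, DagModel.toDdag m n (symFibreCoord.toFibre c w)))
  rw [hū]
  have h2 : (v, symFibreCoord.toFibre c w) = phaseSplitting m n ((v, ū), t) := by rw [h1]; rfl
  rw [h2, (phaseSplitting m n).injective.eq_iff, h1, couplingCoeff_add_smul_vol]
  simp only [Prod.mk.injEq, true_and, hamiltonianCoeff]
  constructor <;> intro h <;> linarith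

theorem contDiffOn_shear (hη : IsSmoothForm η)
    (hL : ContMDiff 𝓘(ℝ, JetModel m n 2) 𝓘(ℝ, ℝ) ∞ L) :
    ContDiffOn ℝ ∞ (fun p : PhaseModel m n =>
        c.hamiltonianCoeff η L (p.1, DagModel.toDdag m n p.2) • DagModel.vol m n)
      c.phaseHomeo.target := by
  have h : ContDiff ℝ ∞ fun p : PhaseModel m n => (p.1, DagModel.toDdag m n p.2) :=
    contDiff_fst.prodMk ((DagModel.toDdag m n).contDiff.comp contDiff_snd)
  exact ((c.contDiffOn_hamiltonianCoeff hη hL).comp h.contDiffOn fun p hp => hp).smul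
    contDiffOn_const

variable (η L) in
/-- The change of coordinates of `W` that replaces the coordinate `p` by `p - H`, with `H` the
Hamiltonian function; it straightens `W_o`. -/
def shear (hη : IsSmoothForm η) (hL : ContMDiff 𝓘(ℝ, JetModel m n 2) 𝓘(ℝ, ℝ) ∞ L) :
    OpenPartialHomeomorph (PhaseModel m n) (PhaseModel m n) where
  toFun p := (p.1, p.2 - c.hamiltonianCoeff η L (p.1, DagModel.toDdag m n p.2) • DagModel.vol m n)
  invFun p :=
    (p.1, p.2 + c.hamiltonianCoeff η L (p.1, DagModel.toDdag m n p.2) • DagModel.vol m n)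
  source := c.phaseHomeo.target
  target := c.phaseHomeo.target
  map_source' _ h := h
  map_target' _ h := h
  left_inv' p _ := by simp [DagModel.toDdag_vol]
  right_inv' p _ := by simp [DagModel.toDdag_vol]
  open_source := c.phaseHomeo.open_target
  open_target := c.phaseHomeo.open_target
  continuousOn_toFun :=
    continuousOn_fst.prodMk (continuousOn_snd.sub (c.contDiffOn_shear hη hL).continuousOn)
  continuousOn_invFun :=
    continuousOn_fst.prodMk (continuousOn_snd.add (c.contDiffOn_shear hη hL).continuousOn)

theorem shear_phaseSplitting (hη : IsSmoothForm η)
    (hL : ContMDiff 𝓘(ℝ, JetModel m n 2) 𝓘(ℝ, ℝ) ∞ L) (p : ReducedPhaseModel m n) :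
    c.shear η L hη hL (phaseSplitting m n (p, c.hamiltonianCoeff η L p))
      = phaseSplitting m n (p, 0) := by
  have h : DagModel.toDdag m n (ddagSection m n p.2 + c.hamiltonianCoeff η L p • DagModel.vol m n)
      = p.2 := by
    rw [map_add, map_smul, toDdag_ddagSection, DagModel.toDdag_vol, smul_zero, add_zero]
  rw [phaseSplitting_apply, phaseSplitting_apply]
  refine Prod.ext rfl ?_
  change _ - c.hamiltonianCoeff η L (p.1, DagModel.toDdag m n _) • _ = _
  rw [h, add_sub_cancel_right, zero_smul, add_zero]

/-- The natural chart of `W` straightened along `W_o`. -/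
theorem phaseHomeo_trans_shear_mem (hη : IsSmoothForm η)
    (hL : ContMDiff 𝓘(ℝ, JetModel m n 2) 𝓘(ℝ, ℝ) ∞ L) :
    c.phaseHomeo.trans (c.shear η L hη hL) ∈
      IsManifold.maximalAtlas 𝓘(ℝ, PhaseModel m n) ∞ (PhaseSpace m n π) := by
  have h1 : ContDiffOn ℝ ∞ (c.shear η L hη hL) c.phaseHomeo.target :=
    contDiffOn_fst.prodMk (contDiffOn_snd.sub (c.contDiffOn_shear hη hL))
  have h2 : ContDiffOn ℝ ∞ (c.shear η L hη hL).symm c.phaseHomeo.target :=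
    contDiffOn_fst.prodMk (contDiffOn_snd.add (c.contDiffOn_shear hη hL))
  refine OpenPartialHomeomorph.mem_maximalAtlas_of_contMDiffOn _ ?_ ?_
  · exact h1.contMDiffOn.comp ((contMDiffOn_of_mem_maximalAtlas c.phaseHomeo_mem).mono
      fun x hx => hx.1) fun x hx => hx.2
  · exact (contMDiffOn_symm_of_mem_maximalAtlas c.phaseHomeo_mem).comp
      (h2.contMDiffOn.mono fun x hx => hx.1) fun x hx => hx.2

end AdaptedChart

open AdaptedChart
variable {η : (x : M) → TangentSpace 𝓘(ℝ, Euc m) x [⋀^Fin m]→L[ℝ] ℝ} {L : Jet m n π 2 → ℝ}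

variable (η L) in
/-- Each fibre of `μ_W` meets `W_o` in exactly one point: on a fibre the equation of `W_o` fixes
the coordinate `p`, on which the coupling form depends affinely with slope one. -/
theorem existsUnique_hamiltonianSubmanifold (r : ReducedPhaseSpace m n π) :
    ∃! w : PhaseSpace m n π, w ∈ hamiltonianSubmanifold η L ∧ w.toReduced = r := by
  obtain ⟨c, hc⟩ := exists_adaptedChart (m := m) (n := n) π r.jet.target
  have hr : r ∈ c.reducedHomeo.source := hc
  have hsrc : ∀ w : PhaseSpace m n π, w.toReduced = r → w ∈ c.phaseHomeo.source := by
    rintro w rfl; exact hc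
  set p : PhaseModel m n :=
    phaseSplitting m n (c.reducedHomeo r, c.hamiltonianCoeff η L (c.reducedHomeo r)) with hp
  have hpt : p ∈ c.phaseHomeo.target := c.reducedHomeo.map_source hr
  have hred : (c.phaseHomeo.symm p).toReduced = r := by
    have hs := c.phaseHomeo.map_target hpt
    refine c.reducedHomeo.injOn (show _ ∈ c.reducedHomeo.source from hs) hr ?_
    rw [c.reducedHomeo_toReduced hs, c.phaseHomeo.right_inv hpt, hp, phaseSplitting_apply]
    refine Prod.ext rfl ?_
    simp [toDdag_ddagSection, DagModel.toDdag_vol]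
  refine ⟨c.phaseHomeo.symm p, ⟨?_, hred⟩, ?_⟩
  · rw [c.mem_hamiltonianSubmanifold_iff_graph (c.phaseHomeo.map_target hpt), hred,
      c.phaseHomeo.right_inv hpt]
  · rintro w ⟨hw, hwr⟩
    rw [c.mem_hamiltonianSubmanifold_iff_graph (hsrc w hwr), hwr, ← hp] at hw
    rw [← hw, c.phaseHomeo.left_inv (hsrc w hwr)]

variable (η L) in
/-- The Hamiltonian section `ĥ : W_r → W`: the point of `W_o` over a point of `W_r`. -/
def hamiltonianSection (r : ReducedPhaseSpace m n π) : PhaseSpace m n π :=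
  (existsUnique_hamiltonianSubmanifold η L r).choose

theorem hamiltonianSection_mem (r : ReducedPhaseSpace m n π) :
    hamiltonianSection η L r ∈ hamiltonianSubmanifold η L :=
  (existsUnique_hamiltonianSubmanifold η L r).choose_spec.1.1

theorem toReduced_hamiltonianSection (r : ReducedPhaseSpace m n π) :
    (hamiltonianSection η L r).toReduced = r :=
  (existsUnique_hamiltonianSubmanifold η L r).choose_spec.1.2

theorem range_hamiltonianSection :
    Set.range (hamiltonianSection η L) = hamiltonianSubmanifold η L := by
  refine Set.Subset.antisymm (Set.range_subset_iff.2 hamiltonianSection_mem) fun w hw => ?_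
  exact ⟨w.toReduced, ((existsUnique_hamiltonianSubmanifold η L w.toReduced).choose_spec.2 w
    ⟨hw, rfl⟩).symm⟩

/-- In the straightened charts the Hamiltonian section is the inclusion `p ↦ (p, 0)`. -/
theorem isImmersion_hamiltonianSection (hη : IsSmoothForm η)
    (hL : ContMDiff 𝓘(ℝ, JetModel m n 2) 𝓘(ℝ, ℝ) ∞ L) :
    IsImmersionOfComplement ℝ 𝓘(ℝ, ReducedPhaseModel m n) 𝓘(ℝ, PhaseModel m n) ∞
      (hamiltonianSection η L) := by
  intro r
  obtain ⟨c, hc⟩ := exists_adaptedChart (m := m) (n := n) π r.jet.target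
  have hsrc : ∀ r ∈ c.reducedHomeo.source, hamiltonianSection η L r ∈ c.phaseHomeo.source := by
    intro r hr
    rw [← toReduced_hamiltonianSection (η := η) (L := L) r] at hr
    exact hr
  have hsrc' : ∀ r ∈ c.reducedHomeo.source,
      hamiltonianSection η L r ∈ (c.phaseHomeo.trans (c.shear η L hη hL)).source := fun r hr =>
    ⟨hsrc r hr, c.phaseHomeo.map_source (hsrc r hr)⟩
  refine IsImmersionAtOfComplement.mk_of_charts (phaseSplitting m n) c.reducedHomeo
    (c.phaseHomeo.trans (c.shear η L hη hL)) hc (hsrc' r hc) c.reducedHomeo_mem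
    (c.phaseHomeo_trans_shear_mem hη hL) hsrc' ?_
  intro p hp
  have hp' : p ∈ c.reducedHomeo.target := by simpa using hp
  have hps := c.reducedHomeo.map_target hp'
  have h1 := (c.mem_hamiltonianSubmanifold_iff_graph (hsrc _ hps)).1
    (hamiltonianSection_mem (η := η) (L := L) (c.reducedHomeo.symm p))
  rw [toReduced_hamiltonianSection, c.reducedHomeo.right_inv hp'] at h1
  change c.shear η L hη hL (c.phaseHomeo (hamiltonianSection η L (c.reducedHomeo.symm p)))
    = phaseSplitting m n (p, 0)
  rw [h1, c.shear_phaseSplitting]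

end HamiltonianSection

end

theorem mainTheorem3 (m n : ℕ) {M E : Type*}
    [TopologicalSpace M] [ChartedSpace (Euc m) M] [IsManifold 𝓘(ℝ, Euc m) ∞ M]
    [TopologicalSpace E] [ChartedSpace (Euc (m + n)) E] [IsManifold 𝓘(ℝ, Euc (m + n)) ∞ E]
    (π : E → M) [IsFiberedManifold m n π]
    (η : (x : M) → TangentSpace 𝓘(ℝ, Euc m) x [⋀^Fin m]→L[ℝ] ℝ)
    (hη : IsSmoothForm η) (hη₀ : ∀ x, η x ≠ 0)
    (L : Jet m n π 2 → ℝ) (hL : ContMDiff 𝓘(ℝ, JetModel m n 2) 𝓘(ℝ, ℝ) ∞ L) :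
    ∃ _ : ChartedSpace (ReducedPhaseModel m n) (hamiltonianSubmanifold η L),
      IsManifold 𝓘(ℝ, ReducedPhaseModel m n) ∞ (hamiltonianSubmanifold η L) ∧
      Manifold.IsSmoothEmbedding 𝓘(ℝ, ReducedPhaseModel m n) 𝓘(ℝ, PhaseModel m n) ∞
        (Subtype.val : hamiltonianSubmanifold η L → PhaseSpace m n π) ∧
      Manifold.IsImmersionOfComplement ℝ 𝓘(ℝ, ReducedPhaseModel m n) 𝓘(ℝ, PhaseModel m n) ∞
        (Subtype.val : hamiltonianSubmanifold η L → PhaseSpace m n π) ∧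
      ContMDiff 𝓘(ℝ, PhaseModel m n) 𝓘(ℝ, ReducedPhaseModel m n) ∞
        (PhaseSpace.toReduced : PhaseSpace m n π → ReducedPhaseSpace m n π) ∧
      (∀ w : hamiltonianSubmanifold η L,
        IsCompl
          (LinearMap.range (mfderiv 𝓘(ℝ, ReducedPhaseModel m n) 𝓘(ℝ, PhaseModel m n)
            (Subtype.val : hamiltonianSubmanifold η L → PhaseSpace m n π) w).toLinearMap)
          (LinearMap.ker (mfderiv 𝓘(ℝ, PhaseModel m n) 𝓘(ℝ, ReducedPhaseModel m n)
            (PhaseSpace.toReduced : PhaseSpace m n π → ReducedPhaseSpace m n π)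
            w.1).toLinearMap)) ∧
      ∃ Φ : Diffeomorph 𝓘(ℝ, ReducedPhaseModel m n) 𝓘(ℝ, ReducedPhaseModel m n)
          (hamiltonianSubmanifold η L) (ReducedPhaseSpace m n π) ∞,
        (∀ w, Φ w = PhaseSpace.toReduced w.1) ∧
        ∃ h : ReducedPhaseSpace m n π → PhaseSpace m n π,
          (∀ r, h r = (Φ.symm r).1) ∧
          ContMDiff 𝓘(ℝ, ReducedPhaseModel m n) 𝓘(ℝ, PhaseModel m n) ∞ h ∧
          ∀ r, (h r).toReduced = r := by
  exact exists_chartedSpace_range_section PhaseSpace.contMDiff_toReduced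
    (isImmersion_hamiltonianSection hη hL) toReduced_hamiltonianSection range_hamiltonianSection
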